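/- Let $p,q\ge 0$ be integers and let $(Z_t)_{t\in\mathbb Z}$ be i.i.d. real random variables with $\mathbb E Z_0=0$, $\mathbb E Z_0^2=1$; put $\mathcal F_t=\sigma(Z_k;k\le t)$. For $\theta=(\alpha_0,\alpha_1,\dots,\alpha_p,\beta_1,\dots,\beta_q,\gamma)$, $x\in\mathbb R^p$ and $s\in[0,\infty)^q$ write $$g_\theta(x,s)=\alpha_0+\sum_{i=1}^p\alpha_i(|x_i|-\gamma x_i)^2+\sum_{j=1}^q\beta_j s_j .$$ Let $B=\{(\beta_1,\dots,\beta_q)\in[0,1)^q:\sum_{j=1}^q\beta_j<1\}$, let $K\subset(0,\infty)\times[0,\infty)^p\times B\times[-1,1]$ be compact, and let $\theta_0=(\alpha_0^\circ,\alpha_1^\circ,\dots,\alpha_p^\circ,\beta_1^\circ,\dots,\beta_q^\circ,\gamma^\circ)\in K$. Let $((X_t,\sigma_t))_{t\in\mathbb Z}$ be a stationary AGARCH$(p,q)$ process with parameter $\theta_0$ (a GARCH$(p,q)$ process if $\gamma^\circ=0$), that is, a strictly stationary sequence with $\sigma_t\ge 0$, $\sigma_t$ (a.s. equal to an) $\mathcal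 F_{t-1}$-measurable random variable, and, almost surely for all $t\in\mathbb Z$, $$X_t=\sigma_tZ_t,\qquad \sigma_t^2=g_{\theta_0}(X_{t-1},\dots,X_{t-p};\sigma_{t-1}^2,\dots,\sigma_{t-q}^2).$$ Suppose that 1. $\alpha_i^\circ>0$ for some $i\in\{1,\dots,p\}$ and, if $q\ge1$, $(\alpha_p^\circ,\beta_q^\circ)\ne(0,0)$; 2. the polynomials $a^\circ(z)=\sum_{i=1}^p\alpha_i^\circ z^i$ and $b^\circ(z)=1-\sum_{j=1}^q\beta_j^\circ z^j$ have no common zeros in $\mathbb C$; 3. the distribution of $Z_0$ is not concentrated at two points: there are no $a,b\in\mathbb R$ with $\mathbb P(Z_0\in\{a,b\})=1$. Fix any initial vector $\varsigma\in[0,\infty)^q$. For $\theta\in K$ set $(\hat h_0(\theta),\hat h_{-1}(\theta),\dots,\hat h_{-q+1}(\theta))=\varsigma$ and, for $t\ge1$, $$\hat h_t(\theta)=g_\theta(X_{t-1},\dots,X_{t-p};\hat h_{t-1}(\theta),\dots,\hat h_{t-q}(\theta)),\qquad \hat L_n(\theta)=-\frac12\sum_{t=1}^n\Big(\frac{X_t^2}{\hat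 h_t(\theta)}+\log\hat h_t(\theta)\Big).$$ Then $\hat L_n$ attains its maximum over $K$ for every $n$ and every outcome, and the quasi-maximum-likelihood estimator is strongly consistent: if, for every $n\ge1$, $\hat\theta_n\in K$ almost surely maximizes $\hat L_n$ over $K$, then $\hat\theta_n\to\theta_0$ almost surely as $n\to\infty$. -/

import Mathlib

open Filter Topology MeasureTheory ProbabilityTheory

noncomputable section

/-- Parameter vectors `θ = (α₀, (α₁, …, α_p), (β₁, …, β_q), γ)` of the AGARCH(p, q) model.
The entry of index `i` of the second (third) component is `α_{i+1}` (`β_{i+1}`). -/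
abbrev AGARCHParam (p q : ℕ) : Type := ℝ × (Fin p → ℝ) × (Fin q → ℝ) × ℝ

namespace AGARCHParam

variable {p q : ℕ}

/-- The constant coefficient `α₀`. -/
def alphaZero (θ : AGARCHParam p q) : ℝ := θ.1

/-- The coefficients `α₁, …, α_p`. -/
def alpha (θ : AGARCHParam p q) : Fin p → ℝ := θ.2.1

/-- The coefficients `β₁, …, β_q`. -/
def beta (θ : AGARCHParam p q) : Fin q → ℝ := θ.2.2.1

/-- The asymmetry parameter `γ`. -/
def gamma (θ : AGARCHParam p q) : ℝ := θ.2.2.2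

/-- The parameter space `(0, ∞) × [0, ∞)^p × B × [-1, 1]`, where
`B = {β ∈ [0, 1)^q | β₁ + ⋯ + β_q < 1}`. -/
def space (p q : ℕ) : Set (AGARCHParam p q) :=
  {θ | 0 < θ.alphaZero ∧ (∀ i, 0 ≤ θ.alpha i) ∧
    ((∀ j, 0 ≤ θ.beta j ∧ θ.beta j < 1) ∧ ∑ j, θ.beta j < 1) ∧
    -1 ≤ θ.gamma ∧ θ.gamma ≤ 1}

/-- The polynomial function `a(z) = α₁ z + ⋯ + α_p z^p`. -/
def aPoly (θ : AGARCHParam p q) (z : ℂ) : ℂ :=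
  ∑ i : Fin p, (θ.alpha i : ℂ) * z ^ ((i : ℕ) + 1)

/-- The polynomial function `b(z) = 1 - β₁ z - ⋯ - β_q z^q`. -/
def bPoly (θ : AGARCHParam p q) (z : ℂ) : ℂ :=
  1 - ∑ j : Fin q, (θ.beta j : ℂ) * z ^ ((j : ℕ) + 1)

/-- The squared volatility as a function of the last `p` observations `x` and the last `q`
squared volatilities `s` (most recent first):
`g_θ(x, s) = α₀ + ∑ α_i (|x_i| - γ x_i)² + ∑ β_j s_j`. -/
def volMap (θ : AGARCHParam p q) (x : Fin p → ℝ) (s : Fin q → ℝ) : ℝ :=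
  θ.alphaZero + ∑ i, θ.alpha i * (|x i| - θ.gamma * x i) ^ 2 + ∑ j, θ.beta j * s j

end AGARCHParam

/-- The vector `(y_t, y_{t-1}, …, y_{t-k+1})`. -/
def lagVec (y : ℤ → ℝ) (k : ℕ) (t : ℤ) : Fin k → ℝ := fun i => y (t - ((i : ℕ) : ℤ))

/-- `(Z_t)` is an i.i.d. sequence of random variables with mean zero and variance one. -/
structure IsStandardNoise {Ω : Type*} [MeasurableSpace Ω] (μ : Measure Ω)
    (Z : ℤ → Ω → ℝ) : Prop where
  measurable : ∀ t, Measurable (Z t)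
  indep : iIndepFun Z μ
  identDistrib : ∀ t, IdentDistrib (Z t) (Z 0) μ μ
  memLp : MemLp (Z 0) 2 μ
  mean : ∫ ω, Z 0 ω ∂μ = 0
  secondMoment : ∫ ω, Z 0 ω ^ 2 ∂μ = 1

/-- Strict stationarity of a sequence of random elements indexed by `ℤ`: the law of the whole
sequence is invariant under every time shift. -/
def IsStrictlyStationary {Ω E : Type*} [MeasurableSpace Ω] [MeasurableSpace E] (μ : Measure Ω)
    (V : ℤ → Ω → E) : Prop :=
  ∀ h : ℤ, IdentDistrib (fun ω (t : ℤ) => V (t + h) ω) (fun ω (t : ℤ) => V t ω) μ μ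

/-- The σ-field `ℱ_t = σ(Z_k; k ≤ t)`. -/
@[reducible] def noisePast {Ω : Type*} (Z : ℤ → Ω → ℝ) (t : ℤ) : MeasurableSpace Ω :=
  ⨆ k : {k : ℤ // k ≤ t}, MeasurableSpace.comap (Z k) inferInstance

/-- `((X_t, σ_t))` is a strictly stationary solution, driven by the noise `(Z_t)`, of the
AGARCH(p, q) equations with parameter `θ`; the volatility `σ_t` is nonnegative and, up to null
sets, measurable with respect to `ℱ_{t-1}`. -/
structure IsStationaryAGARCH {Ω : Type*} [MeasurableSpace Ω] (μ : Measure Ω) {p q : ℕ}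
    (θ : AGARCHParam p q) (Z X σ : ℤ → Ω → ℝ) : Prop where
  noise : IsStandardNoise μ Z
  measurable_obs : ∀ t, Measurable (X t)
  measurable_vol : ∀ t, Measurable (σ t)
  vol_nonneg : ∀ t, ∀ᵐ ω ∂μ, 0 ≤ σ t ω
  vol_adapted : ∀ t, ∃ f : Ω → ℝ, Measurable[noisePast Z (t - 1)] f ∧ σ t =ᵐ[μ] f
  stationary : IsStrictlyStationary μ (fun t ω => (X t ω, σ t ω))
  obs_eq : ∀ t, ∀ᵐ ω ∂μ, X t ω = σ t ω * Z t ω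
  vol_eq : ∀ t, ∀ᵐ ω ∂μ, σ t ω ^ 2 =
    θ.volMap (lagVec (fun s => X s ω) p (t - 1)) (lagVec (fun s => σ s ω ^ 2) q (t - 1))

namespace AGARCHParam

variable {p q : ℕ}

/-- The vector `(ĥ_t(θ), …, ĥ_{t-q+1}(θ))`, `t ≥ 0`, computed recursively from the observed
path `x` and the initial value `ς`:
it equals `ς` at `t = 0`, and a step prepends `g_θ(x_t, …, x_{t-p+1}; ĥ_t, …, ĥ_{t-q+1})`
and drops the oldest entry. -/
def hHatVec (θ : AGARCHParam p q) (ς : Fin q → ℝ) (x : ℤ → ℝ) : ℕ → Fin q → ℝ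
  | 0 => ς
  | t + 1 => fun j =>
      Matrix.vecCons (θ.volMap (lagVec x p (t : ℤ)) (hHatVec θ ς x t)) (hHatVec θ ς x t)
        j.castSucc

/-- The value `ĥ_{t+1}(θ) = g_θ(x_t, …, x_{t-p+1}; ĥ_t(θ), …, ĥ_{t-q+1}(θ))`, `t ≥ 0`.
For `q ≥ 1` it is the first coordinate of the vector at time `t + 1`. -/
def hHatSucc (θ : AGARCHParam p q) (ς : Fin q → ℝ) (x : ℤ → ℝ) (t : ℕ) : ℝ :=
  θ.volMap (lagVec x p (t : ℤ)) (θ.hHatVec ς x t)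

/-- The conditional Gaussian log-likelihood
`L̂_n(θ) = -(1/2) ∑_{t=1}^n (x_t² / ĥ_t(θ) + log ĥ_t(θ))`; the summation variable is `t - 1`. -/
def logLik (ς : Fin q → ℝ) (x : ℤ → ℝ) (n : ℕ) (θ : AGARCHParam p q) : ℝ :=
  -(1 / 2) * ∑ t ∈ Finset.range n,
    (x ((t : ℤ) + 1) ^ 2 / θ.hHatSucc ς x t + Real.log (θ.hHatSucc ς x t))

/-- `θ` is a value of the quasi-maximum-likelihood estimator on `K` computed from
`x_{-p+1}, …, x_n`: a maximizer of `L̂_n` over `K`. -/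
def IsQMLE (K : Set (AGARCHParam p q)) (ς : Fin q → ℝ) (x : ℤ → ℝ) (n : ℕ)
    (θ : AGARCHParam p q) : Prop :=
  θ ∈ K ∧ IsMaxOn (logLik ς x n) K θ

end AGARCHParam

end

open Filter Topology MeasureTheory ProbabilityTheory

noncomputable section

/-! Let h_t(θ) (`statVol`) be the stationary solution of the volatility recursion with parameter θ
driven by the observations: an explicit series in the past shocks, with the coefficients of a(z)/(z
b(z)). The β-sums are bounded away from 1 on the compact set K, so ĥ_t(θ) forgets its initial values
exponentially fast, uniformly in θ. Hence -2 L̂_n(θ) differs from the sum of X_t²/h_t(θ) + log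
h_t(θ) by a bounded amount (`exists_abs_logLik_add_statLoss_le`), while h_t(θ₀) is the true squared
volatility (`ae_sq_vol_eq_statVol`).

Since Z_0 is independent of the past and E Z_0² = 1, the mean loss at θ is E[log h_0(θ) +
h_0(θ₀)/h_0(θ)]. The inequality log r ≤ r - 1, strict for r ≠ 1, makes θ₀ strictly better than every
θ for which h_0(θ) and h_0(θ₀) are not almost surely equal (`lintegral_loss_lt`). Almost sure
equality forces θ = θ₀ (`eq_of_ae_statVol_eq`): in the difference of the two series the term with
the newest innovation would be determined by older ones, hence degenerate, hence zero because Z_0 is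
centred and not concentrated at two points. Peeling off one lag after another identifies all
coefficients, and coprimality with the degree condition recovers a and b.

The passage to the maximizer is Wald's argument. Near θ₁ ≠ θ₀ the loss is bounded below by a
truncated local floor whose mean still exceeds the mean loss at θ₀. Then only a one-sided ergodic
statement is needed: Birkhoff sums of a function with negative mean are bounded above
(`Ergodic.ae_bddAbove_birkhoffSum`). Compactness does the rest (`ae_eventually_logLik_lt`). No
moment is required of the loss at θ₁.

The hard analytic input is a fractional moment of σ_0² (`exists_lintegral_vol_rpow_ne_top`),
obtained from stationarity alone. The squared volatility solves a linear recursion with random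
coefficients and constant term α₀ > 0. That constant makes the response to initial values decay
exponentially relative to the solution (`impulseResp_le`), and by stationarity the solution grows
subexponentially along a subsequence. So for some n the n-th root of the response has mean below
one, and 1/n is the exponent. -/

/-! ### An ergodic theorem -/

/-- The running maximum `max(0, S_1, …, S_n)` of Birkhoff sums. -/
def birkhoffMax {α : Type*} (T : α → α) (f : α → ℝ) : ℕ → α → ℝ
  | 0 => fun _ => 0
  | n + 1 => fun x => max 0 (f x + birkhoffMax T f n (T x))

namespace birkhoffMax

variable {α : Type*} {T : α → α} {f : α → ℝ}

theorem nonneg (n : ℕ) (x : α) : 0 ≤ birkhoffMax T f n x := by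
  cases n with
  | zero => exact le_rfl
  | succ n => exact le_max_left _ _

theorem le_succ (n : ℕ) (x : α) : birkhoffMax T f n x ≤ birkhoffMax T f (n + 1) x := by
  induction n generalizing x with
  | zero => exact nonneg _ x
  | succ n ih => exact max_le_max le_rfl (by simpa using ih (T x))

theorem monotone (x : α) : Monotone fun n => birkhoffMax T f n x :=
  monotone_nat_of_le_succ fun n => le_succ n x

theorem birkhoffSum_le (n : ℕ) (x : α) : birkhoffSum T f n x ≤ birkhoffMax T f n x := by
  induction n generalizing x with
  | zero => simp [birkhoffMax]
  | succ n ih =>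
    rw [birkhoffSum_succ']
    exact (add_le_add_right (ih (T x)) _).trans (le_max_right _ _)

theorem measurable [MeasurableSpace α] (hT : Measurable T) (hf : Measurable f) (n : ℕ) :
    Measurable (birkhoffMax T f n) := by
  induction n with
  | zero => exact measurable_const
  | succ n ih => exact measurable_const.max (hf.add (ih.comp hT))

theorem integrable [MeasurableSpace α] {ν : Measure α} [IsFiniteMeasure ν]
    (hT : MeasurePreserving T ν ν) (hf : Integrable f ν) (n : ℕ) :
    Integrable (birkhoffMax T f n) ν := by
  induction n with
  | zero => exact integrable_const 0
  | succ n ih =>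
    have := (hf.add (hT.integrable_comp_of_integrable ih)).pos_part
    refine this.congr (ae_of_all _ fun x => ?_)
    simp [birkhoffMax, max_comm]

/-- Makes the set of points with bounded running maxima exactly `T`-invariant, so that ergodicity
applies to it. -/
theorem bddAbove_iff (x : α) :
    BddAbove (Set.range fun n => birkhoffMax T f n (T x)) ↔
      BddAbove (Set.range fun n => birkhoffMax T f n x) := by
  constructor
  · rintro ⟨C, hC⟩
    refine ⟨max 0 (f x + C), ?_⟩
    rintro _ ⟨n, rfl⟩
    refine (le_succ n x).trans (max_le_max le_rfl ?_)
    exact add_le_add_right (hC ⟨n, rfl⟩) _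
  · rintro ⟨C, hC⟩
    refine ⟨C - f x, ?_⟩
    rintro _ ⟨n, rfl⟩
    have := (le_max_right 0 (f x + birkhoffMax T f n (T x))).trans (hC ⟨n + 1, rfl⟩)
    dsimp only
    linarith

/-- Once the maximum at `T x` exceeds `-f x` the difference is exactly `f x`, and in any case it is
at most `|f x|` in absolute value. These are the limit and the domination used below. -/
theorem succ_sub (n : ℕ) (x : α) :
    birkhoffMax T f (n + 1) x - birkhoffMax T f n (T x) =
      max (-birkhoffMax T f n (T x)) (f x) := by
  change max 0 (f x + birkhoffMax T f n (T x)) - _ = _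
  rw [← max_sub_sub_right]
  simp

end birkhoffMax

/-- If `T` is ergodic and `∫ f < 0`, then almost every sequence of Birkhoff sums of `f` is bounded
above. -/
theorem Ergodic.ae_bddAbove_birkhoffSum {α : Type*} [MeasurableSpace α] {T : α → α}
    {ν : Measure α} [IsProbabilityMeasure ν] (hT : Ergodic T ν) {f : α → ℝ} (hfm : Measurable f)
    (hf : Integrable f ν) (hneg : ∫ x, f x ∂ν < 0) :
    ∀ᵐ x ∂ν, BddAbove (Set.range fun n => birkhoffSum T f n x) := by
  -- If the running maxima M_n were unbounded almost everywhere, M_{n+1} - M_n ∘ T would converge to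
  -- `f` under the domination `|f|`. Its integrals are nonnegative, because M_n increases with n and
  -- `T` preserves `ν`, which contradicts the negative mean.
  have hM := birkhoffMax.measurable hT.measurable hfm
  set A : Set α := {x | BddAbove (Set.range fun n => birkhoffMax T f n x)} with hA
  have hAm : MeasurableSet A := measurableSet_bddAbove_range hM
  have hAinv : T ⁻¹' A = A := Set.ext fun x => birkhoffMax.bddAbove_iff x
  have key : ∀ᵐ x ∂ν, x ∈ A := by
    rcases hT.toPreErgodic.ae_empty_or_univ hAm hAinv with h | h
    · exfalso
      have hlim : ∀ᵐ x ∂ν, Tendsto (fun n => birkhoffMax T f (n + 1) x - birkhoffMax T f n (T x))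
          atTop (𝓝 (f x)) := by
        filter_upwards [h] with x hx
        have hx' : ¬ BddAbove (Set.range fun n => birkhoffMax T f n (T x)) := by
          rw [birkhoffMax.bddAbove_iff]
          intro hb
          exact (iff_of_eq hx).1 hb
        have htop : Tendsto (fun n => birkhoffMax T f n (T x)) atTop atTop :=
          tendsto_atTop_atTop_of_monotone (birkhoffMax.monotone (T x)) fun b => by
            obtain ⟨_, ⟨n, rfl⟩, hn⟩ := not_bddAbove_iff.1 hx' b
            exact ⟨n, hn.le⟩
        refine tendsto_const_nhds.congr' ?_
        filter_upwards [htop.eventually_ge_atTop (-f x)] with n hn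
        rw [birkhoffMax.succ_sub, max_eq_right (by linarith)]
      have hint : ∀ n, 0 ≤ ∫ x, (birkhoffMax T f (n + 1) x - birkhoffMax T f n (T x)) ∂ν := by
        intro n
        have h1 := birkhoffMax.integrable hT.toMeasurePreserving hf n
        have h3 : Integrable (fun x => birkhoffMax T f n (T x)) ν :=
          hT.toMeasurePreserving.integrable_comp_of_integrable h1
        rw [integral_sub (birkhoffMax.integrable hT.toMeasurePreserving hf (n + 1)) h3,
          sub_nonneg]
        have h2 : ∫ x, birkhoffMax T f n (T x) ∂ν = ∫ x, birkhoffMax T f n x ∂ν := by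
          rw [← integral_map (φ := T) hT.measurable.aemeasurable
            (by rw [hT.map_eq]; exact h1.aestronglyMeasurable), hT.map_eq]
        rw [h2]
        exact integral_mono h1 (birkhoffMax.integrable hT.toMeasurePreserving hf (n + 1))
          fun x => birkhoffMax.le_succ n x
      have hconv := tendsto_integral_of_dominated_convergence (fun x => |f x|)
        (fun n => ((hM (n + 1)).sub ((hM n).comp hT.measurable)).aestronglyMeasurable)
        hf.abs (fun n => ae_of_all _ fun x => ?_) hlim
      · exact absurd (ge_of_tendsto' hconv hint) (not_le.2 hneg)
      · simp only [Function.comp, Pi.sub_apply]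
        rw [Real.norm_eq_abs, birkhoffMax.succ_sub]
        have h0 := birkhoffMax.nonneg (T := T) (f := f) n (T x)
        rcases le_total 0 (f x) with hx | hx
        · rw [max_eq_right (by linarith)]
        · rw [abs_of_nonpos (max_le (by linarith) hx), abs_of_nonpos hx]
          exact neg_le_neg (le_max_right _ _)
    · filter_upwards [h] with x hx
      exact (iff_of_eq hx).2 trivial
  filter_upwards [key] with x hx
  obtain ⟨C, hC⟩ := hx
  refine ⟨C, ?_⟩
  rintro _ ⟨n, rfl⟩
  exact (birkhoffMax.birkhoffSum_le n x).trans (hC ⟨n, rfl⟩)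

/-! ### Shifts of two-sided paths and ergodicity of stationary sequences adapted to independent
noise -/

/-- The translation by `h` on two-sided sequences. -/
def pathShift {E : Type*} (h : ℤ) (w : ℤ → E) : ℤ → E := fun t => w (t + h)

theorem measurable_pathShift {E : Type*} [MeasurableSpace E] (h : ℤ) :
    Measurable (pathShift (E := E) h) :=
  measurable_pi_lambda _ fun t => measurable_pi_apply (t + h)

theorem pathShift_iterate {E : Type*} (n : ℕ) (w : ℤ → E) :
    (pathShift 1)^[n] w = pathShift n w := by
  induction n generalizing w with
  | zero => funext t; simp [pathShift]
  | succ n ih =>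
    rw [Function.iterate_succ_apply, ih]
    funext t
    simp only [pathShift]
    congr 1
    push_cast
    ring

/-- The σ-field generated by the noise after time `t`. -/
@[reducible] def noiseFuture {Ω : Type*} (Z : ℤ → Ω → ℝ) (t : ℤ) : MeasurableSpace Ω :=
  ⨆ k : {k : ℤ // t < k}, MeasurableSpace.comap (Z k) inferInstance

section noise

variable {Ω : Type*} {Z : ℤ → Ω → ℝ}

theorem noisePast_mono : Monotone (noisePast Z) := fun _ t hst =>
  iSup_le fun k => le_iSup (fun k : {k : ℤ // k ≤ t} => MeasurableSpace.comap (Z k) inferInstance)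
    ⟨k, k.2.trans hst⟩

theorem measurable_noiseFuture {t k : ℤ} (h : t < k) : Measurable[noiseFuture Z t] (Z k) :=
  (comap_measurable (Z k)).mono
    (le_iSup (fun k : {k : ℤ // t < k} => MeasurableSpace.comap (Z k) inferInstance) ⟨k, h⟩) le_rfl

theorem measurable_noisePast {t k : ℤ} (h : k ≤ t) : Measurable[noisePast Z t] (Z k) :=
  (comap_measurable (Z k)).mono
    (le_iSup (fun k : {k : ℤ // k ≤ t} => MeasurableSpace.comap (Z k) inferInstance) ⟨k, h⟩) le_rfl

variable [MeasurableSpace Ω] {μ : Measure Ω}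

theorem noisePast_le (hZm : ∀ t, Measurable (Z t)) (t : ℤ) :
    noisePast Z t ≤ ‹MeasurableSpace Ω› :=
  iSup_le fun k => (hZm k).comap_le

theorem noiseFuture_le (hZm : ∀ t, Measurable (Z t)) (t : ℤ) :
    noiseFuture Z t ≤ ‹MeasurableSpace Ω› :=
  iSup_le fun k => (hZm k).comap_le

theorem indep_noisePast_noiseFuture (hZm : ∀ t, Measurable (Z t)) (hZ : iIndepFun Z μ) (t : ℤ) :
    Indep (noisePast Z t) (noiseFuture Z t) μ := by
  have := indep_iSup_of_disjoint (fun i => (hZm i).comap_le) hZ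
    (S := Set.Iic t) (T := Set.Ioi t) (Set.disjoint_left.2 fun x (hx : x ≤ t) (hx' : t < x) => not_lt.2 hx hx')
  rw [iSup_subtype', iSup_subtype'] at this
  exact this

/-- An event which can be approximated by events of the past up to any time is trivial. -/
theorem measure_eq_zero_or_one_of_approx [IsProbabilityMeasure μ] (hZm : ∀ t, Measurable (Z t))
    (hZ : iIndepFun Z μ) {A : Set Ω} (hA : MeasurableSet A)
    (happ : ∀ t : ℤ, ∀ ε > 0, ∃ D, MeasurableSet[noisePast Z t] D ∧ μ.real (symmDiff A D) ≤ ε) :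
    μ A = 0 ∨ μ A = 1 := by
  -- An approximant from the past up to t is exactly independent of the future after t. Letting the
  -- error tend to zero transfers this to `A`.
  have hindep : ∀ t : ℤ, Indep (noiseFuture Z t) (MeasurableSpace.generateFrom {A}) μ := by
    intro t
    refine Indep.symm ?_
    refine IndepSets.indep (MeasurableSpace.generateFrom_le (by simpa using hA))
      (noiseFuture_le hZm t) (IsPiSystem.singleton A) (@MeasurableSpace.isPiSystem_measurableSet _ (noiseFuture Z t)) rfl
      (@MeasurableSpace.generateFrom_measurableSet _ (noiseFuture Z t)).symm ?_
    rw [IndepSets_iff]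
    rintro A' B hA' hB
    rw [Set.mem_singleton_iff.1 hA']
    have hB' := noiseFuture_le hZm t _ hB
    have hreal : μ.real (A ∩ B) = μ.real A * μ.real B := by
      refine eq_of_abs_sub_nonpos ?_
      refine le_of_forall_pos_le_add fun ε hε => ?_
      obtain ⟨D, hD, hAD⟩ := happ t (ε / 2) (by positivity)
      have hD' := noisePast_le hZm t _ hD
      have h1 : μ.real (D ∩ B) = μ.real D * μ.real B := by
        have := (Indep_iff _ _ μ).1 (indep_noisePast_noiseFuture hZm hZ t) D B hD hB
        simp [measureReal_def, this]
      have h2 := abs_measureReal_sub_le_measureReal_symmDiff (μ := μ) hA.nullMeasurableSet hD'.nullMeasurableSet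
      have h3 := abs_measureReal_sub_le_measureReal_symmDiff (μ := μ) (hA.inter hB').nullMeasurableSet
        (hD'.inter hB').nullMeasurableSet
      have h4 : μ.real (symmDiff (A ∩ B) (D ∩ B)) ≤ μ.real (symmDiff A D) := by
        refine measureReal_mono ?_
        intro x hx
        simp only [Set.mem_symmDiff, Set.mem_inter_iff] at hx ⊢
        tauto
      have h5 : |μ.real A * μ.real B - μ.real D * μ.real B| ≤ ε / 2 := by
        rw [← sub_mul, abs_mul, abs_of_nonneg (measureReal_nonneg (μ := μ) (s := B))]
        have := measureReal_le_one (μ := μ) (s := B)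
        nlinarith [abs_nonneg (μ.real A - μ.real D), measureReal_nonneg (μ := μ) (s := B)]
      rw [h1] at h3
      rw [abs_le] at *
      constructor <;> linarith [h3.1, h3.2, h5.1, h5.2]
    rw [← ENNReal.toReal_eq_toReal_iff' (by finiteness) (by finiteness), ENNReal.toReal_mul]
    exact hreal
  -- As t → -∞ the futures exhaust the noise, so `A` becomes independent of its own approximants,
  -- hence of itself.
  have hall : Indep (⨆ t : ℤ, noiseFuture Z t) (MeasurableSpace.generateFrom {A}) μ := by
    refine indep_iSup_of_antitone hindep (noiseFuture_le hZm)
      (MeasurableSpace.generateFrom_le (by simpa using hA)) ?_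
    intro s t hst
    exact iSup_le fun k => le_iSup
      (fun k : {k : ℤ // s < k} => MeasurableSpace.comap (Z k) inferInstance)
      ⟨k, hst.trans_lt k.2⟩
  have hsq : μ.real A = μ.real A * μ.real A := by
    refine eq_of_abs_sub_nonpos ?_
    refine le_of_forall_pos_le_add fun ε hε => ?_
    obtain ⟨D, hD, hAD⟩ := happ 0 (ε / 2) (by positivity)
    have hD' := noisePast_le hZm 0 _ hD
    have hle : noisePast Z 0 ≤ ⨆ t : ℤ, noiseFuture Z t := iSup_le fun k =>
      (measurable_noiseFuture (sub_one_lt k.1)).comap_le.trans (le_iSup (noiseFuture Z) (k.1 - 1))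
    have h1 : μ.real (D ∩ A) = μ.real D * μ.real A := by
      have := (Indep_iff _ _ μ).1 hall D A (hle _ hD)
        (MeasurableSpace.measurableSet_generateFrom rfl)
      simp [measureReal_def, this]
    have h2 := abs_measureReal_sub_le_measureReal_symmDiff (μ := μ) hA.nullMeasurableSet
      hD'.nullMeasurableSet
    have h3 := abs_measureReal_sub_le_measureReal_symmDiff (μ := μ) hA.nullMeasurableSet
      (hD'.inter hA).nullMeasurableSet
    have h4 : μ.real (symmDiff A (D ∩ A)) ≤ μ.real (symmDiff A D) := by
      refine measureReal_mono ?_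
      intro x hx
      simp only [Set.mem_symmDiff, Set.mem_inter_iff] at hx ⊢
      tauto
    have h5 : |μ.real A * μ.real A - μ.real D * μ.real A| ≤ ε / 2 := by
      rw [← sub_mul, abs_mul, abs_of_nonneg (measureReal_nonneg (μ := μ) (s := A))]
      have := measureReal_le_one (μ := μ) (s := A)
      nlinarith [abs_nonneg (μ.real A - μ.real D), measureReal_nonneg (μ := μ) (s := A)]
    rw [h1] at h3
    rw [abs_le] at *
    constructor <;> linarith [h3.1, h3.2, h5.1, h5.2]
  have h01 : μ.real A = 0 ∨ μ.real A = 1 := by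
    have : μ.real A * (1 - μ.real A) = 0 := by linarith
    rcases mul_eq_zero.1 this with h | h
    · exact Or.inl h
    · exact Or.inr (by linarith)
  rcases h01 with h | h
  · left; simpa [measureReal_def, ENNReal.toReal_eq_zero_iff] using h
  · right
    rw [measureReal_def] at h
    rw [← ENNReal.ofReal_toReal (measure_ne_top μ A), h, ENNReal.ofReal_one]

/-- A strictly stationary sequence which is adapted, up to null sets, to the past of an independent
sequence is ergodic. -/
theorem ergodic_pathShift_map [IsProbabilityMeasure μ] {E : Type*} [MeasurableSpace E]
    {V : ℤ → Ω → E} (hZm : ∀ t, Measurable (Z t)) (hZ : iIndepFun Z μ)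
    (hVm : ∀ t, Measurable (V t)) (hV : IsStrictlyStationary μ V)
    (had : ∀ t, ∃ f : Ω → E, Measurable[noisePast Z t] f ∧ V t =ᵐ[μ] f) :
    Ergodic (pathShift 1) (μ.map fun ω t => V t ω) := by
  have hΦ : Measurable fun ω t => V t ω := measurable_pi_lambda _ hVm
  set Φ : Ω → ℤ → E := fun ω t => V t ω with hΦdef
  have hpres : ∀ h : ℤ, MeasurePreserving (pathShift h) (μ.map Φ) (μ.map Φ) := by
    intro h
    refine ⟨measurable_pathShift h, ?_⟩
    rw [Measure.map_map (measurable_pathShift h) hΦ]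
    exact (hV h).map_eq
  have : IsProbabilityMeasure (μ.map Φ) := Measure.isProbabilityMeasure_map hΦ.aemeasurable
  refine ⟨hpres 1, ⟨fun A hA hinv => ?_⟩⟩
  -- The shift is a bijection, so invariance also holds under the backward shift, which moves the
  -- coordinates of a cylinder arbitrarily far into the past.
  have hinv' : ∀ n : ℕ, pathShift (-n : ℤ) ⁻¹' A = A := by
    intro n
    have h1 : pathShift (n : ℤ) ⁻¹' A = A := by
      have : (pathShift 1)^[n] ⁻¹' A = A := by
        induction n with
        | zero => rfl
        | succ n ih => rw [Function.iterate_succ, Set.preimage_comp, ih, hinv]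
      rwa [show (pathShift 1)^[n] = pathShift (E := E) (n : ℤ) from
        funext fun w => pathShift_iterate n w] at this
    have h2 := congrArg (fun s => pathShift (-n : ℤ) ⁻¹' s) h1
    simp only [← Set.preimage_comp] at h2
    rwa [show pathShift (E := E) (n : ℤ) ∘ pathShift (-n : ℤ) = id from
      funext fun w => funext fun t => by simp [pathShift], Set.preimage_id, eq_comm] at h2
  have hdense := Measure.MeasureDense.of_generateFrom_isSetAlgebra_finite (μ := μ.map Φ)
    (isSetAlgebra_measurableCylinders (α := fun _ : ℤ => E))
    (generateFrom_measurableCylinders (α := fun _ : ℤ => E)).symm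
  have h01 : μ (Φ ⁻¹' A) = 0 ∨ μ (Φ ⁻¹' A) = 1 := by
    refine measure_eq_zero_or_one_of_approx hZm hZ (hΦ hA) fun t ε hε => ?_
    obtain ⟨C, hC, hAC⟩ := hdense.approx A hA (measure_ne_top _ _) ε hε
    have hCm := MeasurableSet.of_mem_measurableCylinders hC
    obtain ⟨s, S, hS, rfl⟩ := (mem_measurableCylinders _).1 hC
    choose f hfm hf using had
    obtain ⟨n, hn⟩ : ∃ n : ℕ, ∀ k ∈ s, k + (-n : ℤ) ≤ t := by
      obtain ⟨M, hM⟩ := s.bddAbove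
      refine ⟨(M - t).toNat, fun k hk => ?_⟩
      have := hM hk
      have := Int.self_le_toNat (M - t)
      omega
    refine ⟨{ω | (fun k : s => f (k.1 + (-n : ℤ)) ω) ∈ S}, ?_, ?_⟩
    · have : Measurable[noisePast Z t] fun ω (k : s) => f (k.1 + (-n : ℤ)) ω :=
        @measurable_pi_lambda _ _ _ (noisePast Z t) _ _ fun k =>
          (hfm _).mono (noisePast_mono (hn k.1 k.2)) le_rfl
      exact this hS
    -- Since `A` is invariant and the law is shift-invariant, shifting the cylinder does not worsen
    -- the approximation.
    · have h1 : μ (Φ ⁻¹' (symmDiff A (pathShift (-n : ℤ) ⁻¹' cylinder s S))) < ENNReal.ofReal ε := by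
        have h2 : symmDiff A (pathShift (-n : ℤ) ⁻¹' cylinder s S) =
            pathShift (-n : ℤ) ⁻¹' symmDiff A (cylinder s S) := by
          rw [Set.preimage_symmDiff, hinv' n]
        rw [h2, ← Measure.map_apply hΦ (measurable_pathShift _ (hA.symmDiff hCm)),
          (hpres _).measure_preimage (hA.symmDiff hCm).nullMeasurableSet]
        exact hAC
      have h3 : μ (symmDiff (Φ ⁻¹' A) {ω | (fun k : s => f (k.1 + (-n : ℤ)) ω) ∈ S}) =
          μ (Φ ⁻¹' (symmDiff A (pathShift (-n : ℤ) ⁻¹' cylinder s S))) := by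
        refine measure_congr ?_
        have : ∀ᵐ ω ∂μ, ∀ k : ℤ, V k ω = f k ω := ae_all_iff.2 hf
        filter_upwards [this] with ω hω
        refine propext ?_
        change ω ∈ symmDiff (Φ ⁻¹' A) _ ↔
          Φ ω ∈ symmDiff A (pathShift (-n : ℤ) ⁻¹' cylinder s S)
        simp only [Set.mem_symmDiff, Set.mem_preimage, Set.mem_ofPred_eq, mem_cylinder]
        have : (s.restrict (pathShift (-n : ℤ) (Φ ω))) = fun k : s => f (k.1 + (-n : ℤ)) ω := by
          funext k
          simp [pathShift, hΦdef, hω]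
        rw [this]
      rw [measureReal_def, h3]
      exact ENNReal.toReal_le_of_le_ofReal hε.le h1.le
  rw [eventuallyConst_set']
  rcases h01 with h | h
  · left
    rw [← Measure.map_apply hΦ hA] at h
    exact ae_eq_empty.2 h
  · right
    rw [← Measure.map_apply hΦ hA] at h
    exact (ae_eq_univ_iff_measure_eq hA.nullMeasurableSet).2 (by rw [h, measure_univ])

/-- Partial sums of a functional with negative mean along an ergodic sequence are bounded above. -/
theorem ae_bddAbove_sum_pathShift [IsProbabilityMeasure μ] {E : Type*} [MeasurableSpace E]
    {V : ℤ → Ω → E} (hVm : ∀ t, Measurable (V t))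
    (hV : Ergodic (pathShift 1) (μ.map fun ω t => V t ω)) {f : (ℤ → E) → ℝ} (hfm : Measurable f)
    (hf : Integrable (fun ω => f fun t => V t ω) μ) (hneg : ∫ ω, f (fun t => V t ω) ∂μ < 0) :
    ∀ᵐ ω ∂μ, ∃ C, ∀ n : ℕ, ∑ k ∈ Finset.range n, f (pathShift k fun t => V t ω) ≤ C := by
  have hΦ : Measurable fun ω t => V t ω := measurable_pi_lambda _ hVm
  have : IsProbabilityMeasure (μ.map fun ω t => V t ω) :=
    Measure.isProbabilityMeasure_map hΦ.aemeasurable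
  have h := hV.ae_bddAbove_birkhoffSum hfm
    ((integrable_map_measure hfm.aestronglyMeasurable hΦ.aemeasurable).2 hf)
    (by rwa [integral_map hΦ.aemeasurable hfm.aestronglyMeasurable])
  filter_upwards [ae_of_ae_map hΦ.aemeasurable h] with ω ⟨C, hC⟩
  refine ⟨C, fun n => ?_⟩
  have := hC ⟨n, rfl⟩
  simpa only [birkhoffSum, pathShift_iterate] using this

end noise

/-! ### Discrete Volterra equations -/

/-- The solution `x` of the equation `x n = b n + ∑ u < n, K n u * x u`. -/
def volterra (K : ℕ → ℕ → ℝ) (b : ℕ → ℝ) (n : ℕ) : ℝ :=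
  b n + ∑ u : Fin n, K n u * volterra K b u
termination_by n
decreasing_by exact u.2

namespace volterra

variable {K : ℕ → ℕ → ℝ} {b : ℕ → ℝ}

theorem eq_add_sum (n : ℕ) :
    volterra K b n = b n + ∑ u ∈ Finset.range n, K n u * volterra K b u := by
  rw [volterra, Finset.sum_range (fun u => K n u * volterra K b u)]

theorem nonneg (hK : ∀ n u, 0 ≤ K n u) (hb : ∀ n, 0 ≤ b n) (n : ℕ) : 0 ≤ volterra K b n := by
  induction n using Nat.strong_induction_on with
  | _ n ih =>
    rw [eq_add_sum]
    exact add_nonneg (hb n) (Finset.sum_nonneg fun u hu =>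
      mul_nonneg (hK n u) (ih u (Finset.mem_range.1 hu)))

/-- A nonnegative kernel propagates inequalities forward in time: subsolutions stay below the
solution and, in the next lemma, supersolutions above. The deterministic bounds below come from
exhibiting such comparison sequences. -/
theorem le_of_le {x : ℕ → ℝ} (hK : ∀ n u, 0 ≤ K n u)
    (hx : ∀ n, x n ≤ b n + ∑ u ∈ Finset.range n, K n u * x u) (n : ℕ) :
    x n ≤ volterra K b n := by
  induction n using Nat.strong_induction_on with
  | _ n ih =>
    rw [eq_add_sum]
    refine (hx n).trans (add_le_add_right (Finset.sum_le_sum fun u hu => ?_) _)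
    exact mul_le_mul_of_nonneg_left (ih u (Finset.mem_range.1 hu)) (hK n u)

theorem le_of_ge {x : ℕ → ℝ} (hK : ∀ n u, 0 ≤ K n u)
    (hx : ∀ n, b n + ∑ u ∈ Finset.range n, K n u * x u ≤ x n) (n : ℕ) :
    volterra K b n ≤ x n := by
  induction n using Nat.strong_induction_on with
  | _ n ih =>
    rw [eq_add_sum]
    refine (add_le_add_right (Finset.sum_le_sum fun u hu => ?_) _).trans (hx n)
    exact mul_le_mul_of_nonneg_left (ih u (Finset.mem_range.1 hu)) (hK n u)

theorem eq_of_eq {x : ℕ → ℝ}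
    (hx : ∀ n, x n = b n + ∑ u ∈ Finset.range n, K n u * x u) (n : ℕ) :
    x n = volterra K b n := by
  induction n using Nat.strong_induction_on with
  | _ n ih =>
    rw [eq_add_sum, hx n]
    congr 1
    exact Finset.sum_congr rfl fun u hu => by rw [ih u (Finset.mem_range.1 hu)]

/-- A Gronwall inequality. -/
theorem le_prod {C : ℕ → ℝ} {B : ℝ} (hK : ∀ n u, 0 ≤ K n u) (hKC : ∀ n u, K n u ≤ C u)
    (hb : ∀ n, b n ≤ B) (hB : 0 ≤ B) (n : ℕ) :
    volterra K b n ≤ B * ∏ u ∈ Finset.range n, (1 + C u) := by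
  have hC : ∀ u, 0 ≤ C u := fun u => (hK 0 u).trans (hKC 0 u)
  have hP : ∀ n, ∏ u ∈ Finset.range n, (1 + C u) =
      1 + ∑ u ∈ Finset.range n, C u * ∏ v ∈ Finset.range u, (1 + C v) := by
    intro n
    induction n with
    | zero => simp
    | succ n ih =>
      rw [Finset.prod_range_succ, Finset.sum_range_succ, ← add_assoc, ← ih]
      ring
  -- The product solves the equation with forcing `B` and the larger kernel `C u`, so it is a
  -- supersolution.
  refine le_of_ge (x := fun n => B * ∏ u ∈ Finset.range n, (1 + C u)) hK (fun n => ?_) n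
  have h0 : ∀ u, 0 ≤ ∏ v ∈ Finset.range u, (1 + C v) := fun u =>
    Finset.prod_nonneg fun v _ => by linarith [hC v]
  conv_rhs => rw [hP n, mul_add, mul_one, Finset.mul_sum]
  refine add_le_add (hb n) (Finset.sum_le_sum fun u _ => ?_)
  rw [mul_left_comm]
  exact mul_le_mul_of_nonneg_left
    (mul_le_mul_of_nonneg_right (hKC n u) (h0 u)) hB

theorem measurable {Ω : Type*} [MeasurableSpace Ω] {K : Ω → ℕ → ℕ → ℝ} {b : ℕ → ℝ}
    (hK : ∀ n, ∀ u < n, Measurable fun ω => K ω n u) (n : ℕ) :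
    Measurable fun ω => volterra (K ω) b n := by
  induction n using Nat.strong_induction_on with
  | _ n ih =>
    rw [funext fun ω => eq_add_sum (K := K ω) (b := b) n]
    exact measurable_const.add (Finset.measurable_sum _ fun u hu =>
      (hK n u (Finset.mem_range.1 hu)).mul (ih u (Finset.mem_range.1 hu)))

end volterra

/-! ### Random coefficient recursions -/

/-- A positive two-sided solution of `s t = a + ∑ i < m, c i (t - 1 - i) * s (t - 1 - i)`. -/
structure IsPosRecursion (m : ℕ) (a : ℝ) (c : ℕ → ℤ → ℝ) (s : ℤ → ℝ) : Prop where
  pos_order : 0 < m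
  pos_const : 0 < a
  coeff_nonneg : ∀ i t, 0 ≤ c i t
  coeff_eq_zero : ∀ i t, m ≤ i → c i t = 0
  sol_nonneg : ∀ t, 0 ≤ s t
  sol_eq : ∀ t, s t = a + ∑ i ∈ Finset.range m, c i (t - 1 - i) * s (t - 1 - i)

/-- The kernel of the recursion started at time zero. -/
def recKernel (c : ℕ → ℤ → ℝ) (n u : ℕ) : ℝ := c (n - 1 - u) u

/-- The sum of the coefficients at time `t`. -/
def coeffSum (m : ℕ) (c : ℕ → ℤ → ℝ) (t : ℤ) : ℝ := ∑ i ∈ Finset.range m, c i t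

/-- The total weight carried by the last `m` values before time `t`. -/
def lagSum (m : ℕ) (c : ℕ → ℤ → ℝ) (s : ℤ → ℝ) (t : ℤ) : ℝ :=
  ∑ l ∈ Finset.range m, coeffSum m c (t - 1 - l) * s (t - 1 - l)

/-- The response of the recursion at time `n` to unit impulses at times `0, …, m - 1`. -/
def impulseResp (m : ℕ) (c : ℕ → ℤ → ℝ) (n : ℕ) : ℝ :=
  volterra (recKernel c) (fun n => if n < m then 1 else 0) n

namespace IsPosRecursion

variable {m : ℕ} {a : ℝ} {c : ℕ → ℤ → ℝ} {s : ℤ → ℝ}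

theorem le_sol (h : IsPosRecursion m a c s) (t : ℤ) : a ≤ s t := by
  rw [h.sol_eq t]
  exact le_add_of_nonneg_right (Finset.sum_nonneg fun i _ =>
    mul_nonneg (h.coeff_nonneg _ _) (h.sol_nonneg _))

theorem sol_pos (h : IsPosRecursion m a c s) (t : ℤ) : 0 < s t :=
  h.pos_const.trans_le (h.le_sol t)

theorem kernel_nonneg (h : IsPosRecursion m a c s) (n u : ℕ) : 0 ≤ recKernel c n u :=
  h.coeff_nonneg _ _

theorem coeffSum_nonneg (h : IsPosRecursion m a c s) (t : ℤ) : 0 ≤ coeffSum m c t :=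
  Finset.sum_nonneg fun i _ => h.coeff_nonneg i t

theorem coeff_le_coeffSum (h : IsPosRecursion m a c s) (i : ℕ) (t : ℤ) :
    c i t ≤ coeffSum m c t := by
  rcases lt_or_ge i m with hi | hi
  · exact Finset.single_le_sum (f := fun i => c i t) (fun j _ => h.coeff_nonneg j t)
      (Finset.mem_range.2 hi)
  · rw [h.coeff_eq_zero i t hi]
    exact h.coeffSum_nonneg t

theorem lagSum_nonneg (h : IsPosRecursion m a c s) (t : ℤ) : 0 ≤ lagSum m c s t :=
  Finset.sum_nonneg fun _ _ => mul_nonneg (h.coeffSum_nonneg _) (h.sol_nonneg _)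

theorem impulseResp_nonneg (h : IsPosRecursion m a c s) (n : ℕ) : 0 ≤ impulseResp m c n :=
  volterra.nonneg h.kernel_nonneg (fun n => by split_ifs <;> norm_num) n

/-- The part of the recursion at time `n` which comes from nonnegative times. -/
theorem sum_kernel_eq (h : IsPosRecursion m a c s) (n : ℕ) :
    ∑ i ∈ (Finset.range m).filter (fun i => i < n), c i ((n : ℤ) - 1 - i) * s ((n : ℤ) - 1 - i) =
      ∑ u ∈ Finset.range n, recKernel c n u * s u := by
  have h1 : ∑ i ∈ (Finset.range m).filter (fun i => i < n),
      c i ((n : ℤ) - 1 - i) * s ((n : ℤ) - 1 - i) =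
      ∑ i ∈ Finset.range n, c i ((n : ℤ) - 1 - i) * s ((n : ℤ) - 1 - i) := by
    refine Finset.sum_subset (fun i hi => by simpa using (Finset.mem_filter.1 hi).2) ?_
    intro i hi hi'
    rw [h.coeff_eq_zero i, zero_mul]
    by_contra! hlt
    exact hi' (Finset.mem_filter.2 ⟨Finset.mem_range.2 hlt, Finset.mem_range.1 hi⟩)
  rw [h1, ← Finset.sum_range_reflect]
  refine Finset.sum_congr rfl fun u hu => ?_
  have hu := Finset.mem_range.1 hu
  have h2 : (n : ℤ) - 1 - ((n - 1 - u : ℕ) : ℤ) = u := by omega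
  rw [h2, recKernel]

/-- Values before time zero enter the recursion directly only at times `n < m`, and there with total
at most `lagSum m c s 0`. The solution is therefore below the one with forcing `a` plus these
impulses, which splits by linearity. -/
theorem sol_le (h : IsPosRecursion m a c s) (n : ℕ) :
    s n ≤ a * volterra (recKernel c) (fun _ => 1) n + impulseResp m c n * lagSum m c s 0 := by
  set V := lagSum m c s 0
  have hlin : ∀ n, a * volterra (recKernel c) (fun _ => 1) n + impulseResp m c n * V =
      volterra (recKernel c) (fun n => a + (if n < m then 1 else 0) * V) n := by
    refine volterra.eq_of_eq fun n => ?_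
    simp only [impulseResp]
    rw [volterra.eq_add_sum n, volterra.eq_add_sum (b := fun n => if n < m then (1 : ℝ) else 0) n]
    rw [mul_add, add_mul, Finset.mul_sum, Finset.sum_mul, add_add_add_comm,
      ← Finset.sum_add_distrib, mul_one]
    congr 1
    exact Finset.sum_congr rfl fun u _ => by ring
  rw [hlin]
  refine volterra.le_of_le (x := fun n : ℕ => s n) h.kernel_nonneg (fun n => ?_) n
  rw [h.sol_eq n, ← Finset.sum_filter_add_sum_filter_not _ (fun i => i < n), h.sum_kernel_eq n,
    add_assoc, add_comm (∑ u ∈ Finset.range n, _)]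
  refine add_le_add_right (add_le_add_left ?_ _) a
  rcases lt_or_ge n m with hn | hn
  · rw [if_pos hn, one_mul]
    have hle : ∀ i ∈ (Finset.range m).filter (fun i => ¬ i < n),
        c i ((n : ℤ) - 1 - i) * s ((n : ℤ) - 1 - i) ≤
          coeffSum m c (0 - 1 - ((i - n : ℕ) : ℤ)) * s (0 - 1 - ((i - n : ℕ) : ℤ)) := by
      intro i hi
      have hi' := not_lt.1 (Finset.mem_filter.1 hi).2
      have : (n : ℤ) - 1 - i = 0 - 1 - ((i - n : ℕ) : ℤ) := by omega
      rw [this]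
      exact mul_le_mul_of_nonneg_right (h.coeff_le_coeffSum _ _) (h.sol_nonneg _)
    refine (Finset.sum_le_sum hle).trans ?_
    have hinj : Set.InjOn (fun i => i - n)
        ((Finset.range m).filter (fun i => ¬ i < n) : Finset ℕ) := by
      intro i hi j hj hij
      have hi' := not_lt.1 (Finset.mem_filter.1 hi).2
      have hj' := not_lt.1 (Finset.mem_filter.1 hj).2
      dsimp only at hij
      omega
    rw [← Finset.sum_image (f := fun l : ℕ => coeffSum m c (0 - 1 - (l : ℤ)) * s (0 - 1 - (l : ℤ)))
      hinj]
    refine Finset.sum_le_sum_of_subset_of_nonneg ?_ fun l _ _ =>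
      mul_nonneg (h.coeffSum_nonneg _) (h.sol_nonneg _)
    intro l hl
    obtain ⟨i, hi, rfl⟩ := Finset.mem_image.1 hl
    have := Finset.mem_range.1 (Finset.mem_filter.1 hi).1
    exact Finset.mem_range.2 (by omega)
  · rw [if_neg (not_lt.2 hn), zero_mul]
    refine le_of_eq (Finset.sum_eq_zero fun i hi => ?_)
    rw [h.coeff_eq_zero i _ (hn.trans (not_lt.1 (Finset.mem_filter.1 hi).2)), zero_mul]

/-- The exponential decay of the impulse response relative to the solution. -/
theorem impulseResp_le (h : IsPosRecursion m a c s) (n : ℕ) :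
    impulseResp m c n ≤ Real.exp 1 / a * s n *
      Real.exp (-∑ k ∈ Finset.range (n + 1), (1 / m) * ∏ i ∈ Finset.range m, a / s (k + i)) := by
  -- The solution is a supersolution of the homogeneous recursion with excess `a`, which gains a
  -- factor 1 - a/s_n ≤ exp(-a/s_n) at time n. As the recursion reaches back up to m steps, the gain
  -- has to be spread out: `e k` is at most a/(m s_t) for each of the times t = k, …, k + m - 1, so
  -- the m values of `e` ending at n add up to at most a/s_n.
  set e : ℕ → ℝ := fun k => (1 / m) * ∏ i ∈ Finset.range m, a / s (k + i) with he
  have hm : (0 : ℝ) < m := by exact_mod_cast h.pos_order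
  have hδ0 : ∀ t, 0 ≤ a / s t := fun t => div_nonneg h.pos_const.le (h.sol_nonneg t)
  have hδ1 : ∀ t, a / s t ≤ 1 := fun t => div_le_one_of_le₀ (h.le_sol t) (h.sol_nonneg t)
  have he0 : ∀ k, 0 ≤ e k := fun k => mul_nonneg (by positivity)
    (Finset.prod_nonneg fun i _ => hδ0 _)
  have hele : ∀ k, ∀ i < m, e k ≤ (1 / m) * (a / s (k + i)) := by
    intro k i hi
    refine mul_le_mul_of_nonneg_left ?_ (by positivity)
    rw [← Finset.mul_prod_erase _ _ (Finset.mem_range.2 hi)]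
    exact mul_le_of_le_one_right (hδ0 _) (Finset.prod_le_one (fun _ _ => hδ0 _) fun _ _ => hδ1 _)
  have he1 : ∀ k, e k ≤ 1 / m := fun k => (hele k 0 h.pos_order).trans
    (mul_le_of_le_one_right (by positivity) (hδ1 _))
  have hD : 0 < Real.exp 1 / a := div_pos (Real.exp_pos 1) h.pos_const
  induction n using Nat.strong_induction_on with
  | _ n ih =>
    rcases lt_or_ge n m with hn | hn
    -- Before time m the comparison sequence is s/a, and the factor `Real.exp 1` in the constant
    -- pays for at most m rates, each at most 1/m.
    · have h1 : impulseResp m c n ≤ s n / a := by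
        refine volterra.le_of_ge (x := fun n : ℕ => s n / a) h.kernel_nonneg (fun k => ?_) n
        have h2 : a + ∑ u ∈ Finset.range k, recKernel c k u * s u ≤ s k := by
          rw [h.sol_eq k, ← h.sum_kernel_eq k]
          exact add_le_add_right (Finset.sum_le_sum_of_subset_of_nonneg
            (Finset.filter_subset (fun i => i < k) _) fun i _ _ => mul_nonneg (h.coeff_nonneg _ _) (h.sol_nonneg _)) a
        have h3 : (if k < m then (1 : ℝ) else 0) ≤ 1 := by split_ifs <;> norm_num
        simp_rw [← mul_div_assoc]
        rw [← Finset.sum_div, le_div_iff₀ h.pos_const, add_mul, div_mul_cancel₀ _ h.pos_const.ne']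
        nlinarith [h.pos_const]
      have h2 : ∑ k ∈ Finset.range (n + 1), e k ≤ 1 := by
        calc ∑ k ∈ Finset.range (n + 1), e k ≤ ∑ k ∈ Finset.range (n + 1), (1 / m : ℝ) :=
              Finset.sum_le_sum fun k _ => he1 k
          _ = (n + 1) / m := by simp [div_eq_mul_inv]
          _ ≤ 1 := by
            rw [div_le_one hm]
            exact_mod_cast hn
      refine h1.trans ?_
      have h3 : 1 ≤ Real.exp 1 * Real.exp (-∑ k ∈ Finset.range (n + 1), e k) := by
        rw [← Real.exp_add]
        exact Real.one_le_exp (by linarith)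
      calc s n / a ≤ (s n / a) * (Real.exp 1 * Real.exp (-∑ k ∈ Finset.range (n + 1), e k)) :=
            le_mul_of_one_le_right (div_nonneg (h.sol_nonneg _) h.pos_const.le) h3
        _ = _ := by ring
    · rw [impulseResp, volterra.eq_add_sum, if_neg (not_lt.2 hn), zero_add]
      set S : ℕ → ℝ := fun n => ∑ k ∈ Finset.range (n + 1), e k with hS
      have hSmono : Monotone S := monotone_nat_of_le_succ fun k => by
        simp only [hS]
        rw [Finset.sum_range_succ _ (k + 1)]
        linarith [he0 (k + 1)]
      have hstep : ∀ u ∈ Finset.range n, recKernel c n u * impulseResp m c u ≤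
          recKernel c n u * s u * (Real.exp 1 / a * Real.exp (-S (n - m))) := by
        intro u hu
        rcases lt_or_ge u (n - m) with hum | hum
        · have : recKernel c n u = 0 := h.coeff_eq_zero _ _ (by omega)
          simp [this]
        · rw [mul_assoc]
          refine mul_le_mul_of_nonneg_left ?_ (h.kernel_nonneg _ _)
          refine (ih u (Finset.mem_range.1 hu)).trans ?_
          rw [mul_comm (Real.exp 1 / a), mul_assoc]
          refine mul_le_mul_of_nonneg_left ?_ (h.sol_nonneg _)
          refine mul_le_mul_of_nonneg_left ?_ hD.le
          exact Real.exp_le_exp.2 (neg_le_neg (hSmono hum))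
      refine (Finset.sum_le_sum hstep).trans ?_
      rw [← Finset.sum_mul, ← h.sum_kernel_eq n]
      have h1 : ∑ i ∈ (Finset.range m).filter (fun i => i < n),
          c i ((n : ℤ) - 1 - i) * s ((n : ℤ) - 1 - i) ≤ s n * Real.exp (-(a / s n)) := by
        have h2 : ∑ i ∈ (Finset.range m).filter (fun i => i < n),
            c i ((n : ℤ) - 1 - i) * s ((n : ℤ) - 1 - i) ≤ s n - a := by
          rw [h.sol_eq n, add_sub_cancel_left]
          exact Finset.sum_le_sum_of_subset_of_nonneg (Finset.filter_subset _ _)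
            fun i _ _ => mul_nonneg (h.coeff_nonneg _ _) (h.sol_nonneg _)
        refine h2.trans ?_
        have h3 : s n * (1 - a / s n) = s n - a := by
          field_simp [(h.sol_pos n).ne']
        rw [← h3]
        refine mul_le_mul_of_nonneg_left ?_ (h.sol_nonneg _)
        linarith [Real.add_one_le_exp (-(a / s n))]
      have h4 : S n ≤ S (n - m) + a / s n := by
        have h5 : S n = S (n - m) + ∑ k ∈ Finset.range m, e (n - m + 1 + k) := by
          simp only [hS]
          rw [← Finset.sum_range_add]
          congr 2
          omega
        rw [h5]
        gcongr
        calc ∑ k ∈ Finset.range m, e (n - m + 1 + k)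
            ≤ ∑ k ∈ Finset.range m, (1 / m : ℝ) * (a / s n) := by
              refine Finset.sum_le_sum fun k hk => ?_
              have hk := Finset.mem_range.1 hk
              refine (hele _ (m - 1 - k) (by omega)).trans_eq ?_
              congr 3
              push_cast [Nat.cast_sub]
              omega
          _ = a / s n := by
            rw [Finset.sum_const, Finset.card_range, nsmul_eq_mul, ← mul_assoc,
              mul_one_div_cancel hm.ne', one_mul]
      calc _ ≤ (s n * Real.exp (-(a / s n))) * (Real.exp 1 / a * Real.exp (-S (n - m))) :=
            mul_le_mul_of_nonneg_right h1 (by positivity)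
        _ = Real.exp 1 / a * s n * Real.exp (-(a / s n) + -S (n - m)) := by
            rw [Real.exp_add]; ring
        _ ≤ _ := by
            refine mul_le_mul_of_nonneg_left (Real.exp_le_exp.2 ?_)
              (mul_nonneg hD.le (h.sol_nonneg _))
            change _ ≤ -S n
            linarith

end IsPosRecursion

/-! ### Lagged sums and the affine inequality between the times 0 and n -/

section

theorem prod_one_add_eq (C : ℕ → ℝ) (n : ℕ) : ∏ u ∈ Finset.range n, (1 + C u) =
    1 + ∑ u ∈ Finset.range n, C u * ∏ v ∈ Finset.range u, (1 + C v) := by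
  induction n with
  | zero => simp
  | succ n ih =>
    rw [Finset.prod_range_succ, Finset.sum_range_succ, ← add_assoc, ← ih]
    ring

/-- The weighted sum of the last `m` values before time `n` of a sequence indexed by `ℕ`. -/
def lagResp (m : ℕ) (c : ℕ → ℤ → ℝ) (x : ℕ → ℝ) (n : ℕ) : ℝ :=
  ∑ l ∈ Finset.range m, coeffSum m c ((n - 1 - l : ℕ) : ℤ) * x (n - 1 - l)

namespace IsPosRecursion

variable {m : ℕ} {a : ℝ} {c : ℕ → ℤ → ℝ} {s : ℤ → ℝ}

theorem lagResp_mono (h : IsPosRecursion m a c s) {x y : ℕ → ℝ} {n : ℕ} (hxy : ∀ u, x u ≤ y u) :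
    lagResp m c x n ≤ lagResp m c y n :=
  Finset.sum_le_sum fun _ _ => mul_le_mul_of_nonneg_left (hxy _) (h.coeffSum_nonneg _)

theorem lagSum_eq_lagResp {n : ℕ} (hn : m ≤ n) :
    lagSum m c s n = lagResp m c (fun u => s u) n := by
  refine Finset.sum_congr rfl fun l hl => ?_
  have hl := Finset.mem_range.1 hl
  have h2 : (n : ℤ) - 1 - l = ((n - 1 - l : ℕ) : ℤ) := by omega
  rw [h2]

/-- This is the affine inequality W_n ≤ Q_n + H_n W_0 behind the moment bound: Q_n and H_n involve
only coefficients at the times 0, …, n - 1, whereas W_0 involves only negative times. -/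
theorem lagSum_le (h : IsPosRecursion m a c s) {n : ℕ} (hn : m ≤ n) :
    lagSum m c s n ≤ a * lagResp m c (volterra (recKernel c) fun _ => 1) n +
      lagResp m c (impulseResp m c) n * lagSum m c s 0 := by
  rw [lagSum_eq_lagResp hn]
  refine (h.lagResp_mono h.sol_le).trans_eq ?_
  simp only [lagResp, Finset.mul_sum, Finset.sum_mul, ← Finset.sum_add_distrib]
  exact Finset.sum_congr rfl fun l _ => by ring

/-- The expansion `prod_one_add_eq` of the product contains the weighted sum of its last m partial
products as a sub-sum of nonnegative terms. -/
theorem lagResp_le_prod (h : IsPosRecursion m a c s) {x : ℕ → ℝ} {n : ℕ} (hn : m ≤ n)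
    (hx : ∀ k, x k ≤ ∏ u ∈ Finset.range k, (1 + coeffSum m c u)) :
    lagResp m c x n ≤ ∏ u ∈ Finset.range n, (1 + coeffSum m c u) := by
  have h0 : ∀ k : ℕ, 0 ≤ ∏ v ∈ Finset.range k, (1 + coeffSum m c v) := fun k =>
    Finset.prod_nonneg fun v _ => by linarith [h.coeffSum_nonneg v]
  refine (h.lagResp_mono hx).trans ?_
  rw [prod_one_add_eq (fun u : ℕ => coeffSum m c u)]
  have h1 : lagResp m c (fun k => ∏ u ∈ Finset.range k, (1 + coeffSum m c u)) n ≤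
      ∑ u ∈ Finset.range n, coeffSum m c u * ∏ v ∈ Finset.range u, (1 + coeffSum m c v) := by
    rw [← Finset.sum_range_reflect]
    refine Finset.sum_le_sum_of_subset_of_nonneg (Finset.range_mono hn) fun u _ _ =>
      mul_nonneg (h.coeffSum_nonneg _) (h0 _)
  linarith

theorem lagResp_one_le (h : IsPosRecursion m a c s) {n : ℕ} (hn : m ≤ n) :
    lagResp m c (volterra (recKernel c) fun _ => 1) n ≤
      ∏ u ∈ Finset.range n, (1 + coeffSum m c u) :=
  h.lagResp_le_prod hn fun k => by
    simpa using volterra.le_prod (C := fun u : ℕ => coeffSum m c u) h.kernel_nonneg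
      (fun n u => h.coeff_le_coeffSum _ _) (fun _ => le_refl (1 : ℝ)) zero_le_one k

theorem lagResp_impulseResp_le (h : IsPosRecursion m a c s) {n : ℕ} (hn : m ≤ n) :
    lagResp m c (impulseResp m c) n ≤ ∏ u ∈ Finset.range n, (1 + coeffSum m c u) :=
  h.lagResp_le_prod hn fun k => by
    simpa [impulseResp] using volterra.le_prod (b := fun n => if n < m then (1 : ℝ) else 0) (B := 1)
      (C := fun u : ℕ => coeffSum m c u) h.kernel_nonneg
      (fun n u => h.coeff_le_coeffSum _ _) (fun n => by split_ifs <;> norm_num) zero_le_one k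

theorem lagResp_nonneg (h : IsPosRecursion m a c s) {x : ℕ → ℝ} (hx : ∀ k, 0 ≤ x k) (n : ℕ) :
    0 ≤ lagResp m c x n :=
  Finset.sum_nonneg fun _ _ => mul_nonneg (h.coeffSum_nonneg _) (hx _)

/-- The exponential decay of the response of the lagged sums. -/
theorem lagResp_impulseResp_le_exp (h : IsPosRecursion m a c s) {n : ℕ} (hn : m ≤ n) :
    lagResp m c (impulseResp m c) n ≤ Real.exp 1 / a * lagSum m c s n *
      Real.exp (-∑ k ∈ Finset.range (n - m), (1 / m) * ∏ i ∈ Finset.range m, a / s (k + i)) := by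
  have hD : 0 < Real.exp 1 / a := div_pos (Real.exp_pos 1) h.pos_const
  rw [lagSum_eq_lagResp hn, lagResp, lagResp, Finset.mul_sum, Finset.sum_mul]
  refine Finset.sum_le_sum fun l hl => ?_
  have hl := Finset.mem_range.1 hl
  have hle : Real.exp (-∑ k ∈ Finset.range ((n - 1 - l) + 1),
      (1 / m) * ∏ i ∈ Finset.range m, a / s (k + i)) ≤
      Real.exp (-∑ k ∈ Finset.range (n - m), (1 / m) * ∏ i ∈ Finset.range m, a / s (k + i)) := by
    refine Real.exp_le_exp.2 (neg_le_neg ?_)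
    refine Finset.sum_le_sum_of_subset_of_nonneg (Finset.range_mono (by omega)) fun k _ _ => ?_
    exact mul_nonneg (by positivity) (Finset.prod_nonneg fun i _ =>
      div_nonneg h.pos_const.le (h.sol_nonneg _))
  calc coeffSum m c ((n - 1 - l : ℕ) : ℤ) * impulseResp m c (n - 1 - l)
      ≤ coeffSum m c ((n - 1 - l : ℕ) : ℤ) * (Real.exp 1 / a * s ((n - 1 - l : ℕ) : ℤ) *
        Real.exp (-∑ k ∈ Finset.range (n - m),
          (1 / m) * ∏ i ∈ Finset.range m, a / s (k + i))) := by
        refine mul_le_mul_of_nonneg_left ((h.impulseResp_le _).trans ?_) (h.coeffSum_nonneg _)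
        exact mul_le_mul_of_nonneg_left hle (mul_nonneg hD.le (h.sol_nonneg _))
    _ = _ := by ring

end IsPosRecursion

/-! ### Two integrability criteria for nonnegative random variables -/

section moments

open scoped ENNReal

variable {Ω : Type*} [MeasurableSpace Ω] {μ : Measure Ω} [IsProbabilityMeasure μ]

/-- A nonnegative random variable `W` whose law is dominated by that of `q + h * W`, with `h`
independent of `W` and of mean less than one, is integrable if `q` is. -/
theorem lintegral_ne_top_of_affine_bound {W W' h q : Ω → ℝ≥0∞} (hW : AEMeasurable W μ)
    (hh : Measurable h) (hq : Measurable q) (hident : IdentDistrib W' W μ μ)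
    (hindep : IndepFun h W μ) (hfin : ∀ᵐ ω ∂μ, W ω ≠ ∞)
    (hle : ∀ᵐ ω ∂μ, W' ω ≤ q ω + h ω * W ω) (hh1 : ∫⁻ ω, h ω ∂μ < 1) (hq1 : ∫⁻ ω, q ω ∂μ ≠ ∞) :
    ∫⁻ ω, W ω ∂μ ≠ ∞ := by
  -- The mean of `W` may be infinite a priori, so the inequality is truncated at M. Integrating over
  -- `h` first, with `W` fixed, replaces `h` by its mean inside the concave truncation.
  set ρ := ∫⁻ ω, h ω ∂μ with hρ
  have key : ∀ M : ℝ≥0∞, M ≠ ∞ →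
      ∫⁻ ω, min (W ω) M ∂μ ≤ ∫⁻ ω, q ω ∂μ + ∫⁻ ω, min (ρ * W ω) M ∂μ := by
    intro M hM
    have h1 : ∫⁻ ω, min (W ω) M ∂μ = ∫⁻ ω, min (W' ω) M ∂μ :=
      ((hident.comp (u := fun x => min x M) (measurable_id.min measurable_const)).lintegral_eq).symm
    have h2 : ∫⁻ ω, min (W' ω) M ∂μ ≤ ∫⁻ ω, q ω + min (h ω * W ω) M ∂μ := by
      refine lintegral_mono_ae ?_
      filter_upwards [hle] with ω hω
      refine (min_le_min_right M hω).trans ?_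
      rw [← min_add_add_left]
      exact min_le_min le_rfl le_add_self
    have h3 : ∫⁻ ω, min (h ω * W ω) M ∂μ ≤ ∫⁻ ω, min (ρ * W ω) M ∂μ := by
      have hmeas : Measurable fun z : ℝ≥0∞ × ℝ≥0∞ => min (z.1 * z.2) M :=
        (measurable_fst.mul measurable_snd).min measurable_const
      have hprod := (indepFun_iff_map_prod_eq_prod_map_map hh.aemeasurable hW).1 hindep
      have e1 : ∫⁻ ω, min (h ω * W ω) M ∂μ =
          ∫⁻ z, min (z.1 * z.2) M ∂(μ.map fun ω => (h ω, W ω)) :=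
        (lintegral_map' hmeas.aemeasurable (hh.aemeasurable.prodMk hW)).symm
      have e2 : ∫⁻ ω, min (ρ * W ω) M ∂μ = ∫⁻ w, min (ρ * w) M ∂(μ.map W) :=
        (lintegral_map' (f := fun w => min (ρ * w) M)
          ((measurable_const.mul measurable_id).min measurable_const).aemeasurable hW).symm
      have : IsProbabilityMeasure (μ.map h) := Measure.isProbabilityMeasure_map hh.aemeasurable
      rw [e1, hprod, lintegral_prod_symm' _ hmeas, e2]
      refine lintegral_mono fun w => ?_
      refine le_min ?_ ?_
      · refine (lintegral_mono fun x => min_le_left _ _).trans_eq ?_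
        dsimp only
        rw [lintegral_mul_const _ measurable_id', lintegral_map measurable_id' hh]
      · refine (lintegral_mono fun x => min_le_right _ _).trans_eq ?_
        simp
    rw [h1]
    refine h2.trans ?_
    rw [lintegral_add_left hq]
    gcongr
  -- Truncated at n, `W` and `ρ * W` differ by at least (1 - ρ) W where W ≤ n, and by a nonnegative
  -- amount elsewhere. The truncated integral being cancelled is finite.
  have hbound : ∀ n : ℕ, ∫⁻ ω, (1 - ρ) * (if W ω ≤ n then W ω else 0) ∂μ ≤ ∫⁻ ω, q ω ∂μ := by
    intro n
    have hfinM : ∫⁻ ω, min (ρ * W ω) (n : ℝ≥0∞) ∂μ ≠ ∞ := by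
      refine ne_top_of_le_ne_top (ENNReal.natCast_ne_top n) ?_
      refine (lintegral_mono fun ω => min_le_right _ _).trans_eq ?_
      simp
    refine (ENNReal.add_le_add_iff_right hfinM).1 ?_
    refine le_trans ?_ (key n (ENNReal.natCast_ne_top n))
    have hmeas : AEMeasurable (fun ω => min (ρ * W ω) (n : ℝ≥0∞)) μ :=
      (aemeasurable_const.mul hW).min aemeasurable_const
    rw [← lintegral_add_right' _ hmeas]
    refine lintegral_mono fun ω => ?_
    dsimp only
    split_ifs with hn
    · have : (1 - ρ) * W ω + ρ * W ω = W ω := by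
        rw [← add_mul, tsub_add_cancel_of_le hh1.le, one_mul]
      rw [min_eq_left hn]
      calc (1 - ρ) * W ω + min (ρ * W ω) n ≤ (1 - ρ) * W ω + ρ * W ω := by
            gcongr; exact min_le_left _ _
        _ = W ω := this
    · rw [mul_zero, zero_add, min_eq_right (not_le.1 hn).le]
      exact min_le_right _ _
  have hlim : ∫⁻ ω, (1 - ρ) * W ω ∂μ ≤ ∫⁻ ω, q ω ∂μ := by
    have h1 : ∫⁻ ω, (1 - ρ) * W ω ∂μ ≤
        ∫⁻ ω, liminf (fun n : ℕ => (1 - ρ) * (if W ω ≤ n then W ω else 0)) atTop ∂μ := by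
      refine lintegral_mono_ae ?_
      filter_upwards [hfin] with ω hω
      obtain ⟨N, hN⟩ := ENNReal.exists_nat_gt hω
      refine le_liminf_of_le (by isBoundedDefault) ?_
      filter_upwards [eventually_ge_atTop N] with n hn
      rw [if_pos]
      exact hN.le.trans (by exact_mod_cast hn)
    refine h1.trans ((lintegral_liminf_le' fun n => ?_).trans ?_)
    · refine aemeasurable_const.mul ?_
      have : Measurable fun x : ℝ≥0∞ => if x ≤ n then x else 0 :=
        Measurable.ite measurableSet_Iic measurable_id measurable_const
      exact this.comp_aemeasurable hW
    · refine liminf_le_of_le (by isBoundedDefault) fun b hb => ?_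
      obtain ⟨n, hn⟩ := hb.exists
      exact hn.trans (hbound n)
  rw [lintegral_const_mul'' _ hW] at hlim
  intro htop
  rw [htop, ENNReal.mul_top (tsub_pos_of_lt hh1).ne'] at hlim
  exact hq1 (top_le_iff.1 hlim)

/-- If `0 ≤ Y n ≤ A n`, where the `A n` have the same mean and converge to it almost surely, and
`Y n ≤ r < 1` eventually along a subsequence, then some `Y n` has mean less than one. -/
theorem exists_lintegral_lt_one {Y A : ℕ → Ω → ℝ} {r c : ℝ} {ns : ℕ → ℕ} (hns : StrictMono ns)
    (hY : ∀ n, Measurable (Y n)) (hY0 : ∀ n, ∀ᵐ ω ∂μ, 0 ≤ Y n ω)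
    (hYA : ∀ᶠ n in atTop, ∀ᵐ ω ∂μ, Y n ω ≤ A n ω)
    (hA : ∀ n, Integrable (A n) μ) (hAc : ∀ᶠ n in atTop, ∫ ω, A n ω ∂μ = c)
    (hlim : ∀ᵐ ω ∂μ, Tendsto (fun n => A n ω) atTop (𝓝 c)) (hr : r < 1)
    (hsub : ∀ᵐ ω ∂μ, ∀ᶠ i in atTop, Y (ns i) ω ≤ r) (N : ℕ) :
    ∃ n ≥ N, ∫⁻ ω, ENNReal.ofReal (Y n ω) ∂μ < 1 := by
  -- Fatou's lemma for the gap `A n - Y n` replaces uniform integrability. If all means of `Y n`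
  -- were at least one, the mean gap would eventually be at most c - 1, while along the subsequence
  -- the gap itself is eventually above c - (r + 1)/2, with (r + 1)/2 strictly between r and 1.
  by_contra! hcon
  have hYi : ∀ᶠ n in atTop, Integrable (Y n) μ := by
    filter_upwards [hYA] with n hn
    refine (hA n).mono' (hY n).aestronglyMeasurable ?_
    filter_upwards [hn, hY0 n] with ω h1 h2
    rwa [Real.norm_eq_abs, abs_of_nonneg h2]
  have hup : ∀ᶠ i in atTop,
      ∫⁻ ω, ENNReal.ofReal (A (ns i) ω - Y (ns i) ω) ∂μ ≤ ENNReal.ofReal (c - 1) := by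
    filter_upwards [hns.tendsto_atTop.eventually hYA, hns.tendsto_atTop.eventually hYi,
      hns.tendsto_atTop.eventually hAc, hns.tendsto_atTop.eventually_ge_atTop N]
      with i h1 h2 h3 h4
    have h5 : Integrable (fun ω => A (ns i) ω - Y (ns i) ω) μ := (hA _).sub h2
    rw [← ofReal_integral_eq_lintegral_ofReal h5
      (by filter_upwards [h1] with ω hω; exact sub_nonneg.2 hω)]
    rw [integral_sub (hA _) h2, h3]
    refine ENNReal.ofReal_le_ofReal (sub_le_sub_left ?_ c)
    have := hcon (ns i) h4
    rw [← ofReal_integral_eq_lintegral_ofReal h2 (hY0 _)] at this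
    exact ENNReal.one_le_ofReal.1 this
  have hlow : ENNReal.ofReal (c - (r + 1) / 2) ≤
      ∫⁻ ω, liminf (fun i => ENNReal.ofReal (A (ns i) ω - Y (ns i) ω)) atTop ∂μ := by
    have : ∫⁻ _, ENNReal.ofReal (c - (r + 1) / 2) ∂μ = ENNReal.ofReal (c - (r + 1) / 2) := by
      simp
    rw [← this]
    refine lintegral_mono_ae ?_
    filter_upwards [hlim, hsub] with ω h1 h2
    refine le_liminf_of_le (by isBoundedDefault) ?_
    filter_upwards [h2, hns.tendsto_atTop.eventually (h1.eventually_const_lt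
      (show c - (1 - r) / 2 < c by linarith))] with i h3 h4
    refine ENNReal.ofReal_le_ofReal ?_
    linarith
  have hfatou := lintegral_liminf_le' (μ := μ) (u := atTop)
    (f := fun i ω => ENNReal.ofReal (A (ns i) ω - Y (ns i) ω)) fun i =>
      ((hA _).aemeasurable.sub (hY _).aemeasurable).ennreal_ofReal
  have hle : ENNReal.ofReal (c - (r + 1) / 2) ≤ ENNReal.ofReal (c - 1) := by
    refine (hlow.trans hfatou).trans ?_
    refine liminf_le_of_le (by isBoundedDefault) fun b hb => ?_
    obtain ⟨i, h1, h2⟩ := (hb.and hup).exists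
    exact h1.trans h2
  -- `ENNReal.ofReal` truncates at zero, so the real inequality can be read off only when c - 1 is
  -- nonnegative.
  have hc : 1 ≤ c := by
    obtain ⟨n, h1, h2, h3, h4⟩ := (hYi.and (hYA.and (hAc.and (eventually_ge_atTop N)))).exists
    have := hcon n h4
    rw [← ofReal_integral_eq_lintegral_ofReal h1 (hY0 _)] at this
    rw [← h3]
    exact (ENNReal.one_le_ofReal.1 this).trans (integral_mono_ae h1 (hA n) h2)
  rw [ENNReal.ofReal_le_ofReal_iff (by linarith)] at hle
  linarith

end moments

end

/-! ### Basic properties of stationary AGARCH processes -/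

/-- The function `x ↦ (|x| - γ x)²`. -/
def asymSq (γ x : ℝ) : ℝ := (|x| - γ * x) ^ 2

theorem asymSq_nonneg (γ x : ℝ) : 0 ≤ asymSq γ x := sq_nonneg _

theorem measurable_asymSq (γ : ℝ) : Measurable (asymSq γ) := by
  unfold asymSq
  fun_prop

/-- Positive homogeneity of degree two splits a shock into a function of the innovation and the
squared volatility. This turns the model into a linear recursion with random coefficients. -/
theorem asymSq_mul (γ : ℝ) {r : ℝ} (hr : 0 ≤ r) (z : ℝ) : asymSq γ (r * z) = asymSq γ z * r ^ 2 := by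
  unfold asymSq
  rw [abs_mul, abs_of_nonneg hr]
  ring

theorem asymSq_le (γ x : ℝ) : asymSq γ x ≤ (1 + |γ|) ^ 2 * x ^ 2 := by
  unfold asymSq
  rw [← mul_pow, ← sq_abs (|x| - γ * x), ← sq_abs ((1 + |γ|) * x)]
  refine pow_le_pow_left₀ (abs_nonneg _) ?_ 2
  refine (abs_sub _ _).trans_eq ?_
  rw [abs_abs, abs_mul, abs_mul, abs_of_nonneg (by positivity : 0 ≤ 1 + |γ|)]
  ring

namespace AGARCHParam

variable {p q : ℕ}

/-- The coefficients `α` extended by zero; the entry of index `i` is `α_{i+1}`. -/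
def alphaN (θ : AGARCHParam p q) (i : ℕ) : ℝ := if h : i < p then θ.alpha ⟨i, h⟩ else 0

/-- The coefficients `β` extended by zero; the entry of index `j` is `β_{j+1}`. -/
def betaN (θ : AGARCHParam p q) (j : ℕ) : ℝ := if h : j < q then θ.beta ⟨j, h⟩ else 0

theorem alphaN_fin (θ : AGARCHParam p q) (i : Fin p) : θ.alphaN i = θ.alpha i := by
  simp [alphaN]

theorem betaN_fin (θ : AGARCHParam p q) (j : Fin q) : θ.betaN j = θ.beta j := by
  simp [betaN]

theorem alphaN_of_le (θ : AGARCHParam p q) {i : ℕ} (h : p ≤ i) : θ.alphaN i = 0 := by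
  simp [alphaN, not_lt.2 h]

theorem betaN_of_le (θ : AGARCHParam p q) {j : ℕ} (h : q ≤ j) : θ.betaN j = 0 := by
  simp [betaN, not_lt.2 h]

theorem alphaN_nonneg {θ : AGARCHParam p q} (hθ : θ ∈ space p q) (i : ℕ) : 0 ≤ θ.alphaN i := by
  unfold alphaN
  split_ifs with h
  · exact hθ.2.1 _
  · exact le_rfl

theorem betaN_nonneg {θ : AGARCHParam p q} (hθ : θ ∈ space p q) (j : ℕ) : 0 ≤ θ.betaN j := by
  unfold betaN
  split_ifs with h
  · exact (hθ.2.2.1.1 _).1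
  · exact le_rfl

theorem sum_betaN (θ : AGARCHParam p q) : ∑ j ∈ Finset.range q, θ.betaN j = ∑ j, θ.beta j := by
  rw [Finset.sum_range]
  exact Finset.sum_congr rfl fun j _ => θ.betaN_fin j

theorem volMap_lagVec (θ : AGARCHParam p q) (x s : ℤ → ℝ) (t : ℤ) :
    θ.volMap (lagVec x p (t - 1)) (lagVec s q (t - 1)) = θ.alphaZero +
      ∑ i ∈ Finset.range p, θ.alphaN i * asymSq θ.gamma (x (t - 1 - i)) +
      ∑ j ∈ Finset.range q, θ.betaN j * s (t - 1 - j) := by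
  rw [volMap, Finset.sum_range, Finset.sum_range]
  simp only [alphaN_fin, betaN_fin, lagVec, asymSq]

/-- The random coefficients of the recursion satisfied by the squared volatility. -/
def recCoeff (θ : AGARCHParam p q) (z : ℤ → ℝ) (i : ℕ) (t : ℤ) : ℝ :=
  θ.alphaN i * asymSq θ.gamma (z t) + θ.betaN i

/-- The sum of the weighted past values as a functional of the path of `(X, σ)`. -/
def lagFun (θ : AGARCHParam p q) (w : ℤ → ℝ × ℝ) : ℝ :=
  ∑ l ∈ Finset.range (p + q), ∑ i ∈ Finset.range (p + q),
    (θ.alphaN i * asymSq θ.gamma (w (-1 - l)).1 + θ.betaN i * (w (-1 - l)).2 ^ 2)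

theorem measurable_lagFun (θ : AGARCHParam p q) : Measurable θ.lagFun := by
  unfold lagFun
  have := measurable_asymSq θ.gamma
  fun_prop

/-- The deterministic properties of almost every path of a stationary AGARCH process. -/
structure IsPath (θ : AGARCHParam p q) (z x v : ℤ → ℝ) : Prop where
  vol_nonneg : ∀ t, 0 ≤ v t
  obs_eq : ∀ t, x t = v t * z t
  vol_eq : ∀ t, v t ^ 2 = θ.alphaZero +
      ∑ i ∈ Finset.range p, θ.alphaN i * asymSq θ.gamma (x (t - 1 - i)) +
      ∑ j ∈ Finset.range q, θ.betaN j * v (t - 1 - j) ^ 2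

namespace IsPath

variable {θ : AGARCHParam p q} {z x v : ℤ → ℝ}

theorem asymSq_obs (h : θ.IsPath z x v) (γ : ℝ) (t : ℤ) :
    asymSq γ (x t) = asymSq γ (z t) * v t ^ 2 := by
  rw [h.obs_eq, asymSq_mul γ (h.vol_nonneg t)]

/-- The order `p + q` is only a common bound for both coefficient ranges, which are extended by
zero. Each coefficient is a function of the innovation at the time of the lagged value it
multiplies. -/
theorem isPosRecursion (h : θ.IsPath z x v) (hθ : θ ∈ space p q) (hp : 0 < p) :
    IsPosRecursion (p + q) θ.alphaZero (θ.recCoeff z) (fun t => v t ^ 2) where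
  pos_order := by omega
  pos_const := hθ.1
  coeff_nonneg i t := add_nonneg (mul_nonneg (alphaN_nonneg hθ i) (asymSq_nonneg _ _))
    (betaN_nonneg hθ i)
  coeff_eq_zero i t hi := by
    rw [recCoeff, alphaN_of_le θ (by omega), betaN_of_le θ (by omega), zero_mul, zero_add]
  sol_nonneg t := sq_nonneg _
  sol_eq t := by
    rw [h.vol_eq, add_assoc]
    simp only [recCoeff, add_mul, Finset.sum_add_distrib]
    congr 2
    · refine (Finset.sum_subset (Finset.range_mono (Nat.le_add_right p q)) fun i _ hi => ?_).trans
        (Finset.sum_congr rfl fun i _ => ?_)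
      · rw [alphaN_of_le θ (by simpa using hi), zero_mul]
      · rw [h.asymSq_obs, mul_assoc]
    · refine Finset.sum_subset (Finset.range_mono (Nat.le_add_left q p)) fun i _ hi => ?_
      rw [betaN_of_le θ (by simpa using hi), zero_mul]

theorem lagSum_eq (h : θ.IsPath z x v) (t : ℤ) :
    lagSum (p + q) (θ.recCoeff z) (fun t => v t ^ 2) t =
      θ.lagFun (pathShift t fun t => (x t, v t)) := by
  unfold lagSum lagFun coeffSum
  refine Finset.sum_congr rfl fun l _ => ?_
  rw [Finset.sum_mul]
  refine Finset.sum_congr rfl fun i _ => ?_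
  simp only [pathShift, recCoeff]
  rw [show -1 - (l : ℤ) + t = t - 1 - l by ring, h.asymSq_obs]
  ring

theorem alphaZero_le (h : θ.IsPath z x v) (hθ : θ ∈ space p q) (t : ℤ) :
    θ.alphaZero ≤ v t ^ 2 := by
  rw [h.vol_eq, add_assoc]
  refine le_add_of_nonneg_right (add_nonneg (Finset.sum_nonneg fun i _ => ?_)
    (Finset.sum_nonneg fun i _ => ?_))
  · exact mul_nonneg (alphaN_nonneg hθ i) (asymSq_nonneg _ _)
  · exact mul_nonneg (betaN_nonneg hθ i) (sq_nonneg _)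

theorem sq_le (h : θ.IsPath z x v) (hθ : θ ∈ space p q) (hp : 0 < p) :
    v 0 ^ 2 ≤ θ.alphaZero + θ.lagFun fun t => (x t, v t) := by
  have hrec := h.isPosRecursion hθ hp
  have h1 := h.lagSum_eq 0
  rw [show (pathShift 0 fun t => (x t, v t)) = fun t => (x t, v t) from
    funext fun t => by simp [pathShift]] at h1
  rw [← h1]
  refine (hrec.sol_eq 0).trans_le (add_le_add_right (Finset.sum_le_sum fun i _ => ?_) _)
  exact mul_le_mul_of_nonneg_right (hrec.coeff_le_coeffSum _ _) (sq_nonneg _)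

end IsPath

end AGARCHParam

namespace IsStationaryAGARCH

open AGARCHParam

variable {Ω : Type*} [MeasurableSpace Ω] {μ : Measure Ω} {p q : ℕ} {θ : AGARCHParam p q}
  {Z X σ : ℤ → Ω → ℝ}

theorem ae_isPath (h : IsStationaryAGARCH μ θ Z X σ) :
    ∀ᵐ ω ∂μ, θ.IsPath (fun t => Z t ω) (fun t => X t ω) (fun t => σ t ω) := by
  filter_upwards [ae_all_iff.2 h.vol_nonneg, ae_all_iff.2 h.obs_eq, ae_all_iff.2 h.vol_eq]
    with ω h1 h2 h3
  exact ⟨h1, h2, fun t => by rw [h3 t, volMap_lagVec]⟩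

theorem measurable_path (h : IsStationaryAGARCH μ θ Z X σ) (t : ℤ) :
    Measurable fun ω => (X t ω, σ t ω) :=
  (h.measurable_obs t).prodMk (h.measurable_vol t)

theorem measurable_pathMap (h : IsStationaryAGARCH μ θ Z X σ) :
    Measurable fun ω t => (X t ω, σ t ω) :=
  measurable_pi_lambda _ h.measurable_path

theorem identDistrib_pathShift (h : IsStationaryAGARCH μ θ Z X σ) {β : Type*} [MeasurableSpace β]
    {f : (ℤ → ℝ × ℝ) → β} (hf : Measurable f) (k : ℤ) :
    IdentDistrib (fun ω => f (pathShift k fun t => (X t ω, σ t ω)))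
      (fun ω => f fun t => (X t ω, σ t ω)) μ μ :=
  (h.stationary k).comp hf

theorem exists_noisePast_path (h : IsStationaryAGARCH μ θ Z X σ) (t : ℤ) :
    ∃ f : Ω → ℝ × ℝ, Measurable[noisePast Z t] f ∧ (fun ω => (X t ω, σ t ω)) =ᵐ[μ] f := by
  obtain ⟨f, hfm, hf⟩ := h.vol_adapted t
  have hfm' : Measurable[noisePast Z t] f := hfm.mono (noisePast_mono (by omega)) le_rfl
  have hZ : Measurable[noisePast Z t] (Z t) := measurable_noisePast le_rfl
  refine ⟨fun ω => (f ω * Z t ω, f ω), ?_, ?_⟩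
  · exact (hfm'.mul hZ).prodMk hfm'
  · filter_upwards [hf, h.obs_eq t] with ω h1 h2
    rw [h2, h1]

theorem ergodic [IsProbabilityMeasure μ] (h : IsStationaryAGARCH μ θ Z X σ) :
    Ergodic (pathShift 1) (μ.map fun ω t => (X t ω, σ t ω)) :=
  ergodic_pathShift_map h.noise.measurable h.noise.indep h.measurable_path h.stationary
    h.exists_noisePast_path

theorem ae_bddAbove_sum [IsProbabilityMeasure μ] (h : IsStationaryAGARCH μ θ Z X σ)
    {f : (ℤ → ℝ × ℝ) → ℝ} (hfm : Measurable f)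
    (hf : Integrable (fun ω => f fun t => (X t ω, σ t ω)) μ)
    (hneg : ∫ ω, f (fun t => (X t ω, σ t ω)) ∂μ < 0) :
    ∀ᵐ ω ∂μ, ∃ C, ∀ n : ℕ, ∑ k ∈ Finset.range n, f (pathShift k fun t => (X t ω, σ t ω)) ≤ C :=
  ae_bddAbove_sum_pathShift h.measurable_path h.ergodic hfm hf hneg

end IsStationaryAGARCH

section

/-! ### Fractional moments of the volatility -/

open scoped ENNReal

/-- Identically distributed random variables grow subexponentially along a subsequence. -/
theorem exists_seq_exp_neg_mul_tendsto {Ω : Type*} [MeasurableSpace Ω] {μ : Measure Ω}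
    [IsProbabilityMeasure μ] {V : ℕ → Ω → ℝ} {V₀ : Ω → ℝ} (hV₀ : Measurable V₀)
    (hV : ∀ n, IdentDistrib (V n) V₀ μ μ) {κ : ℝ} (hκ : 0 < κ) :
    ∃ ns : ℕ → ℕ, StrictMono ns ∧
      ∀ᵐ ω ∂μ, Tendsto (fun i => Real.exp (-(κ * ns i)) * V (ns i) ω) atTop (𝓝 0) := by
  -- The discounted `V n` has the law of the equally discounted `V₀`, which tends to zero. Hence
  -- there is convergence in measure, and almost sure convergence along a subsequence.
  have h0 : TendstoInMeasure μ (fun (n : ℕ) ω => Real.exp (-(κ * n)) * V₀ ω) atTop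
      (fun _ => (0 : ℝ)) := by
    refine tendstoInMeasure_of_tendsto_ae
      (fun n => (measurable_const.mul hV₀).aestronglyMeasurable) (ae_of_all _ fun ω => ?_)
    have h1 : Tendsto (fun n : ℕ => Real.exp (-(κ * n))) atTop (𝓝 0) :=
      Real.tendsto_exp_atBot.comp (tendsto_neg_atTop_atBot.comp
        (tendsto_natCast_atTop_atTop.const_mul_atTop hκ))
    simpa using h1.mul_const (V₀ ω)
  have h1 : TendstoInMeasure μ (fun (n : ℕ) ω => Real.exp (-(κ * n)) * V n ω) atTop
      (fun _ => (0 : ℝ)) := by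
    intro ε hε
    refine (h0 ε hε).congr fun n => ?_
    have := ((hV n).comp (u := fun x => Real.exp (-(κ * n)) * x)
      (measurable_const.mul measurable_id)).symm.measure_mem_eq
      (s := {x | ε ≤ edist x 0}) (measurableSet_le measurable_const
        (measurable_id.edist measurable_const))
    exact this
  exact h1.exists_seq_tendsto_ae

/-- By the inequality of arithmetic and geometric means, one moment of the factors controls the n-th
root of a product of n of them. This is why the exponent 1/n will suffice. -/
theorem prod_rpow_inv_le_avg {x : ℕ → ℝ} (hx : ∀ u, 0 ≤ x u) {n : ℕ} (hn : 0 < n) :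
    (∏ u ∈ Finset.range n, x u) ^ ((n : ℝ)⁻¹) ≤ (∑ u ∈ Finset.range n, x u) / n := by
  have := Real.geom_mean_le_arith_mean (Finset.range n) (fun _ => 1) x (fun _ _ => zero_le_one)
    (by simpa using hn) (fun u _ => hx u)
  simpa using this

theorem pathShift_zero {E : Type*} (w : ℤ → E) : pathShift 0 w = w := by
  funext t
  simp [pathShift]

section measurability

variable {Ω : Type*} {mΩ : MeasurableSpace Ω} {c : Ω → ℕ → ℤ → ℝ}

theorem measurable_volterra_recKernel (hc : ∀ i (u : ℕ), Measurable fun ω => c ω i u) {b : ℕ → ℝ}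
    (n : ℕ) : Measurable fun ω => volterra (recKernel (c ω)) b n :=
  volterra.measurable (fun _ _ _ => hc _ _) n

theorem measurable_lagResp (hc : ∀ i (u : ℕ), Measurable fun ω => c ω i u) {m : ℕ}
    {x : Ω → ℕ → ℝ} (hx : ∀ k, Measurable fun ω => x ω k) (n : ℕ) :
    Measurable fun ω => lagResp m (c ω) (x ω) n :=
  Finset.measurable_sum _ fun _ _ => (Finset.measurable_sum _ fun _ _ => hc _ _).mul (hx _)

end measurability

namespace IsStationaryAGARCH

open AGARCHParam

variable {Ω : Type*} {p q : ℕ} {θ : AGARCHParam p q} {Z X σ : ℤ → Ω → ℝ}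

/-- The sum of the random coefficients at time `t` is a function of `Z_t`. -/
def coeffFun (θ : AGARCHParam p q) (z : ℝ) : ℝ :=
  ∑ i ∈ Finset.range (p + q), (θ.alphaN i * asymSq θ.gamma z + θ.betaN i)

theorem measurable_coeffFun : Measurable (coeffFun θ) := by
  have := measurable_asymSq θ.gamma
  unfold coeffFun
  fun_prop

theorem measurable_recCoeff {mΩ : MeasurableSpace Ω} {t : ℤ} (hZ : Measurable (Z t)) (i : ℕ) :
    Measurable fun ω => θ.recCoeff (fun t => Z t ω) i t :=
  (measurable_const.mul ((measurable_asymSq _).comp hZ)).add measurable_const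

/-- The response at time `n` of the lagged sums to their value at time `0`. -/
def response (θ : AGARCHParam p q) (Z : ℤ → Ω → ℝ) (n : ℕ) (ω : Ω) : ℝ :=
  lagResp (p + q) (θ.recCoeff fun t => Z t ω) (impulseResp (p + q) (θ.recCoeff fun t => Z t ω)) n

/-- The contribution of the constant term between the times `0` and `n`. -/
def forcing (θ : AGARCHParam p q) (Z : ℤ → Ω → ℝ) (n : ℕ) (ω : Ω) : ℝ :=
  lagResp (p + q) (θ.recCoeff fun t => Z t ω)
    (volterra (recKernel (θ.recCoeff fun t => Z t ω)) fun _ => 1) n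

theorem measurable_response {mΩ : MeasurableSpace Ω} (hZ : ∀ u : ℕ, Measurable (Z u)) (n : ℕ) :
    Measurable (response θ Z n) :=
  measurable_lagResp (fun i u => measurable_recCoeff (hZ u) i)
    (fun _ => measurable_volterra_recKernel (fun i u => measurable_recCoeff (hZ u) i) _) n

theorem measurable_forcing {mΩ : MeasurableSpace Ω} (hZ : ∀ u : ℕ, Measurable (Z u)) (n : ℕ) :
    Measurable (forcing θ Z n) :=
  measurable_lagResp (fun i u => measurable_recCoeff (hZ u) i)
    (fun _ => measurable_volterra_recKernel (fun i u => measurable_recCoeff (hZ u) i) _) n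

variable [MeasurableSpace Ω] {μ : Measure Ω}

theorem integrable_sq_noise (h : IsStationaryAGARCH μ θ Z X σ) (t : ℤ) :
    Integrable (fun ω => Z t ω ^ 2) μ :=
  ((h.noise.identDistrib t).comp (u := fun x => x ^ 2) (by fun_prop)).integrable_iff.2
    h.noise.memLp.integrable_sq

theorem integrable_coeffFun [IsProbabilityMeasure μ] (h : IsStationaryAGARCH μ θ Z X σ) (t : ℤ) :
    Integrable (fun ω => coeffFun θ (Z t ω)) μ := by
  refine integrable_finsetSum _ fun i _ => ?_
  refine Integrable.add (Integrable.const_mul ?_ _) (integrable_const _)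
  refine ((h.integrable_sq_noise t).const_mul ((1 + |θ.gamma|) ^ 2)).mono'
    ((measurable_asymSq _).comp (h.noise.measurable t)).aestronglyMeasurable
    (ae_of_all _ fun ω => ?_)
  rw [Real.norm_eq_abs, abs_of_nonneg (asymSq_nonneg _ _)]
  exact asymSq_le _ _

/-- The averages dominating the roots of the responses. -/
def avgCoeff (θ : AGARCHParam p q) (Z : ℤ → Ω → ℝ) (n : ℕ) (ω : Ω) : ℝ :=
  (∑ u ∈ Finset.range n, (1 + coeffFun θ (Z u ω))) / n

theorem integrable_avgCoeff [IsProbabilityMeasure μ] (h : IsStationaryAGARCH μ θ Z X σ) (n : ℕ) :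
    Integrable (avgCoeff θ Z n) μ :=
  (integrable_finsetSum _ fun _ _ => (integrable_const 1).add (h.integrable_coeffFun _)).div_const _

theorem identDistrib_coeffFun (h : IsStationaryAGARCH μ θ Z X σ) (t : ℤ) :
    IdentDistrib (fun ω => 1 + coeffFun θ (Z t ω)) (fun ω => 1 + coeffFun θ (Z 0 ω)) μ μ :=
  (h.noise.identDistrib t).comp (u := fun z => 1 + coeffFun θ z)
    (measurable_const.add measurable_coeffFun)

theorem integral_avgCoeff [IsProbabilityMeasure μ] (h : IsStationaryAGARCH μ θ Z X σ) {n : ℕ}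
    (hn : 0 < n) : ∫ ω, avgCoeff θ Z n ω ∂μ = ∫ ω, (1 + coeffFun θ (Z 0 ω)) ∂μ := by
  unfold avgCoeff
  have hint : ∀ u ∈ Finset.range n, Integrable (fun ω => 1 + coeffFun θ (Z u ω)) μ := fun u _ =>
    (integrable_const (1 : ℝ)).add (h.integrable_coeffFun u)
  rw [integral_div, integral_finsetSum _ hint]
  rw [Finset.sum_congr rfl fun (u : ℕ) _ => (h.identDistrib_coeffFun u).integral_eq]
  rw [Finset.sum_const, Finset.card_range, nsmul_eq_mul,
    mul_div_cancel_left₀ _ (by positivity)]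

theorem tendsto_avgCoeff [IsProbabilityMeasure μ] (h : IsStationaryAGARCH μ θ Z X σ) :
    ∀ᵐ ω ∂μ, Tendsto (fun n => avgCoeff θ Z n ω) atTop
      (𝓝 (∫ ω, (1 + coeffFun θ (Z 0 ω)) ∂μ)) := by
  refine strong_law_ae_real (fun (u : ℕ) ω => 1 + coeffFun θ (Z u ω))
    ((integrable_const 1).add (h.integrable_coeffFun 0)) (fun u v huv => ?_)
    (fun u => h.identDistrib_coeffFun u)
  exact (h.noise.indep.indepFun (i := u) (j := v) (by exact_mod_cast huv)).comp
    (φ := fun z => 1 + coeffFun θ z) (ψ := fun z => 1 + coeffFun θ z)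
    (measurable_const.add measurable_coeffFun) (measurable_const.add measurable_coeffFun)

/-- The relative growth rate of the volatility, as a functional of the path. -/
def rateFun (θ : AGARCHParam p q) (w : ℤ → ℝ × ℝ) : ℝ :=
  (1 / (p + q : ℕ)) * ∏ i ∈ Finset.range (p + q), θ.alphaZero / (w i).2 ^ 2

theorem measurable_rateFun : Measurable (rateFun θ) := by
  unfold rateFun
  fun_prop

theorem rateFun_pos (hθ : θ ∈ space p q) (hp : 0 < p) {z x v : ℤ → ℝ} (h : θ.IsPath z x v) :
    0 < rateFun θ fun t => (x t, v t) := by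
  have : (0 : ℝ) < (p + q : ℕ) := by exact_mod_cast (by omega)
  refine mul_pos (by positivity) (Finset.prod_pos fun i _ => ?_)
  exact div_pos hθ.1 (hθ.1.trans_le (h.alphaZero_le hθ _))

theorem rateFun_le_one (hθ : θ ∈ space p q) (hp : 0 < p) {z x v : ℤ → ℝ} (h : θ.IsPath z x v) :
    (rateFun θ fun t => (x t, v t)) ≤ 1 := by
  have h1 : (1 : ℝ) ≤ (p + q : ℕ) := by exact_mod_cast (by omega)
  refine mul_le_one₀ (by rw [div_le_one (by linarith)]; exact h1)
    (Finset.prod_nonneg fun i _ => div_nonneg hθ.1.le (sq_nonneg _))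
    (Finset.prod_le_one (fun i _ => div_nonneg hθ.1.le (sq_nonneg _)) fun i _ => ?_)
  exact div_le_one_of_le₀ (h.alphaZero_le hθ _) (sq_nonneg _)

/-- The accumulated rates grow at least linearly. -/
theorem exists_rate [IsProbabilityMeasure μ] (h : IsStationaryAGARCH μ θ Z X σ)
    (hθ : θ ∈ space p q) (hp : 0 < p) : ∃ κ > 0, ∀ᵐ ω ∂μ, ∃ C, ∀ n : ℕ,
      κ * n - C ≤ ∑ k ∈ Finset.range n, rateFun θ (pathShift k fun t => (X t ω, σ t ω)) := by
  have hint : Integrable (fun ω => rateFun θ fun t => (X t ω, σ t ω)) μ := by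
    refine (integrable_const (1 : ℝ)).mono'
      (measurable_rateFun.comp h.measurable_pathMap).aestronglyMeasurable ?_
    filter_upwards [h.ae_isPath] with ω hω
    rw [Real.norm_eq_abs, abs_of_pos (rateFun_pos hθ hp hω)]
    exact rateFun_le_one hθ hp hω
  set I := ∫ ω, rateFun θ (fun t => (X t ω, σ t ω)) ∂μ with hI
  have hIpos : 0 < I := by
    rw [hI, integral_pos_iff_support_of_nonneg_ae (by
      filter_upwards [h.ae_isPath] with ω hω using (rateFun_pos hθ hp hω).le) hint]
    refine pos_of_ne_zero fun h0 => ?_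
    have h1 : ∀ᵐ ω ∂μ, False := by
      filter_upwards [h.ae_isPath, measure_eq_zero_iff_ae_notMem.1 h0] with ω hω h2
      exact h2 (rateFun_pos hθ hp hω).ne'
    simp only [eventually_false_iff_eq_bot, ae_eq_bot] at h1
    exact IsProbabilityMeasure.ne_zero μ h1
  -- The function `I / 2 - rateFun` has negative mean, so its sums are bounded above. This one-sided
  -- law gives every linear rate below I.
  refine ⟨I / 2, by positivity, ?_⟩
  have := h.ae_bddAbove_sum (f := fun w => I / 2 - rateFun θ w)
    (measurable_const.sub measurable_rateFun) ((integrable_const _).sub hint) (by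
      rw [integral_sub (integrable_const _) hint, ← hI]
      simp
      linarith)
  filter_upwards [this] with ω ⟨C, hC⟩
  refine ⟨C, fun n => ?_⟩
  have := hC n
  rw [Finset.sum_sub_distrib, Finset.sum_const, Finset.card_range, nsmul_eq_mul] at this
  linarith

theorem coeffSum_recCoeff (θ : AGARCHParam p q) (z : ℤ → ℝ) (t : ℤ) :
    coeffSum (p + q) (θ.recCoeff z) t = coeffFun θ (z t) := rfl

/-- Some root of the response has mean less than one. -/
theorem exists_lintegral_response_lt_one [IsProbabilityMeasure μ]
    (h : IsStationaryAGARCH μ θ Z X σ) (hθ : θ ∈ space p q) (hp : 0 < p) :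
    ∃ n ≥ p + q, ∫⁻ ω, ENNReal.ofReal (response θ Z n ω) ^ ((n : ℝ)⁻¹) ∂μ < 1 := by
  -- The response is at most a constant times `lagFun` at time n times exp(-κ n). Along a
  -- subsequence stationarity keeps `lagFun` below exp(κ n/2), leaving exp(-κ n/2); half of this
  -- exponent absorbs the constants, whence exp(-κ/4) for the n-th root.
  obtain ⟨κ, hκ, hrate⟩ := h.exists_rate hθ hp
  obtain ⟨ns, hns, hsub⟩ := exists_seq_exp_neg_mul_tendsto
    (V := fun (n : ℕ) ω => θ.lagFun (pathShift n fun t => (X t ω, σ t ω)))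
    ((measurable_lagFun θ).comp h.measurable_pathMap)
    (fun n => h.identDistrib_pathShift (measurable_lagFun θ) n) (κ := κ / 2) (by positivity)
  have hresp0 : ∀ n, ∀ᵐ ω ∂μ, 0 ≤ response θ Z n ω := by
    intro n
    filter_upwards [h.ae_isPath] with ω hω
    have hrec := hω.isPosRecursion hθ hp
    exact hrec.lagResp_nonneg hrec.impulseResp_nonneg n
  obtain ⟨n, hn, hlt⟩ := exists_lintegral_lt_one (μ := μ)
    (Y := fun n ω => response θ Z n ω ^ ((n : ℝ)⁻¹)) (A := avgCoeff θ Z)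
    (r := Real.exp (-(κ / 4))) hns
    (fun n => (measurable_response (fun u => h.noise.measurable u) n).pow_const _)
    (fun n => by filter_upwards [hresp0 n] with ω hω using Real.rpow_nonneg hω _)
    (by
      filter_upwards [eventually_ge_atTop (p + q)] with n hn
      filter_upwards [h.ae_isPath, hresp0 n] with ω hω h0
      have hrec := hω.isPosRecursion hθ hp
      refine (Real.rpow_le_rpow h0 (hrec.lagResp_impulseResp_le hn) (by positivity)).trans ?_
      simp only [coeffSum_recCoeff]
      exact prod_rpow_inv_le_avg (fun u => by
        have := hrec.coeffSum_nonneg u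
        rw [coeffSum_recCoeff] at this
        linarith) (by omega))
    h.integrable_avgCoeff
    (by
      filter_upwards [eventually_gt_atTop 0] with n hn using h.integral_avgCoeff hn)
    h.tendsto_avgCoeff (by rw [Real.exp_lt_one_iff]; linarith) (by
      filter_upwards [h.ae_isPath, hrate, hsub, ae_all_iff.2 hresp0] with ω hω ⟨C, hC⟩ hω2 h0
      have hrec := hω.isPosRecursion hθ hp
      have hev : ∀ᶠ n : ℕ in atTop, (κ / 4) * n ≥
          Real.log (Real.exp 1 / θ.alphaZero) + κ * (p + q : ℕ) + C :=
        (tendsto_natCast_atTop_atTop.const_mul_atTop (by positivity)).eventually_ge_atTop _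
      filter_upwards [hω2.eventually_le_const (u := 1) one_pos,
        hns.tendsto_atTop.eventually (hev.and (eventually_ge_atTop (p + q)))] with i h1 ⟨h2, h3⟩
      set n := ns i
      have hD : 0 < Real.exp 1 / θ.alphaZero := div_pos (Real.exp_pos 1) hθ.1
      have hn0 : (0 : ℝ) < n := by exact_mod_cast (by omega : 0 < n)
      have h4 : θ.lagFun (pathShift n fun t => (X t ω, σ t ω)) ≤ Real.exp (κ / 2 * n) := by
        rwa [Real.exp_neg, ← div_eq_inv_mul, div_le_one (Real.exp_pos _)] at h1
      have h5 : ∑ k ∈ Finset.range (n - (p + q)), (1 / (p + q : ℕ)) *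
          ∏ i ∈ Finset.range (p + q), θ.alphaZero / (σ (k + i) ω) ^ 2 =
          ∑ k ∈ Finset.range (n - (p + q)),
            rateFun θ (pathShift k fun t => (X t ω, σ t ω)) := by
        refine Finset.sum_congr rfl fun k _ => ?_
        simp only [rateFun, pathShift, add_comm (k : ℤ)]
      have h6 := hrec.lagResp_impulseResp_le_exp h3
      rw [hω.lagSum_eq, h5] at h6
      have h7 : response θ Z n ω ≤ Real.exp (-(κ / 4) * n) := by
        refine h6.trans ?_
        calc _ ≤ Real.exp 1 / θ.alphaZero * Real.exp (κ / 2 * n) *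
              Real.exp (-(κ * (n - (p + q : ℕ) : ℕ) - C)) := by
              gcongr
              exact hC _
          _ = Real.exp (Real.log (Real.exp 1 / θ.alphaZero) + κ / 2 * n +
              -(κ * (n - (p + q : ℕ) : ℕ) - C)) := by
              rw [Real.exp_add, Real.exp_add, Real.exp_log hD]
          _ ≤ _ := by
              refine Real.exp_le_exp.2 ?_
              rw [Nat.cast_sub h3]
              linarith
      calc response θ Z n ω ^ ((n : ℝ)⁻¹) ≤ Real.exp (-(κ / 4) * n) ^ ((n : ℝ)⁻¹) :=
            Real.rpow_le_rpow (h0 n) h7 (by positivity)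
        _ = Real.exp (-(κ / 4)) := by
            rw [← Real.exp_mul, mul_assoc, mul_inv_cancel₀ hn0.ne', mul_one]) (p + q)
  refine ⟨n, hn, ?_⟩
  refine lt_of_eq_of_lt (lintegral_congr_ae ?_) hlt
  filter_upwards [hresp0 n] with ω h0
  rw [ENNReal.ofReal_rpow_of_nonneg h0 (by positivity)]

theorem exists_noisePast_lagFun (h : IsStationaryAGARCH μ θ Z X σ) :
    ∃ g : Ω → ℝ, Measurable[noisePast Z (-1)] g ∧
      (fun ω => θ.lagFun fun t => (X t ω, σ t ω)) =ᵐ[μ] g := by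
  choose f hfm hf using h.exists_noisePast_path
  refine ⟨fun ω => ∑ l ∈ Finset.range (p + q), ∑ i ∈ Finset.range (p + q),
    (θ.alphaN i * asymSq θ.gamma (f (-1 - l) ω).1 + θ.betaN i * (f (-1 - l) ω).2 ^ 2), ?_, ?_⟩
  · refine Finset.measurable_sum _ fun l _ => Finset.measurable_sum _ fun i _ => ?_
    have hl : Measurable[noisePast Z (-1)] (f (-1 - l)) :=
      (hfm _).mono (noisePast_mono (by omega)) le_rfl
    exact (measurable_const.mul ((measurable_asymSq _).comp (measurable_fst.comp hl))).add
      (measurable_const.mul ((measurable_snd.comp hl).pow_const 2))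
  · filter_upwards [ae_all_iff.2 hf] with ω hω
    simp only [lagFun]
    refine Finset.sum_congr rfl fun l _ => Finset.sum_congr rfl fun i _ => ?_
    rw [← hω]

/-- Adaptedness of the model holds only up to null sets, hence the second variable `g'` with a
past-measurable representative `g`. -/
theorem indepFun_of_measurable (h : IsStationaryAGARCH μ θ Z X σ) {β γ : Type*}
    [MeasurableSpace β] [MeasurableSpace γ] {f : Ω → β} {g g' : Ω → γ} {t : ℤ}
    (hf : Measurable[noiseFuture Z t] f) (hg : Measurable[noisePast Z t] g) (hgg : g' =ᵐ[μ] g) :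
    IndepFun f g' μ := by
  refine IndepFun.congr (f := f) (g := g) ?_ (ae_eq_refl _) hgg.symm
  rw [IndepFun_iff_Indep]
  exact indep_of_indep_of_le (indep_noisePast_noiseFuture h.noise.measurable h.noise.indep t).symm
    hf.comap_le hg.comap_le

/-- The volatility of a stationary AGARCH process has a finite fractional moment. -/
theorem exists_lintegral_vol_rpow_ne_top [IsProbabilityMeasure μ]
    (h : IsStationaryAGARCH μ θ Z X σ) (hθ : θ ∈ space p q) (hp : 0 < p) :
    ∃ κ : ℝ, 0 < κ ∧ κ ≤ 1 ∧ ∫⁻ ω, ENNReal.ofReal (σ 0 ω ^ 2) ^ κ ∂μ ≠ ∞ := by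
  obtain ⟨n, hn, hlt⟩ := h.exists_lintegral_response_lt_one hθ hp
  have hn0 : 0 < n := by omega
  -- For κ = 1/n ≤ 1 the power x ↦ x^κ is subadditive, so the affine inequality for the lagged sums
  -- survives it. Its random slope has mean below one by the choice of n, and its forcing term is
  -- integrable by `prod_rpow_inv_le_avg`.
  set κ : ℝ := (n : ℝ)⁻¹ with hκ
  have hκ0 : 0 < κ := by positivity
  have hκ1 : κ ≤ 1 := inv_le_one_of_one_le₀ (by exact_mod_cast hn0)
  have hφ : Measurable fun x : ℝ => ENNReal.ofReal x ^ κ :=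
    ENNReal.measurable_ofReal.pow_const κ
  have hZ : ∀ u : ℕ, Measurable (Z u) := fun u => h.noise.measurable u
  have hW : ∫⁻ ω, ENNReal.ofReal (θ.lagFun fun t => (X t ω, σ t ω)) ^ κ ∂μ ≠ ∞ := by
    refine lintegral_ne_top_of_affine_bound
      (W' := fun ω => ENNReal.ofReal (θ.lagFun (pathShift n fun t => (X t ω, σ t ω))) ^ κ)
      (h := fun ω => ENNReal.ofReal (response θ Z n ω) ^ κ)
      (q := fun ω => ENNReal.ofReal (θ.alphaZero * forcing θ Z n ω) ^ κ)
      (hφ.comp ((measurable_lagFun θ).comp h.measurable_pathMap)).aemeasurable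
      (hφ.comp (measurable_response hZ n))
      (hφ.comp (measurable_const.mul (measurable_forcing hZ n)))
      (h.identDistrib_pathShift (hφ.comp (measurable_lagFun θ)) n) ?_ ?_ ?_ hlt ?_
    · obtain ⟨g, hgm, hg⟩ := h.exists_noisePast_lagFun
      refine IndepFun.comp (φ := fun x : ℝ => ENNReal.ofReal x ^ κ)
        (ψ := fun x : ℝ => ENNReal.ofReal x ^ κ) ?_ hφ hφ
      exact h.indepFun_of_measurable
        (measurable_response (fun u => measurable_noiseFuture (by omega)) n) hgm hg
    · exact ae_of_all _ fun ω => ENNReal.rpow_ne_top_of_nonneg hκ0.le ENNReal.ofReal_ne_top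
    · filter_upwards [h.ae_isPath] with ω hω
      have hrec := hω.isPosRecursion hθ hp
      have hle := hrec.lagSum_le hn
      have h0 : θ.lagFun (fun t => (X t ω, σ t ω)) =
          lagSum (p + q) (θ.recCoeff fun t => Z t ω) (fun t => σ t ω ^ 2) 0 := by
        rw [hω.lagSum_eq]
        rw [pathShift_zero]
      rw [← hω.lagSum_eq, h0, ← ENNReal.mul_rpow_of_nonneg _ _ hκ0.le, ← ENNReal.ofReal_mul
        (show 0 ≤ response θ Z n ω from hrec.lagResp_nonneg hrec.impulseResp_nonneg n)]
      refine le_trans ?_ (ENNReal.rpow_add_le_add_rpow _ _ hκ0.le hκ1)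
      refine ENNReal.rpow_le_rpow ?_ hκ0.le
      rw [← ENNReal.ofReal_add]
      · exact ENNReal.ofReal_le_ofReal hle
      · exact mul_nonneg hθ.1.le (hrec.lagResp_nonneg
          (volterra.nonneg hrec.kernel_nonneg fun _ => zero_le_one) n)
      · exact mul_nonneg (hrec.lagResp_nonneg hrec.impulseResp_nonneg n) (hrec.lagSum_nonneg 0)
    · refine ne_top_of_le_ne_top (b := ∫⁻ ω, ENNReal.ofReal θ.alphaZero ^ κ *
        ENNReal.ofReal (avgCoeff θ Z n ω) ∂μ) ?_ (lintegral_mono_ae ?_)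
      · rw [lintegral_const_mul' _ _ (ENNReal.rpow_ne_top_of_nonneg hκ0.le ENNReal.ofReal_ne_top)]
        exact ENNReal.mul_ne_top (ENNReal.rpow_ne_top_of_nonneg hκ0.le ENNReal.ofReal_ne_top)
          (h.integrable_avgCoeff n).lintegral_lt_top.ne
      · filter_upwards [h.ae_isPath] with ω hω
        have hrec := hω.isPosRecursion hθ hp
        have h0 : 0 ≤ forcing θ Z n ω := hrec.lagResp_nonneg
          (volterra.nonneg hrec.kernel_nonneg fun _ => zero_le_one) n
        rw [ENNReal.ofReal_mul hθ.1.le, ENNReal.mul_rpow_of_nonneg _ _ hκ0.le]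
        gcongr
        rw [ENNReal.ofReal_rpow_of_nonneg h0 hκ0.le]
        refine ENNReal.ofReal_le_ofReal ?_
        refine (Real.rpow_le_rpow h0 (hrec.lagResp_one_le hn) hκ0.le).trans ?_
        simp only [coeffSum_recCoeff]
        exact prod_rpow_inv_le_avg (fun u => by
          have := hrec.coeffSum_nonneg u
          rw [coeffSum_recCoeff] at this
          linarith) hn0
  refine ⟨κ, hκ0, hκ1, ?_⟩
  refine ne_top_of_le_ne_top (b := ∫⁻ ω, (ENNReal.ofReal θ.alphaZero ^ κ +
    ENNReal.ofReal (θ.lagFun fun t => (X t ω, σ t ω)) ^ κ) ∂μ) ?_ (lintegral_mono_ae ?_)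
  · rw [lintegral_add_left measurable_const, lintegral_const, measure_univ, mul_one]
    exact ENNReal.add_ne_top.2
      ⟨ENNReal.rpow_ne_top_of_nonneg hκ0.le ENNReal.ofReal_ne_top, hW⟩
  · filter_upwards [h.ae_isPath] with ω hω
    refine le_trans ?_ (ENNReal.rpow_add_le_add_rpow _ _ hκ0.le hκ1)
    refine ENNReal.rpow_le_rpow ?_ hκ0.le
    exact (ENNReal.ofReal_le_ofReal (hω.sq_le hθ hp)).trans ENNReal.ofReal_add_le

/-- The squared observations have a finite fractional moment. -/
theorem lintegral_obs_rpow_ne_top [IsProbabilityMeasure μ]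
    (h : IsStationaryAGARCH μ θ Z X σ) {κ : ℝ} (hκ0 : 0 < κ) (hκ1 : κ ≤ 1)
    (hσ : ∫⁻ ω, ENNReal.ofReal (σ 0 ω ^ 2) ^ κ ∂μ ≠ ∞) :
    ∫⁻ ω, ENNReal.ofReal (X 0 ω ^ 2) ^ κ ∂μ ≠ ∞ := by
  have hφ : Measurable fun x : ℝ => ENNReal.ofReal (x ^ 2) ^ κ := by fun_prop
  obtain ⟨g, hgm, hg⟩ := h.vol_adapted 0
  have hind : IndepFun (Z 0) (σ 0) μ :=
    h.indepFun_of_measurable (measurable_noiseFuture (by omega)) hgm hg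
  have heq : ∫⁻ ω, ENNReal.ofReal (X 0 ω ^ 2) ^ κ ∂μ =
      ∫⁻ ω, ENNReal.ofReal (Z 0 ω ^ 2) ^ κ * ENNReal.ofReal (σ 0 ω ^ 2) ^ κ ∂μ := by
    refine lintegral_congr_ae ?_
    filter_upwards [h.obs_eq 0] with ω hω
    rw [hω, mul_pow, mul_comm, ENNReal.ofReal_mul (sq_nonneg _),
      ENNReal.mul_rpow_of_nonneg _ _ hκ0.le]
  have hmul := lintegral_mul_eq_lintegral_mul_lintegral_of_indepFun''
    (hφ.comp (h.noise.measurable 0)).aemeasurable (hφ.comp (h.measurable_vol 0)).aemeasurable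
    (hind.comp hφ hφ)
  simp only [Function.comp_apply] at hmul
  rw [heq, hmul]
  refine ENNReal.mul_ne_top ?_ hσ
  refine ne_top_of_le_ne_top (b := ∫⁻ ω, (1 + ENNReal.ofReal (Z 0 ω ^ 2)) ∂μ) ?_
    (lintegral_mono fun ω => ?_)
  · rw [lintegral_add_left measurable_const, lintegral_const, measure_univ, mul_one]
    exact ENNReal.add_ne_top.2 ⟨ENNReal.one_ne_top, (h.integrable_sq_noise 0).lintegral_lt_top.ne⟩
  · rcases le_total (ENNReal.ofReal (Z 0 ω ^ 2)) 1 with h1 | h1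
    · exact (ENNReal.rpow_le_one h1 hκ0.le).trans le_self_add
    · refine le_trans ?_ le_add_self
      simpa using ENNReal.rpow_le_rpow_of_exponent_le h1 hκ1

end IsStationaryAGARCH

end

/-! ### The stationary approximation of the volatility recursion -/

/-- Contraction of a linear recursion with small nonnegative coefficients. -/
theorem abs_le_of_contracting_recursion {q : ℕ} {b : ℕ → ℝ} {ρ : ℝ} (hρ0 : 0 ≤ ρ) (hρ1 : ρ ≤ 1)
    (hb : ∀ j, 0 ≤ b j) (hsum : ∑ j ∈ Finset.range q, b j ≤ ρ ^ (q + 1)) {d : ℤ → ℝ} {s : ℤ}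
    (hd : ∀ n : ℕ, d (s + 1 + n) = ∑ j ∈ Finset.range q, b j * d (s + n - j)) (n : ℕ) :
    |d (s + 1 + n)| ≤ ρ ^ (n + 1) * ∑ j ∈ Finset.range q, |d (s - j)| := by
  set M := ∑ j ∈ Finset.range q, |d (s - j)| with hM
  have hM0 : 0 ≤ M := Finset.sum_nonneg fun _ _ => abs_nonneg _
  induction n using Nat.strong_induction_on with
  | _ n ih =>
    -- Reaching back j + 1 ≤ q steps loses at most q powers of ρ, which the bound `ρ ^ (q + 1)` on
    -- the coefficient sum repays. Inside the initial window the truncated exponent `n - j` is zero.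
    have hterm : ∀ j ∈ Finset.range q, |b j * d (s + n - j)| ≤ b j * (ρ ^ (n - j) * M) := by
      intro j hj
      rw [abs_mul, abs_of_nonneg (hb j)]
      refine mul_le_mul_of_nonneg_left ?_ (hb j)
      rcases lt_or_ge j n with hjn | hjn
      · have := ih (n - j - 1) (by omega)
        have h1 : s + 1 + ((n - j - 1 : ℕ) : ℤ) = s + n - j := by omega
        rwa [h1, show n - j - 1 + 1 = n - j by omega] at this
      · rw [Nat.sub_eq_zero_of_le hjn, pow_zero, one_mul]
        have h1 : s + (n : ℤ) - j = s - ((j - n : ℕ) : ℤ) := by omega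
        rw [h1]
        have hj' := Finset.mem_range.1 hj
        exact Finset.single_le_sum (f := fun j : ℕ => |d (s - j)|) (fun _ _ => abs_nonneg _)
          (Finset.mem_range.2 (by omega))
    rw [hd n]
    calc |∑ j ∈ Finset.range q, b j * d (s + n - j)|
        ≤ ∑ j ∈ Finset.range q, b j * (ρ ^ (n - j) * M) :=
          (Finset.abs_sum_le_sum_abs _ _).trans (Finset.sum_le_sum hterm)
      _ ≤ ∑ j ∈ Finset.range q, b j * (ρ ^ (n + 1 - q) * M) := by
          refine Finset.sum_le_sum fun j hj => ?_
          have hj' := Finset.mem_range.1 hj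
          refine mul_le_mul_of_nonneg_left (mul_le_mul_of_nonneg_right ?_ hM0) (hb j)
          exact pow_le_pow_of_le_one hρ0 hρ1 (by omega)
      _ ≤ ρ ^ (q + 1) * (ρ ^ (n + 1 - q) * M) := by
          rw [← Finset.sum_mul]
          exact mul_le_mul_of_nonneg_right hsum (by positivity)
      _ = ρ ^ (q + 1 + (n + 1 - q)) * M := by rw [pow_add _ (q + 1), mul_assoc]
      _ ≤ ρ ^ (n + 1) * M :=
          mul_le_mul_of_nonneg_right (pow_le_pow_of_le_one hρ0 hρ1 (by omega)) hM0

namespace AGARCHParam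

variable {p q : ℕ}

/-- The coefficients of the power series `a(z) / (z b(z))`. -/
def archCoeff (θ : AGARCHParam p q) (k : ℕ) : ℝ :=
  volterra (fun n u => θ.betaN (n - 1 - u)) θ.alphaN k

theorem archCoeff_eq (θ : AGARCHParam p q) (k : ℕ) :
    θ.archCoeff k = θ.alphaN k + ∑ u ∈ Finset.range k, θ.betaN (k - 1 - u) * θ.archCoeff u :=
  volterra.eq_add_sum k

/-- Indexing the convolution by the lag of β, over a range independent of `k`, allows summation over
`k` lag by lag. -/
theorem archCoeff_eq' (θ : AGARCHParam p q) (k : ℕ) :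
    θ.archCoeff k = θ.alphaN k +
      ∑ j ∈ Finset.range q, if j < k then θ.betaN j * θ.archCoeff (k - 1 - j) else 0 := by
  rw [archCoeff_eq, ← Finset.sum_range_reflect, ← Finset.sum_filter]
  congr 1
  have h1 : ∑ j ∈ (Finset.range q).filter (· < k), θ.betaN j * θ.archCoeff (k - 1 - j) =
      ∑ j ∈ Finset.range k, θ.betaN j * θ.archCoeff (k - 1 - j) := by
    refine Finset.sum_subset (fun i hi => by simpa using (Finset.mem_filter.1 hi).2) ?_
    intro i hi hi'
    rw [betaN_of_le, zero_mul]
    by_contra! hlt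
    exact hi' (Finset.mem_filter.2 ⟨Finset.mem_range.2 hlt, Finset.mem_range.1 hi⟩)
  rw [h1]
  refine Finset.sum_congr rfl fun u hu => ?_
  have hu := Finset.mem_range.1 hu
  rw [show k - 1 - (k - 1 - u) = u by omega]

theorem archCoeff_nonneg {θ : AGARCHParam p q} (hθ : θ ∈ space p q) (k : ℕ) :
    0 ≤ θ.archCoeff k :=
  volterra.nonneg (fun _ _ => betaN_nonneg hθ _) (alphaN_nonneg hθ) k

theorem alphaN_le_archCoeff {θ : AGARCHParam p q} (hθ : θ ∈ space p q) (k : ℕ) :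
    θ.alphaN k ≤ θ.archCoeff k := by
  rw [archCoeff_eq]
  exact le_add_of_nonneg_right (Finset.sum_nonneg fun _ _ =>
    mul_nonneg (betaN_nonneg hθ _) (archCoeff_nonneg hθ _))

/-- The constant term of the stationary volatility. -/
def volConst (θ : AGARCHParam p q) : ℝ := θ.alphaZero / (1 - ∑ j ∈ Finset.range q, θ.betaN j)

/-- The stationary solution of the volatility recursion with parameter `θ` driven by the
observations `x`. -/
def statVol (θ : AGARCHParam p q) (x : ℤ → ℝ) (t : ℤ) : ℝ :=
  θ.volConst + ∑' k : ℕ, θ.archCoeff k * asymSq θ.gamma (x (t - 1 - k))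

/-- Bounds which hold uniformly on a set of parameters. -/
structure UnifBounds (K : Set (AGARCHParam p q)) (a A ρ : ℝ) : Prop where
  subset : K ⊆ space p q
  a_pos : 0 < a
  rho_pos : 0 < ρ
  rho_lt_one : ρ < 1
  le_alphaZero : ∀ θ ∈ K, a ≤ θ.alphaZero
  alphaZero_le : ∀ θ ∈ K, θ.alphaZero ≤ A
  sum_beta_le : ∀ θ ∈ K, ∑ j ∈ Finset.range q, θ.betaN j ≤ ρ ^ (q + 1)
  alphaN_le : ∀ θ ∈ K, ∀ i, θ.alphaN i ≤ A
  nonneg : 0 ≤ A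

theorem continuous_alphaN (i : ℕ) : Continuous fun θ : AGARCHParam p q => θ.alphaN i := by
  unfold alphaN alpha
  split_ifs <;> fun_prop

theorem continuous_betaN (j : ℕ) : Continuous fun θ : AGARCHParam p q => θ.betaN j := by
  unfold betaN beta
  split_ifs <;> fun_prop

theorem continuous_alphaZero : Continuous fun θ : AGARCHParam p q => θ.alphaZero := by
  unfold alphaZero
  fun_prop

theorem continuous_gamma : Continuous fun θ : AGARCHParam p q => θ.gamma := by
  unfold gamma
  fun_prop

theorem continuous_archCoeff (k : ℕ) : Continuous fun θ : AGARCHParam p q => θ.archCoeff k := by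
  induction k using Nat.strong_induction_on with
  | _ k ih =>
    rw [funext fun θ : AGARCHParam p q => θ.archCoeff_eq k]
    exact (continuous_alphaN k).add (continuous_finsetSum _ fun u hu =>
      (continuous_betaN _).mul (ih u (Finset.mem_range.1 hu)))

theorem sum_betaN_lt_one {θ : AGARCHParam p q} (hθ : θ ∈ space p q) :
    ∑ j ∈ Finset.range q, θ.betaN j < 1 := by
  rw [sum_betaN]
  exact hθ.2.2.1.2

theorem exists_unifBounds {K : Set (AGARCHParam p q)} (hK : IsCompact K) (hne : K.Nonempty)
    (hsub : K ⊆ space p q) : ∃ a A ρ, UnifBounds K a A ρ := by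
  obtain ⟨θ₁, h₁, hmin⟩ := hK.exists_isMinOn hne continuous_alphaZero.continuousOn
  have hcb : Continuous fun θ : AGARCHParam p q => ∑ j ∈ Finset.range q, θ.betaN j :=
    continuous_finsetSum _ fun j _ => continuous_betaN j
  obtain ⟨θ₂, h₂, hmax⟩ := hK.exists_isMaxOn hne hcb.continuousOn
  have hca : Continuous fun θ : AGARCHParam p q => ∑ i ∈ Finset.range p, θ.alphaN i :=
    continuous_finsetSum _ fun i _ => continuous_alphaN i
  obtain ⟨θ₃, h₃, hmax'⟩ := hK.exists_isMaxOn hne hca.continuousOn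
  obtain ⟨θ₄, h₄, hmax₀⟩ := hK.exists_isMaxOn hne continuous_alphaZero.continuousOn
  have hα₃ : 0 ≤ ∑ i ∈ Finset.range p, θ₃.alphaN i :=
    Finset.sum_nonneg fun i _ => alphaN_nonneg (hsub h₃) i
  have hα₄ : 0 < θ₄.alphaZero := (hsub h₄).1
  -- The choice ρ = 1 - (1 - b)/(q + 1) gives ρ^(q+1) ≥ b by Bernoulli's inequality. The lower bound
  -- 1/2 on b keeps ρ positive.
  set b := max (∑ j ∈ Finset.range q, θ₂.betaN j) (1 / 2) with hb
  have hb1 : b < 1 := max_lt (sum_betaN_lt_one (hsub h₂)) (by norm_num)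
  have hb2 : 1 / 2 ≤ b := le_max_right _ _
  have hq : (0 : ℝ) < (q + 1 : ℕ) := by positivity
  have hq1 : (1 : ℝ) ≤ (q + 1 : ℕ) := by exact_mod_cast Nat.succ_le_succ (Nat.zero_le q)
  have hx0 : 0 < (1 - b) / (q + 1 : ℕ) := div_pos (by linarith) hq
  have hx1 : (1 - b) / (q + 1 : ℕ) ≤ 1 / 2 := by
    rw [div_le_iff₀ hq]
    nlinarith
  refine ⟨θ₁.alphaZero, ∑ i ∈ Finset.range p, θ₃.alphaN i + θ₄.alphaZero, 1 + -((1 - b) / (q + 1 : ℕ)), hsub,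
    (hsub h₁).1, by linarith, by linarith, fun θ hθ => hmin hθ,
    fun θ hθ => (hmax₀ hθ : _ ≤ _).trans (le_add_of_nonneg_left hα₃), fun θ hθ => ?_,
    fun θ hθ i => ?_, by linarith⟩
  · have h1 := one_add_mul_le_pow (a := -((1 - b) / (q + 1 : ℕ))) (by linarith) (q + 1)
    have h2 : 1 + ((q + 1 : ℕ) : ℝ) * -((1 - b) / (q + 1 : ℕ)) = b := by
      field_simp
      ring
    rw [h2] at h1
    exact ((hmax hθ : _ ≤ _).trans (le_max_left _ _)).trans h1
  · rcases lt_or_ge i p with hi | hi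
    · refine le_trans ?_ ((hmax' hθ : _ ≤ _).trans (le_add_of_nonneg_right hα₄.le))
      exact Finset.single_le_sum (f := fun i => θ.alphaN i)
        (fun i _ => alphaN_nonneg (hsub hθ) i) (Finset.mem_range.2 hi)
    · rw [alphaN_of_le θ hi]
      linarith

/-- The dominating functional of the observations. -/
def pathDom (ρ : ℝ) (x : ℤ → ℝ) (t : ℤ) : ℝ := ∑' k : ℕ, ρ ^ k * (1 + x (t - 1 - k) ^ 2)

/-- The observations grow slowly enough for the dominating functional to be finite. -/
def TemperedPath (ρ : ℝ) (x : ℤ → ℝ) : Prop :=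
  ∀ t : ℤ, Summable fun k : ℕ => ρ ^ k * (1 + x (t - 1 - k) ^ 2)

theorem asymSq_le_of_mem {θ : AGARCHParam p q} (hθ : θ ∈ space p q) (x : ℝ) :
    asymSq θ.gamma x ≤ 4 * x ^ 2 := by
  refine (asymSq_le _ _).trans ?_
  have : |θ.gamma| ≤ 1 := abs_le.2 hθ.2.2.2
  have h0 := abs_nonneg θ.gamma
  gcongr
  nlinarith

namespace UnifBounds

variable {K : Set (AGARCHParam p q)} {a A ρ : ℝ} {θ : AGARCHParam p q}

/-- The constant in the exponential bound of the coefficients. -/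
def archBound (p : ℕ) (A ρ : ℝ) : ℝ := A / (ρ ^ p * (1 - ρ))

theorem archBound_nonneg (h : UnifBounds K a A ρ) : 0 ≤ archBound p A ρ := by
  have := h.rho_pos
  have h1 := sub_pos.2 h.rho_lt_one
  exact div_nonneg h.nonneg (by positivity)

/-- The geometric sequence on the right is a supersolution: its share 1 - ρ covers `alphaN k`, which
vanishes for k ≥ p (hence ρ^p in the constant), and the remaining share ρ covers the convolution
with β. -/
theorem archCoeff_le (h : UnifBounds K a A ρ) (hθ : θ ∈ K) (k : ℕ) :
    θ.archCoeff k ≤ archBound p A ρ * ρ ^ k := by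
  have hρ := h.rho_pos
  have hρ1 := sub_pos.2 h.rho_lt_one
  have hD := h.archBound_nonneg
  refine volterra.le_of_ge (x := fun k => archBound p A ρ * ρ ^ k)
    (fun _ _ => betaN_nonneg (h.subset hθ) _) (fun k => ?_) k
  have h1 : θ.alphaN k ≤ archBound p A ρ * ρ ^ k * (1 - ρ) := by
    rcases lt_or_ge k p with hk | hk
    · refine (h.alphaN_le θ hθ k).trans ?_
      have h2 : A = archBound p A ρ * ρ ^ p * (1 - ρ) := by
        unfold archBound
        field_simp
      conv_lhs => rw [h2]
      gcongr archBound p A ρ * ?_ * _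
      exact pow_le_pow_of_le_one hρ.le h.rho_lt_one.le hk.le
    · rw [alphaN_of_le θ hk]
      positivity
  have h2 : ∑ u ∈ Finset.range k, θ.betaN (k - 1 - u) * (archBound p A ρ * ρ ^ u) ≤
      archBound p A ρ * ρ ^ k * ρ := by
    have h3 : ∑ u ∈ Finset.range k, θ.betaN (k - 1 - u) * (archBound p A ρ * ρ ^ u) ≤
        ∑ u ∈ Finset.range k, θ.betaN (k - 1 - u) * (archBound p A ρ * ρ ^ (k - q)) := by
      refine Finset.sum_le_sum fun u _ => ?_
      rcases lt_or_ge u (k - q) with hu | hu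
      · rw [betaN_of_le θ (by omega), zero_mul, zero_mul]
      · exact mul_le_mul_of_nonneg_left (mul_le_mul_of_nonneg_left
          (pow_le_pow_of_le_one hρ.le h.rho_lt_one.le hu) hD) (betaN_nonneg (h.subset hθ) _)
    have h4 : ∑ u ∈ Finset.range k, θ.betaN (k - 1 - u) ≤ ∑ j ∈ Finset.range q, θ.betaN j := by
      rw [Finset.sum_range_reflect (fun j => θ.betaN j)]
      rcases le_total k q with hkq | hkq
      · exact Finset.sum_le_sum_of_subset_of_nonneg (Finset.range_mono hkq)
          fun j _ _ => betaN_nonneg (h.subset hθ) j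
      · refine (Finset.sum_subset (Finset.range_mono hkq) fun j _ hj => ?_).ge
        exact betaN_of_le θ (by simpa using hj)
    refine h3.trans ?_
    rw [← Finset.sum_mul]
    calc (∑ u ∈ Finset.range k, θ.betaN (k - 1 - u)) * (archBound p A ρ * ρ ^ (k - q))
        ≤ ρ ^ (q + 1) * (archBound p A ρ * ρ ^ (k - q)) :=
          mul_le_mul_of_nonneg_right (h4.trans (h.sum_beta_le θ hθ)) (by positivity)
      _ = archBound p A ρ * ρ ^ (k - q + q + 1) := by rw [pow_add, pow_add, pow_add]; ring
      _ ≤ archBound p A ρ * ρ ^ (k + 1) := by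
          gcongr archBound p A ρ * ?_
          exact pow_le_pow_of_le_one hρ.le h.rho_lt_one.le (by omega)
      _ = _ := by ring
  linarith

theorem sum_betaN_lt_one (h : UnifBounds K a A ρ) (hθ : θ ∈ K) :
    ∑ j ∈ Finset.range q, θ.betaN j < 1 :=
  AGARCHParam.sum_betaN_lt_one (h.subset hθ)

theorem le_volConst (h : UnifBounds K a A ρ) (hθ : θ ∈ K) : a ≤ θ.volConst := by
  have h1 := h.sum_betaN_lt_one hθ
  have h0 : 0 ≤ ∑ j ∈ Finset.range q, θ.betaN j :=
    Finset.sum_nonneg fun j _ => betaN_nonneg (h.subset hθ) j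
  refine (h.le_alphaZero θ hθ).trans ?_
  unfold volConst
  rw [le_div_iff₀ (by linarith)]
  nlinarith [(h.subset hθ).1]

theorem summable_archCoeff (h : UnifBounds K a A ρ) (hθ : θ ∈ K) {x : ℤ → ℝ}
    (hx : TemperedPath ρ x) (t : ℤ) :
    Summable fun k : ℕ => θ.archCoeff k * asymSq θ.gamma (x (t - 1 - k)) := by
  refine Summable.of_nonneg_of_le (fun k => mul_nonneg (archCoeff_nonneg (h.subset hθ) k)
    (asymSq_nonneg _ _)) (fun k => ?_) ((hx t).mul_left (archBound p A ρ * 4))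
  have hD := h.archBound_nonneg
  have hρ := h.rho_pos
  calc θ.archCoeff k * asymSq θ.gamma (x (t - 1 - k))
      ≤ (archBound p A ρ * ρ ^ k) * (4 * x (t - 1 - k) ^ 2) :=
        mul_le_mul (h.archCoeff_le hθ k) (asymSq_le_of_mem (h.subset hθ) _)
          (asymSq_nonneg _ _) (by positivity)
    _ ≤ (archBound p A ρ * ρ ^ k) * (4 * (1 + x (t - 1 - k) ^ 2)) := by
        gcongr
        linarith
    _ = _ := by ring

theorem le_statVol (h : UnifBounds K a A ρ) (hθ : θ ∈ K) (x : ℤ → ℝ) (t : ℤ) :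
    a ≤ θ.statVol x t :=
  (h.le_volConst hθ).trans (le_add_of_nonneg_right (tsum_nonneg fun k =>
    mul_nonneg (archCoeff_nonneg (h.subset hθ) k) (asymSq_nonneg _ _)))

/-- The stationary solution satisfies the volatility recursion. -/
theorem statVol_eq (h : UnifBounds K a A ρ) (hθ : θ ∈ K) {x : ℤ → ℝ}
    (hx : TemperedPath ρ x) (t : ℤ) :
    θ.statVol x t = θ.alphaZero +
      ∑ i ∈ Finset.range p, θ.alphaN i * asymSq θ.gamma (x (t - 1 - i)) +
      ∑ j ∈ Finset.range q, θ.betaN j * θ.statVol x (t - 1 - j) := by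
  set y : ℕ → ℝ := fun k => asymSq θ.gamma (x (t - 1 - k)) with hy
  -- Shifted by j + 1 lags, all series run over the same observations, and the recursion reduces to
  -- the coefficient identity `archCoeff_eq'`.
  have hshift : ∀ j : ℕ, HasSum (fun k : ℕ => if j < k then θ.archCoeff (k - 1 - j) * y k else 0)
      (∑' k : ℕ, θ.archCoeff k * asymSq θ.gamma (x (t - 1 - j - 1 - k))) := by
    intro j
    rw [← hasSum_nat_add_iff' (j + 1)]
    have h0 : ∑ i ∈ Finset.range (j + 1),
        (if j < i then θ.archCoeff (i - 1 - j) * y i else 0) = 0 :=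
      Finset.sum_eq_zero fun i hi => if_neg (by have := Finset.mem_range.1 hi; omega)
    rw [h0, sub_zero]
    refine (h.summable_archCoeff hθ hx (t - 1 - j)).hasSum.congr_fun fun k => ?_
    rw [if_pos (by omega), show k + (j + 1) - 1 - j = k by omega]
    simp only [hy]
    congr 3
    push_cast
    ring
  have hfin : HasSum (fun k : ℕ => θ.alphaN k * y k) (∑ i ∈ Finset.range p, θ.alphaN i * y i) :=
    hasSum_sum_of_ne_finset_zero fun k hk => by
      rw [alphaN_of_le θ (by simpa using hk), zero_mul]
  have hall : HasSum (fun k : ℕ => θ.archCoeff k * y k)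
      (∑ i ∈ Finset.range p, θ.alphaN i * y i + ∑ j ∈ Finset.range q, θ.betaN j *
        ∑' k : ℕ, θ.archCoeff k * asymSq θ.gamma (x (t - 1 - j - 1 - k))) := by
    refine (hfin.add (hasSum_sum fun j _ => (hshift j).mul_left (θ.betaN j))).congr_fun fun k => ?_
    rw [archCoeff_eq', add_mul, Finset.sum_mul]
    congr 1
    refine Finset.sum_congr rfl fun j _ => ?_
    split_ifs <;> ring
  have h1 := h.sum_betaN_lt_one hθ
  have hc : θ.volConst = θ.alphaZero + (∑ j ∈ Finset.range q, θ.betaN j) * θ.volConst := by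
    unfold volConst
    have : 1 - ∑ j ∈ Finset.range q, θ.betaN j ≠ 0 := by linarith
    field_simp
    ring
  unfold statVol
  rw [hall.tsum_eq]
  simp only [mul_add, Finset.sum_add_distrib, ← Finset.sum_mul]
  linarith

end UnifBounds

end AGARCHParam

namespace AGARCHParam

variable {p q : ℕ}

/-- Separates parameter and observation: polynomials in γ multiply x² and x|x|. Changes of the
parameter are therefore controlled by x² alone. -/
theorem asymSq_eq (γ x : ℝ) : asymSq γ x = (1 + γ ^ 2) * x ^ 2 - 2 * γ * (x * |x|) := by
  unfold asymSq
  rw [sub_sq, sq_abs]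
  ring

theorem abs_mul_asymSq_sub_le (c c' γ γ' x : ℝ) : |c * asymSq γ x - c' * asymSq γ' x| ≤
    (|c * (1 + γ ^ 2) - c' * (1 + γ' ^ 2)| + 2 * |c * γ - c' * γ'|) * x ^ 2 := by
  have h1 : c * asymSq γ x - c' * asymSq γ' x =
      (c * (1 + γ ^ 2) - c' * (1 + γ' ^ 2)) * x ^ 2 - 2 * (c * γ - c' * γ') * (x * |x|) := by
    rw [asymSq_eq, asymSq_eq]
    ring
  rw [h1]
  refine (abs_sub _ _).trans_eq ?_
  have h2 : abs (x * |x|) = x ^ 2 := by rw [abs_mul, abs_abs, ← sq, sq_abs]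
  rw [abs_mul, abs_mul (2 * _), h2, abs_mul 2, abs_of_nonneg (sq_nonneg x), abs_two]
  ring

theorem TemperedPath.mono {ρ ρ' : ℝ} (hρ : 0 ≤ ρ) (hle : ρ ≤ ρ') {x : ℤ → ℝ}
    (hx : TemperedPath ρ' x) : TemperedPath ρ x := fun t =>
  Summable.of_nonneg_of_le (fun k => by positivity) (fun k => by gcongr) (hx t)

namespace UnifBounds

variable {K : Set (AGARCHParam p q)} {a A ρ : ℝ} {θ : AGARCHParam p q}

/-- The stationary volatility depends on the parameter continuously, uniformly relative to the
dominating functional. -/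
theorem eventually_abs_statVol_sub_le (h : UnifBounds K a A ρ) {ρ' : ℝ} (hρ' : ρ < ρ')
    {θ₁ : AGARCHParam p q} (hθ₁ : θ₁ ∈ K) {η : ℝ} (hη : 0 < η) :
    ∀ᶠ θ in 𝓝[K] θ₁, ∀ x, TemperedPath ρ' x → ∀ t,
      |θ.statVol x t - θ₁.statVol x t| ≤ η * pathDom ρ' x t := by
  have hρ := h.rho_pos
  have hD := h.archBound_nonneg
  set D := UnifBounds.archBound p A ρ
  set d : ℕ → AGARCHParam p q → ℝ := fun k θ =>
    |θ.archCoeff k * (1 + θ.gamma ^ 2) - θ₁.archCoeff k * (1 + θ₁.gamma ^ 2)| +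
      2 * |θ.archCoeff k * θ.gamma - θ₁.archCoeff k * θ₁.gamma| with hd
  have hdK : ∀ θ ∈ K, ∀ k, d k θ ≤ 8 * D * ρ ^ k := by
    intro θ hθ k
    have e1 := h.archCoeff_le hθ k
    have e2 := h.archCoeff_le hθ₁ k
    have e3 := archCoeff_nonneg (h.subset hθ) k
    have e4 := archCoeff_nonneg (h.subset hθ₁) k
    have g1 := (h.subset hθ).2.2.2
    have g2 := (h.subset hθ₁).2.2.2
    have s1 : θ.gamma ^ 2 ≤ 1 := by nlinarith
    have s2 : θ₁.gamma ^ 2 ≤ 1 := by nlinarith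
    have a1 : |θ.archCoeff k * (1 + θ.gamma ^ 2) - θ₁.archCoeff k * (1 + θ₁.gamma ^ 2)| ≤
        2 * (D * ρ ^ k) := by
      rw [abs_le]
      constructor <;> nlinarith [sq_nonneg θ.gamma, sq_nonneg θ₁.gamma]
    have a2 : |θ.archCoeff k * θ.gamma - θ₁.archCoeff k * θ₁.gamma| ≤ 2 * (D * ρ ^ k) := by
      rw [abs_le]
      constructor <;> nlinarith
    simp only [hd]
    nlinarith [mul_nonneg hD (pow_nonneg hρ.le k)]
  have hd0 : ∀ k, Tendsto (d k) (𝓝[K] θ₁) (𝓝 0) := by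
    intro k
    have hc : Continuous (d k) := by
      have h1 := continuous_archCoeff (p := p) (q := q) k
      have h2 := continuous_gamma (p := p) (q := q)
      simp only [hd]
      fun_prop
    have : d k θ₁ = 0 := by simp [hd]
    rw [← this]
    exact hc.continuousWithinAt
  -- For large k the uniform bound 8Dρ^k is already below ηρ'^k, since ρ < ρ'. The finitely many
  -- remaining coefficients are handled by continuity.
  have hev : ∀ᶠ θ in 𝓝[K] θ₁, ∀ k, d k θ ≤ η * ρ' ^ k := by
    have hlim : Tendsto (fun k : ℕ => 8 * D * (ρ / ρ') ^ k) atTop (𝓝 0) := by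
      have := (tendsto_pow_atTop_nhds_zero_of_lt_one (r := ρ / ρ')
        (div_nonneg hρ.le (hρ.le.trans hρ'.le))
        ((div_lt_one (hρ.trans hρ')).2 hρ')).const_mul (8 * D)
      simpa using this
    obtain ⟨k₀, hk₀⟩ := eventually_atTop.1 (hlim.eventually_le_const hη)
    have hfin : ∀ᶠ θ in 𝓝[K] θ₁, ∀ k ∈ Finset.range k₀, d k θ ≤ η * ρ' ^ k :=
      (eventually_all_finset _).2 fun k _ =>
        (hd0 k).eventually_le_const (mul_pos hη (pow_pos (hρ.trans hρ') k))
    filter_upwards [hfin, self_mem_nhdsWithin] with θ h1 h2 k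
    rcases lt_or_ge k k₀ with hk | hk
    · exact h1 k (Finset.mem_range.2 hk)
    · have h3 := hk₀ k hk
      rw [div_pow, ← mul_div_assoc, div_le_iff₀ (pow_pos (hρ.trans hρ') k)] at h3
      exact (hdK θ h2 k).trans h3
  have hconst : ∀ᶠ θ in 𝓝[K] θ₁, |θ.volConst - θ₁.volConst| ≤ η := by
    have hc : ContinuousWithinAt (fun θ : AGARCHParam p q => θ.volConst) K θ₁ := by
      unfold volConst
      refine continuous_alphaZero.continuousWithinAt.div (continuous_const.sub
        (continuous_finsetSum _ fun j _ => continuous_betaN j)).continuousWithinAt ?_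
      have := h.sum_betaN_lt_one hθ₁
      linarith
    have := (hc.tendsto.sub_const θ₁.volConst).abs
    rw [sub_self, abs_zero] at this
    exact this.eventually_le_const hη
  filter_upwards [hev, hconst, self_mem_nhdsWithin] with θ h1 h2 hθ x hx t
  have hx' := hx.mono hρ.le hρ'.le
  have hs := (h.summable_archCoeff hθ hx' t).sub (h.summable_archCoeff hθ₁ hx' t)
  have hρ'0 : 0 ≤ ρ' := (hρ.trans hρ').le
  have hsq : Summable fun k : ℕ => η * (ρ' ^ k * x (t - 1 - k) ^ 2) :=
    (Summable.of_nonneg_of_le (fun k => by positivity)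
      (fun k => mul_le_mul_of_nonneg_left (by linarith) (pow_nonneg hρ'0 k)) (hx t)).mul_left η
  have hgeo : Summable fun k : ℕ => ρ' ^ k :=
    Summable.of_nonneg_of_le (fun k => by positivity)
      (fun k => le_mul_of_one_le_right (pow_nonneg hρ'0 k) (by nlinarith [sq_nonneg (x (t - 1 - k))]))
      (hx t)
  have hdiff : |∑' k : ℕ, (θ.archCoeff k * asymSq θ.gamma (x (t - 1 - k)) -
      θ₁.archCoeff k * asymSq θ₁.gamma (x (t - 1 - k)))| ≤
      ∑' k : ℕ, η * (ρ' ^ k * x (t - 1 - k) ^ 2) := by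
    rw [← Real.norm_eq_abs]
    refine tsum_of_norm_bounded hsq.hasSum fun k => ?_
    rw [Real.norm_eq_abs]
    refine (abs_mul_asymSq_sub_le _ _ _ _ _).trans ?_
    rw [← mul_assoc]
    exact mul_le_mul_of_nonneg_right (h1 k) (sq_nonneg _)
  have hdom : η + ∑' k : ℕ, η * (ρ' ^ k * x (t - 1 - k) ^ 2) ≤ η * pathDom ρ' x t := by
    rw [tsum_mul_left, ← mul_one_add]
    refine mul_le_mul_of_nonneg_left ?_ hη.le
    unfold pathDom
    have hsq' : Summable fun k : ℕ => ρ' ^ k * x (t - 1 - k) ^ 2 := by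
      have := hsq.mul_left η⁻¹
      simpa [inv_mul_cancel_left₀ hη.ne'] using this
    simp only [mul_add, mul_one]
    rw [hgeo.tsum_add hsq']
    have : 1 ≤ ∑' k : ℕ, ρ' ^ k := by
      simpa using hgeo.le_tsum 0 fun k _ => pow_nonneg hρ'0 k
    linarith
  refine le_trans ?_ hdom
  have : θ.statVol x t - θ₁.statVol x t = (θ.volConst - θ₁.volConst) +
      ∑' k : ℕ, (θ.archCoeff k * asymSq θ.gamma (x (t - 1 - k)) -
      θ₁.archCoeff k * asymSq θ₁.gamma (x (t - 1 - k))) := by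
    rw [(h.summable_archCoeff hθ hx' t).tsum_sub (h.summable_archCoeff hθ₁ hx' t)]
    unfold statVol
    ring
  rw [this]
  exact (abs_add_le _ _).trans (add_le_add h2 hdiff)

theorem statVol_le (h : UnifBounds K a A ρ) (hθ : θ ∈ K) {x : ℤ → ℝ} (hx : TemperedPath ρ x)
    (t : ℤ) : θ.statVol x t ≤ A / (1 - ρ) + 4 * archBound p A ρ * pathDom ρ x t := by
  have hρ := h.rho_pos
  have hD := h.archBound_nonneg
  have hρ1 := sub_pos.2 h.rho_lt_one
  refine add_le_add ?_ ?_
  · have h1 : ∑ j ∈ Finset.range q, θ.betaN j ≤ ρ := (h.sum_beta_le θ hθ).trans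
      (pow_le_of_le_one hρ.le h.rho_lt_one.le (Nat.succ_ne_zero q))
    exact div_le_div₀ h.nonneg (h.alphaZero_le θ hθ) hρ1 (by linarith)
  · unfold pathDom
    rw [← tsum_mul_left]
    refine (h.summable_archCoeff hθ hx t).tsum_le_tsum (fun k => ?_) ((hx t).mul_left _)
    calc θ.archCoeff k * asymSq θ.gamma (x (t - 1 - k))
        ≤ (archBound p A ρ * ρ ^ k) * (4 * x (t - 1 - k) ^ 2) :=
          mul_le_mul (h.archCoeff_le hθ k) (asymSq_le_of_mem (h.subset hθ) _)
            (asymSq_nonneg _ _) (by positivity)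
      _ ≤ (archBound p A ρ * ρ ^ k) * (4 * (1 + x (t - 1 - k) ^ 2)) := by
          gcongr
          linarith
      _ = _ := by ring

end UnifBounds

/-! ### The observable recursion -/

/-- The observable approximation of the volatility, indexed by `ℤ`: the recursion at positive
times, the initial values before. -/
def hHatSeq (θ : AGARCHParam p q) (ς : Fin q → ℝ) (x : ℤ → ℝ) (s : ℤ) : ℝ :=
  if 1 ≤ s then θ.hHatSucc ς x (s - 1).toNat
  else if h : (-s).toNat < q then ς ⟨(-s).toNat, h⟩ else 0

theorem hHatSeq_succ (θ : AGARCHParam p q) (ς : Fin q → ℝ) (x : ℤ → ℝ) (t : ℕ) :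
    θ.hHatSeq ς x (t + 1) = θ.hHatSucc ς x t := by
  rw [hHatSeq, if_pos (by omega)]
  congr 1
  omega

/-- Presents the state vector as a window of one sequence on ℤ, so that the observable and the
stationary volatility obey the same scalar recursion and can be subtracted. -/
theorem hHatVec_eq_lagVec (θ : AGARCHParam p q) (ς : Fin q → ℝ) (x : ℤ → ℝ) (t : ℕ) :
    θ.hHatVec ς x t = lagVec (θ.hHatSeq ς x) q t := by
  induction t with
  | zero =>
    funext j
    have hj := j.2
    rw [lagVec, hHatSeq, if_neg (by omega), dif_pos (by omega)]
    simp only [hHatVec]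
    congr 1
    ext
    simp
  | succ t ih =>
    funext j
    rw [hHatVec]
    obtain ⟨j, hj⟩ := j
    cases j with
    | zero =>
      simp only [lagVec]
      have : ((t + 1 : ℕ) : ℤ) - ((0 : ℕ) : ℤ) = (t : ℤ) + 1 := by push_cast; ring
      rw [this, hHatSeq_succ]
      rfl
    | succ j =>
      change Matrix.vecCons (θ.volMap (lagVec x p t) (θ.hHatVec ς x t)) (θ.hHatVec ς x t)
        (Fin.succ ⟨j, by omega⟩) = _
      rw [Matrix.cons_val_succ, ih]
      simp only [lagVec]
      congr 1
      push_cast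
      ring

theorem hHatSucc_eq (θ : AGARCHParam p q) (ς : Fin q → ℝ) (x : ℤ → ℝ) (t : ℕ) :
    θ.hHatSucc ς x t = θ.alphaZero +
      ∑ i ∈ Finset.range p, θ.alphaN i * asymSq θ.gamma (x (t - i)) +
      ∑ j ∈ Finset.range q, θ.betaN j * θ.hHatSeq ς x (t - j) := by
  have := volMap_lagVec θ x (θ.hHatSeq ς x) (t + 1)
  rw [add_sub_cancel_right] at this
  rw [hHatSucc, hHatVec_eq_lagVec, this]

theorem hHatVec_nonneg {θ : AGARCHParam p q} (hθ : θ ∈ space p q) {ς : Fin q → ℝ}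
    (hς : ∀ j, 0 ≤ ς j) (x : ℤ → ℝ) (t : ℕ) (j : Fin q) : 0 ≤ θ.hHatVec ς x t j := by
  induction t generalizing j with
  | zero => exact hς j
  | succ t ih =>
    rw [hHatVec]
    have h0 : 0 ≤ θ.volMap (lagVec x p t) (θ.hHatVec ς x t) :=
      add_nonneg (add_nonneg hθ.1.le (Finset.sum_nonneg fun i _ =>
        mul_nonneg (hθ.2.1 i) (sq_nonneg _))) (Finset.sum_nonneg fun i _ =>
        mul_nonneg (hθ.2.2.1.1 i).1 (ih i))
    refine Fin.cases (motive := fun i => 0 ≤ Matrix.vecCons (θ.volMap (lagVec x p t)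
      (θ.hHatVec ς x t)) (θ.hHatVec ς x t) i) ?_ (fun i => ?_) j.castSucc
    · exact h0
    · exact ih i

theorem alphaZero_le_hHatSucc {θ : AGARCHParam p q} (hθ : θ ∈ space p q) {ς : Fin q → ℝ}
    (hς : ∀ j, 0 ≤ ς j) (x : ℤ → ℝ) (t : ℕ) : θ.alphaZero ≤ θ.hHatSucc ς x t := by
  unfold hHatSucc volMap
  rw [add_assoc]
  refine le_add_of_nonneg_right (add_nonneg (Finset.sum_nonneg fun i _ =>
        mul_nonneg (hθ.2.1 i) (sq_nonneg _)) (Finset.sum_nonneg fun i _ =>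
        mul_nonneg (hθ.2.2.1.1 i).1 (hHatVec_nonneg hθ hς x t i)))

theorem continuous_hHatVec (ς : Fin q → ℝ) (x : ℤ → ℝ) (t : ℕ) (j : Fin q) :
    Continuous fun θ : AGARCHParam p q => θ.hHatVec ς x t j := by
  induction t generalizing j with
  | zero => exact continuous_const
  | succ t ih =>
    simp only [hHatVec]
    refine Fin.cases ?_ (fun i => ?_) j.castSucc
    · simp only [Matrix.cons_val_zero]
      unfold volMap alphaZero alpha beta gamma
      fun_prop
    · simp only [Matrix.cons_val_succ]
      exact ih i

theorem continuous_hHatSucc (ς : Fin q → ℝ) (x : ℤ → ℝ) (t : ℕ) :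
    Continuous fun θ : AGARCHParam p q => θ.hHatSucc ς x t := by
  have := continuous_hHatVec (p := p) ς x t
  unfold hHatSucc volMap alphaZero alpha beta gamma
  fun_prop

/-- The likelihood attains its maximum on every compact set of parameters. -/
theorem exists_isQMLE {K : Set (AGARCHParam p q)} (hK : IsCompact K) (hne : K.Nonempty)
    (hsub : K ⊆ space p q) {ς : Fin q → ℝ} (hς : ∀ j, 0 ≤ ς j) (x : ℤ → ℝ) (n : ℕ) :
    ∃ θ, IsQMLE K ς x n θ := by
  have hpos : ∀ θ ∈ K, ∀ t, θ.hHatSucc ς x t ≠ 0 := fun θ hθ t =>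
    ((hsub hθ).1.trans_le (alphaZero_le_hHatSucc (hsub hθ) hς x t)).ne'
  have hc : ContinuousOn (logLik ς x n) K := by
    unfold logLik
    refine continuousOn_const.mul (continuousOn_finsetSum _ fun t _ => ?_)
    have h1 := (continuous_hHatSucc (p := p) ς x t).continuousOn (s := K)
    exact (continuousOn_const.div h1 fun θ hθ => hpos θ hθ t).add
      (h1.log fun θ hθ => hpos θ hθ t)
  obtain ⟨θ, hθ, hmax⟩ := hK.exists_isMaxOn hne hc
  exact ⟨θ, hθ, hmax⟩

theorem abs_log_sub_log_le {a u v : ℝ} (ha : 0 < a) (hu : a ≤ u) (hv : a ≤ v) :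
    |Real.log u - Real.log v| ≤ |u - v| / a := by
  have key : ∀ u v : ℝ, a ≤ u → a ≤ v → Real.log u - Real.log v ≤ |u - v| / a := by
    intro u v hu hv
    have hu0 := ha.trans_le hu
    have hv0 := ha.trans_le hv
    rw [← Real.log_div hu0.ne' hv0.ne']
    refine (Real.log_le_sub_one_of_pos (div_pos hu0 hv0)).trans ?_
    rw [div_sub_one hv0.ne']
    exact (div_le_div_of_nonneg_right (le_abs_self _) hv0.le).trans
      (div_le_div_of_nonneg_left (abs_nonneg _) ha hv)
  rw [abs_le']
  refine ⟨key u v hu hv, ?_⟩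
  have := key v u hv hu
  rw [abs_sub_comm] at this
  linarith

theorem abs_div_sub_div_le {a u v y : ℝ} (ha : 0 < a) (hu : a ≤ u) (hv : a ≤ v) (hy : 0 ≤ y) :
    |y / u - y / v| ≤ y * |u - v| / a ^ 2 := by
  have hu0 := ha.trans_le hu
  have hv0 := ha.trans_le hv
  have h1 : y / u - y / v = y * (v - u) / (u * v) := by
    field_simp
  rw [h1, abs_div, abs_mul, abs_of_nonneg hy, abs_of_pos (mul_pos hu0 hv0), abs_sub_comm, sq]
  gcongr

/-- Minus twice the likelihood computed from the stationary volatility. -/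
def statLoss (θ : AGARCHParam p q) (x : ℤ → ℝ) (n : ℕ) : ℝ :=
  ∑ t ∈ Finset.range n,
    (x ((t : ℤ) + 1) ^ 2 / θ.statVol x (t + 1) + Real.log (θ.statVol x (t + 1)))

namespace UnifBounds

variable {K : Set (AGARCHParam p q)} {a A ρ : ℝ}

/-- The difference solves the homogeneous β-recursion from time zero on, and `statVol_le` bounds its
initial window uniformly over K. -/
theorem exists_abs_hHatSucc_sub_le (h : UnifBounds K a A ρ) {ς : Fin q → ℝ} {x : ℤ → ℝ}
    (hx : TemperedPath ρ x) : ∃ C, 0 ≤ C ∧ ∀ θ ∈ K, ∀ n : ℕ,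
      |θ.hHatSucc ς x n - θ.statVol x (n + 1)| ≤ C * ρ ^ n := by
  have hρ := h.rho_pos
  have hρ1 := h.rho_lt_one
  set C : ℝ := ∑ j ∈ Finset.range q, ((if h : j < q then |ς ⟨j, h⟩| else 0) +
    (A / (1 - ρ) + 4 * archBound p A ρ * pathDom ρ x (-j))) with hC
  have hC' : ∀ θ ∈ K, ∑ j ∈ Finset.range q, |θ.hHatSeq ς x (0 - j) - θ.statVol x (0 - j)| ≤ C := by
    intro θ hθ
    refine Finset.sum_le_sum fun j hj => ?_
    have hj := Finset.mem_range.1 hj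
    refine (abs_sub _ _).trans (add_le_add ?_ ?_)
    · rw [hHatSeq, if_neg (by omega), dif_pos hj, dif_pos (by omega)]
      refine le_of_eq ?_
      congr 3
      omega
    · rw [zero_sub, abs_of_pos (h.a_pos.trans_le (h.le_statVol hθ x _))]
      exact h.statVol_le hθ hx _
  refine ⟨max C 0, le_max_right _ _, fun θ hθ n => ?_⟩
  have := abs_le_of_contracting_recursion (d := fun s => θ.hHatSeq ς x s - θ.statVol x s) (s := 0)
    hρ.le hρ1.le (fun j => betaN_nonneg (h.subset hθ) j) (h.sum_beta_le θ hθ) (fun n => by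
      have e1 : (0 : ℤ) + 1 + n = n + 1 := by ring
      rw [e1, hHatSeq_succ, hHatSucc_eq, h.statVol_eq hθ hx]
      simp only [add_sub_cancel_right, zero_add, mul_sub, Finset.sum_sub_distrib]
      ring) n
  have e1 : (0 : ℤ) + 1 + n = n + 1 := by ring
  rw [e1, hHatSeq_succ] at this
  refine this.trans ?_
  rw [mul_comm]
  refine mul_le_mul ((hC' θ hθ).trans (le_max_left _ _)) ?_ (by positivity) (le_max_right _ _)
  exact pow_le_pow_of_le_one hρ.le hρ1.le (Nat.le_succ n)

/-- The initial values are asymptotically negligible. -/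
theorem exists_abs_logLik_add_statLoss_le (h : UnifBounds K a A ρ) {ς : Fin q → ℝ}
    (hς : ∀ j, 0 ≤ ς j) {x : ℤ → ℝ} (hx : TemperedPath ρ x)
    (hfwd : Summable fun k : ℕ => ρ ^ k * (1 + x (k + 1) ^ 2)) :
    ∃ C, ∀ θ ∈ K, ∀ n : ℕ, |2 * logLik ς x n θ + θ.statLoss x n| ≤ C := by
  obtain ⟨C, hC0, hC⟩ := h.exists_abs_hHatSucc_sub_le (ς := ς) hx
  have ha := h.a_pos
  have hρ := h.rho_pos
  set M := C * (1 / a ^ 2 + 1 / a) with hM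
  have hM0 : 0 ≤ M := by positivity
  -- Above `a`, both u ↦ y/u and log u are Lipschitz, so all error sums are dominated by one
  -- convergent series independent of θ and n.
  refine ⟨∑' k : ℕ, M * (ρ ^ k * (1 + x (k + 1) ^ 2)), fun θ hθ n => ?_⟩
  have e1 : 2 * logLik ς x n θ + θ.statLoss x n = ∑ t ∈ Finset.range n,
      ((x ((t : ℤ) + 1) ^ 2 / θ.statVol x (t + 1) - x ((t : ℤ) + 1) ^ 2 / θ.hHatSucc ς x t) +
        (Real.log (θ.statVol x (t + 1)) - Real.log (θ.hHatSucc ς x t))) := by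
    simp only [logLik, statLoss, Finset.sum_add_distrib, Finset.sum_sub_distrib]
    ring
  rw [e1]
  refine (Finset.abs_sum_le_sum_abs _ _).trans (le_trans (Finset.sum_le_sum fun t _ => ?_)
    ((hfwd.mul_left M).sum_le_tsum _ fun k _ => by positivity))
  have hu := h.le_statVol hθ x (t + 1)
  have hv := (h.le_alphaZero θ hθ).trans (alphaZero_le_hHatSucc (h.subset hθ) hς x t)
  have hd : |θ.statVol x (t + 1) - θ.hHatSucc ς x t| ≤ C * ρ ^ t := by
    rw [abs_sub_comm]
    exact hC θ hθ t
  have hX := sq_nonneg (x ((t : ℤ) + 1))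
  refine (abs_add_le _ _).trans ((add_le_add (abs_div_sub_div_le ha hu hv hX)
    (abs_log_sub_log_le ha hu hv)).trans ?_)
  calc x ((t : ℤ) + 1) ^ 2 * |θ.statVol x (t + 1) - θ.hHatSucc ς x t| / a ^ 2 +
        |θ.statVol x (t + 1) - θ.hHatSucc ς x t| / a
      ≤ x ((t : ℤ) + 1) ^ 2 * (C * ρ ^ t) / a ^ 2 + (C * ρ ^ t) / a := by gcongr
    _ ≤ (1 + x ((t : ℤ) + 1) ^ 2) * (C * ρ ^ t) / a ^ 2 +
        (1 + x ((t : ℤ) + 1) ^ 2) * (C * ρ ^ t) / a := by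
        have h1 : C * ρ ^ t ≤ (1 + x ((t : ℤ) + 1) ^ 2) * (C * ρ ^ t) :=
          le_mul_of_one_le_left (by positivity) (by linarith)
        refine add_le_add ?_ (div_le_div_of_nonneg_right h1 ha.le)
        gcongr
        linarith
    _ = M * (ρ ^ t * (1 + x (t + 1) ^ 2)) := by
        rw [hM]
        field_simp

end UnifBounds

end AGARCHParam

/-! ### Almost sure growth bounds and uniqueness of the stationary volatility -/

/-- A nonnegative sequence with bounded fractional moments grows subexponentially. -/
theorem ae_summable_pow_mul_of_lintegral_rpow_le {Ω : Type*} [MeasurableSpace Ω] {μ : Measure Ω}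
    {Y : ℕ → Ω → ℝ} (hYm : ∀ k, Measurable (Y k)) (hY : ∀ k, ∀ᵐ ω ∂μ, 0 ≤ Y k ω) {κ : ℝ}
    (hκ0 : 0 < κ) (hκ1 : κ ≤ 1) {C : ENNReal} (hC : C ≠ ⊤)
    (hle : ∀ k, ∫⁻ ω, ENNReal.ofReal (Y k ω) ^ κ ∂μ ≤ C) {ρ : ℝ} (hρ0 : 0 < ρ) (hρ1 : ρ < 1) :
    ∀ᵐ ω ∂μ, Summable fun k : ℕ => ρ ^ k * Y k ω := by
  have hm : ∀ k, Measurable fun ω => ENNReal.ofReal (ρ ^ k * Y k ω) ^ κ := fun k =>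
    ((hYm k).const_mul _).ennreal_ofReal.pow_const κ
  have hr1 : ENNReal.ofReal ρ ^ κ < 1 :=
    ENNReal.rpow_lt_one (by simpa using hρ1) hκ0
  -- The means of the κ-th powers are bounded by a geometric sequence, so these powers are almost
  -- surely summable. Hence the terms y are eventually at most one, and there y ≤ y^κ.
  have hsum : ∫⁻ ω, ∑' k, ENNReal.ofReal (ρ ^ k * Y k ω) ^ κ ∂μ ≠ ⊤ := by
    rw [lintegral_tsum fun k => (hm k).aemeasurable]
    refine ne_top_of_le_ne_top (b := ∑' k : ℕ, (ENNReal.ofReal ρ ^ κ) ^ k * C) ?_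
      (ENNReal.tsum_le_tsum fun k => ?_)
    · rw [ENNReal.tsum_mul_right, ENNReal.tsum_geometric]
      exact ENNReal.mul_ne_top (ENNReal.inv_ne_top.2 (tsub_pos_of_lt hr1).ne') hC
    · have h1 : ∀ ω, ENNReal.ofReal (ρ ^ k * Y k ω) ^ κ =
          (ENNReal.ofReal ρ ^ κ) ^ k * ENNReal.ofReal (Y k ω) ^ κ := by
        intro ω
        rw [ENNReal.ofReal_mul (by positivity), ENNReal.mul_rpow_of_nonneg _ _ hκ0.le,
          ENNReal.ofReal_pow hρ0.le, ← ENNReal.rpow_natCast, ← ENNReal.rpow_natCast,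
          ← ENNReal.rpow_mul, ← ENNReal.rpow_mul, mul_comm κ]
      simp only [h1]
      rw [lintegral_const_mul _ ((hYm k).ennreal_ofReal.pow_const κ)]
      gcongr
      exact hle k
  filter_upwards [ae_lt_top (Measurable.tsum hm) hsum, ae_all_iff.2 hY] with ω hω h0
  have hs : Summable fun k : ℕ => (ρ ^ k * Y k ω) ^ κ := by
    refine (ENNReal.summable_toReal hω.ne).congr fun k => ?_
    rw [← ENNReal.toReal_rpow, ENNReal.toReal_ofReal (mul_nonneg (by positivity) (h0 k))]
  have hev : ∀ᶠ k in cofinite, (ρ ^ k * Y k ω) ^ κ ≤ 1 :=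
    hs.tendsto_cofinite_zero.eventually_le_const one_pos
  refine Summable.of_norm_bounded_eventually hs ?_
  filter_upwards [hev] with k hk
  have hk0 : 0 ≤ ρ ^ k * Y k ω := mul_nonneg (by positivity) (h0 k)
  rw [Real.norm_of_nonneg hk0]
  have hk1 : ρ ^ k * Y k ω ≤ 1 := by
    by_contra! hlt
    exact absurd hk (not_le.2 (Real.one_lt_rpow hlt hκ0))
  simpa using Real.rpow_le_rpow_of_exponent_ge' hk0 hk1 hκ0.le hκ1

namespace AGARCHParam

variable {p q : ℕ}

/-- After reindexing, this is the tail of the series defining `pathDom` at `t`. -/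
theorem tendsto_pow_mul_pathDom (ρ : ℝ) (x : ℤ → ℝ) (t : ℤ) :
    Tendsto (fun N : ℕ => ρ ^ N * pathDom ρ x (t - N)) atTop (𝓝 0) := by
  refine (tendsto_sum_nat_add fun k : ℕ => ρ ^ k * (1 + x (t - 1 - k) ^ 2)).congr fun N => ?_
  unfold pathDom
  rw [← tsum_mul_left]
  refine tsum_congr fun k => ?_
  rw [add_comm k, pow_add, mul_assoc]
  congr 5
  push_cast
  ring

/-- Uniqueness of the slowly growing solution of the volatility recursion. -/
theorem UnifBounds.eq_statVol {K : Set (AGARCHParam p q)} {a A ρ : ℝ} {θ : AGARCHParam p q}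
    (h : UnifBounds K a A ρ) (hθ : θ ∈ K) {x v : ℤ → ℝ} (hx : TemperedPath ρ x)
    (hv : ∀ t : ℤ, v t = θ.alphaZero +
      ∑ i ∈ Finset.range p, θ.alphaN i * asymSq θ.gamma (x (t - 1 - i)) +
      ∑ j ∈ Finset.range q, θ.betaN j * v (t - 1 - j))
    (hlim : ∀ t, Tendsto (fun N : ℕ => ρ ^ N * v (t - N)) atTop (𝓝 0)) (t : ℤ) :
    v t = θ.statVol x t := by
  have hρ := h.rho_pos
  have hstat : ∀ t, Tendsto (fun N : ℕ => ρ ^ N * θ.statVol x (t - N)) atTop (𝓝 0) := by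
    intro t
    have h1 := ((tendsto_pow_atTop_nhds_zero_of_lt_one hρ.le h.rho_lt_one).mul_const
      (A / (1 - ρ))).add ((tendsto_pow_mul_pathDom ρ x t).const_mul (4 * archBound p A ρ))
    rw [zero_mul, mul_zero, add_zero] at h1
    refine squeeze_zero (fun N => mul_nonneg (by positivity)
      (h.a_pos.le.trans (h.le_statVol hθ x _))) (fun N => ?_) h1
    have := mul_le_mul_of_nonneg_left (h.statVol_le hθ hx (t - N)) (pow_nonneg hρ.le N)
    linarith
  set d : ℤ → ℝ := fun s => v s - θ.statVol x s with hd
  have hdlim : ∀ t, Tendsto (fun N : ℕ => ρ ^ N * |d (t - N)|) atTop (𝓝 0) := by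
    intro t
    have h1 := ((hlim t).sub (hstat t)).abs
    rw [sub_zero, abs_zero] at h1
    refine h1.congr fun N => ?_
    rw [← mul_sub, abs_mul, abs_of_pos (pow_pos hρ N)]
  have hdrec : ∀ t, d t = ∑ j ∈ Finset.range q, θ.betaN j * d (t - 1 - j) := by
    intro t
    simp only [hd, mul_sub, Finset.sum_sub_distrib]
    rw [hv t, h.statVol_eq hθ hx t]
    ring
  -- Started N + 1 steps before t, the homogeneous recursion contracts by ρ^(N+1), while the
  -- starting window grows more slowly than ρ^(-N).
  have hbound : ∀ N : ℕ, |d t| ≤ ∑ j ∈ Finset.range q, ρ * (ρ ^ N * |d (t - 1 - j - N)|) := by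
    intro N
    have h1 := abs_le_of_contracting_recursion (d := d) (s := t - 1 - N) hρ.le h.rho_lt_one.le
      (fun j => betaN_nonneg (h.subset hθ) j) (h.sum_beta_le θ hθ) (fun n => by
        rw [hdrec]
        refine Finset.sum_congr rfl fun j _ => ?_
        congr 2
        ring) N
    rw [show t - 1 - (N : ℤ) + 1 + N = t by ring, Finset.mul_sum] at h1
    refine h1.trans_eq (Finset.sum_congr rfl fun j _ => ?_)
    rw [show t - 1 - (N : ℤ) - j = t - 1 - j - N by ring]
    ring
  have hzero : Tendsto (fun N : ℕ => ∑ j ∈ Finset.range q, ρ * (ρ ^ N * |d (t - 1 - j - N)|))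
      atTop (𝓝 0) := by
    have := tendsto_finsetSum (Finset.range q) fun j _ => (hdlim (t - 1 - j)).const_mul ρ
    simpa using this
  have := ge_of_tendsto' hzero hbound
  have h0 : d t = 0 := abs_eq_zero.1 (le_antisymm this (abs_nonneg _))
  exact sub_eq_zero.1 h0

theorem measurable_statVol {Ω : Type*} [MeasurableSpace Ω] (θ : AGARCHParam p q)
    {X : ℤ → Ω → ℝ} {t : ℤ} (hX : ∀ k : ℕ, Measurable (X (t - 1 - k))) :
    Measurable fun ω => θ.statVol (fun s => X s ω) t :=
  measurable_const.add (Measurable.tsum fun k =>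
    measurable_const.mul ((measurable_asymSq _).comp (hX k)))

theorem measurable_pathDom {Ω : Type*} [MeasurableSpace Ω] (ρ : ℝ)
    {X : ℤ → Ω → ℝ} {t : ℤ} (hX : ∀ k : ℕ, Measurable (X (t - 1 - k))) :
    Measurable fun ω => pathDom ρ (fun s => X s ω) t :=
  Measurable.tsum fun k => measurable_const.mul (((hX k).pow_const 2).const_add 1)

end AGARCHParam

namespace IsStationaryAGARCH

open AGARCHParam

variable {Ω : Type*} [MeasurableSpace Ω] {μ : Measure Ω} {p q : ℕ} {θ : AGARCHParam p q}
  {Z X σ : ℤ → Ω → ℝ}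

theorem lintegral_obs_rpow_eq (h : IsStationaryAGARCH μ θ Z X σ) (κ : ℝ) (t : ℤ) :
    ∫⁻ ω, ENNReal.ofReal (X t ω ^ 2) ^ κ ∂μ = ∫⁻ ω, ENNReal.ofReal (X 0 ω ^ 2) ^ κ ∂μ := by
  have hf : Measurable fun w : ℤ → ℝ × ℝ => ENNReal.ofReal ((w 0).1 ^ 2) ^ κ := by fun_prop
  have := (h.identDistrib_pathShift hf t).lintegral_eq
  simpa [pathShift] using this

theorem lintegral_vol_rpow_eq (h : IsStationaryAGARCH μ θ Z X σ) (κ : ℝ) (t : ℤ) :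
    ∫⁻ ω, ENNReal.ofReal (σ t ω ^ 2) ^ κ ∂μ = ∫⁻ ω, ENNReal.ofReal (σ 0 ω ^ 2) ^ κ ∂μ := by
  have hf : Measurable fun w : ℤ → ℝ × ℝ => ENNReal.ofReal ((w 0).2 ^ 2) ^ κ := by fun_prop
  have := (h.identDistrib_pathShift hf t).lintegral_eq
  simpa [pathShift] using this

/-- Up to null sets, the stationary volatility is adapted to the noise. -/
theorem exists_noisePast_statVol (h : IsStationaryAGARCH μ θ Z X σ) (θ' : AGARCHParam p q)
    {s t : ℤ} (hst : s ≤ t + 1) : ∃ g : Ω → ℝ, Measurable[noisePast Z t] g ∧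
      (fun ω => θ'.statVol (fun s => X s ω) s) =ᵐ[μ] g := by
  choose f hfm hf using h.exists_noisePast_path
  refine ⟨fun ω => θ'.statVol (fun s => (f s ω).1) s, ?_, ?_⟩
  · refine @measurable_statVol p q Ω (noisePast Z t) θ' (fun s ω => (f s ω).1) s fun k => ?_
    exact measurable_fst.comp ((hfm _).mono (noisePast_mono (by omega)) le_rfl)
  · filter_upwards [ae_all_iff.2 hf] with ω hω
    congr 1
    funext s
    rw [← hω s]

variable [IsProbabilityMeasure μ]

theorem ae_summable_obs (h : IsStationaryAGARCH μ θ Z X σ) (hθ : θ ∈ space p q) (hp : 0 < p)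
    {ρ : ℝ} (hρ0 : 0 < ρ) (hρ1 : ρ < 1) (u : ℕ → ℤ) :
    ∀ᵐ ω ∂μ, Summable fun k : ℕ => ρ ^ k * (1 + X (u k) ω ^ 2) := by
  obtain ⟨κ, hκ0, hκ1, hσ⟩ := h.exists_lintegral_vol_rpow_ne_top hθ hp
  have hX := h.lintegral_obs_rpow_ne_top hκ0 hκ1 hσ
  filter_upwards [ae_summable_pow_mul_of_lintegral_rpow_le (Y := fun k ω => X (u k) ω ^ 2)
    (fun k => (h.measurable_obs _).pow_const 2) (fun k => ae_of_all _ fun ω => sq_nonneg _)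
    hκ0 hκ1 hX (fun k => (h.lintegral_obs_rpow_eq κ (u k)).le) hρ0 hρ1] with ω hω
  refine ((summable_geometric_of_lt_one hρ0.le hρ1).add hω).congr fun k => ?_
  ring

theorem ae_summable_vol (h : IsStationaryAGARCH μ θ Z X σ) (hθ : θ ∈ space p q) (hp : 0 < p)
    {ρ : ℝ} (hρ0 : 0 < ρ) (hρ1 : ρ < 1) (u : ℕ → ℤ) :
    ∀ᵐ ω ∂μ, Summable fun k : ℕ => ρ ^ k * σ (u k) ω ^ 2 := by
  obtain ⟨κ, hκ0, hκ1, hσ⟩ := h.exists_lintegral_vol_rpow_ne_top hθ hp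
  exact ae_summable_pow_mul_of_lintegral_rpow_le (Y := fun k ω => σ (u k) ω ^ 2)
    (fun k => (h.measurable_vol _).pow_const 2) (fun k => ae_of_all _ fun ω => sq_nonneg _)
    hκ0 hκ1 hσ (fun k => (h.lintegral_vol_rpow_eq κ (u k)).le) hρ0 hρ1

theorem ae_temperedPath (h : IsStationaryAGARCH μ θ Z X σ) (hθ : θ ∈ space p q) (hp : 0 < p)
    {ρ : ℝ} (hρ0 : 0 < ρ) (hρ1 : ρ < 1) : ∀ᵐ ω ∂μ, TemperedPath ρ fun t => X t ω :=
  ae_all_iff.2 fun t => h.ae_summable_obs hθ hp hρ0 hρ1 fun k => t - 1 - k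

/-- The squared volatility is the stationary solution of the volatility recursion. -/
theorem ae_sq_vol_eq_statVol (h : IsStationaryAGARCH μ θ Z X σ) {K : Set (AGARCHParam p q)}
    {a A ρ : ℝ} (hK : UnifBounds K a A ρ) (hθ : θ ∈ K) (hp : 0 < p) :
    ∀ᵐ ω ∂μ, ∀ t, σ t ω ^ 2 = θ.statVol (fun s => X s ω) t := by
  filter_upwards [h.ae_isPath, h.ae_temperedPath (hK.subset hθ) hp hK.rho_pos hK.rho_lt_one,
    ae_all_iff.2 fun t : ℤ => h.ae_summable_vol (hK.subset hθ) hp hK.rho_pos hK.rho_lt_one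
      fun k => t - k] with ω h1 h2 h3 t
  exact hK.eq_statVol hθ (v := fun s => σ s ω ^ 2) h2 h1.vol_eq
    (fun t => (h3 t).tendsto_atTop_zero) t

end IsStationaryAGARCH

/-! ### Identification of the parameter -/

/-- Events in the σ-field of `f` are independent of themselves, so each has probability zero or one.
Countably many Borel sets separate the points of ℝ. -/
theorem ProbabilityTheory.IndepFun.exists_ae_eq_const {Ω : Type*} [MeasurableSpace Ω]
    {μ : Measure Ω} [IsProbabilityMeasure μ] {f : Ω → ℝ} (hf : Measurable f)
    (h : IndepFun f f μ) : ∃ c, ∀ᵐ ω ∂μ, f ω = c := by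
  refine Filter.exists_eventuallyEq_const_of_forall_separating (l := ae μ) MeasurableSet ?_
  intro U hU
  rcases measure_eq_zero_or_one_of_indep_self ((IndepFun_iff_Indep f f μ).1 h) (t := f ⁻¹' U)
    ⟨U, hU, rfl⟩ with h0 | h1
  · exact Or.inr (measure_eq_zero_iff_ae_notMem.1 h0)
  · exact Or.inl ((mem_ae_iff_prob_eq_one (hf hU)).2 h1)

/-- A centred random variable whose law is not concentrated at two points does not charge a single
half-line. -/
theorem not_ae_eq_or_nonpos {Ω : Type*} [MeasurableSpace Ω] {μ : Measure Ω} {f : Ω → ℝ}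
    (hf : Integrable f μ) (hmean : ∫ ω, f ω ∂μ = 0)
    (hnd : ¬ ∃ a b : ℝ, ∀ᵐ ω ∂μ, f ω = a ∨ f ω = b) : ¬ ∀ᵐ ω ∂μ, f ω ≤ 0 := by
  intro h
  have h1 : (fun ω => -f ω) =ᵐ[μ] 0 := by
    refine (integral_eq_zero_iff_of_nonneg_ae ?_ hf.neg).1 ?_
    · filter_upwards [h] with ω hω
      simpa using hω
    · rw [show (-f) = fun ω => -f ω from rfl, integral_neg, hmean, neg_zero]
  refine hnd ⟨0, 0, ?_⟩
  filter_upwards [h1] with ω hω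
  left
  simpa using hω

/-- A nonzero piecewise quadratic function of a centred random variable whose law is not
concentrated at two points is not degenerate. -/
theorem eq_zero_of_ae_piecewise_eq_const {Ω : Type*} [MeasurableSpace Ω] {μ : Measure Ω}
    {f : Ω → ℝ} (hf : Integrable f μ) (hmean : ∫ ω, f ω ∂μ = 0)
    (hnd : ¬ ∃ a b : ℝ, ∀ᵐ ω ∂μ, f ω = a ∨ f ω = b) {u v c : ℝ}
    (h : ∀ᵐ ω ∂μ, (0 ≤ f ω → u * f ω ^ 2 = c) ∧ (f ω ≤ 0 → v * f ω ^ 2 = c)) :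
    u = 0 ∧ v = 0 := by
  -- A nonzero `u` leaves one possible value on the nonnegative side, a nonzero `v` one on the
  -- nonpositive side; if both are nonzero there are only two values. If exactly one vanishes, then
  -- c ≠ 0 excludes its side, and c = 0 confines `f` to a half-line, where a zero mean forces f = 0.
  have hpos : u ≠ 0 → ∀ ω, (0 ≤ f ω → u * f ω ^ 2 = c) → 0 ≤ f ω → f ω = √(c / u) := by
    intro hu ω h1 h0
    rw [← h1 h0, mul_div_cancel_left₀ _ hu, Real.sqrt_sq h0]
  have hneg : v ≠ 0 → ∀ ω, (f ω ≤ 0 → v * f ω ^ 2 = c) → f ω ≤ 0 → f ω = -√(c / v) := by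
    intro hv ω h1 h0
    rw [← h1 h0, mul_div_cancel_left₀ _ hv, ← neg_sq, Real.sqrt_sq (by linarith), neg_neg]
  have hn1 := not_ae_eq_or_nonpos hf hmean hnd
  have hn2 := not_ae_eq_or_nonpos hf.neg (by simp [integral_neg, hmean]) (fun ⟨a, b, hab⟩ => by
    refine hnd ⟨-a, -b, ?_⟩
    filter_upwards [hab] with ω hω
    simpa [neg_eq_iff_eq_neg] using hω)
  by_cases hu : u = 0
  · by_cases hv : v = 0
    · exact ⟨hu, hv⟩
    exfalso
    by_cases hc : c = 0
    · apply hn2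
      filter_upwards [h] with ω hω
      by_contra! hlt
      have hlt' : f ω < 0 := by simpa using hlt
      have := hneg hv ω hω.2 hlt'.le
      rw [hc, zero_div, Real.sqrt_zero, neg_zero] at this
      exact hlt'.ne this
    · refine hnd ⟨-√(c / v), -√(c / v), ?_⟩
      filter_upwards [h] with ω hω
      left
      rcases le_total 0 (f ω) with h0 | h0
      · have := hω.1 h0
        rw [hu, zero_mul] at this
        exact absurd this.symm hc
      · exact hneg hv ω hω.2 h0
  · exfalso
    by_cases hv : v = 0
    · by_cases hc : c = 0
      · apply hn1
        filter_upwards [h] with ω hω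
        by_contra! hlt
        have := hpos hu ω hω.1 hlt.le
        rw [hc, zero_div, Real.sqrt_zero] at this
        exact hlt.ne' this
      · refine hnd ⟨√(c / u), √(c / u), ?_⟩
        filter_upwards [h] with ω hω
        left
        rcases le_total 0 (f ω) with h0 | h0
        · exact hpos hu ω hω.1 h0
        · have := hω.2 h0
          rw [hv, zero_mul] at this
          exact absurd this.symm hc
    · refine hnd ⟨√(c / u), -√(c / v), ?_⟩
      filter_upwards [h] with ω hω
      rcases le_total 0 (f ω) with h0 | h0
      · exact Or.inl (hpos hu ω hω.1 h0)
      · exact Or.inr (hneg hv ω hω.2 h0)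

/-- Isolated so that it can be instantiated with `noisePast` as the σ-field. -/
theorem measurable_neg_add_tsum {Ω : Type*} [MeasurableSpace Ω] {c : ℝ} {f : ℕ → Ω → ℝ}
    (hf : ∀ k, Measurable (f k)) : Measurable fun ω => -(c + ∑' k, f k ω) :=
  (measurable_const.add (Measurable.tsum hf)).neg

/-! ### Algebraic identification: recovering the parameter from the power series a/b -/

namespace AGARCHParam

variable {p q : ℕ}

/-- The polynomial `a(z) / z`. -/
def arPolynomial (θ : AGARCHParam p q) : Polynomial ℂ :=
  ∑ i ∈ Finset.range p, Polynomial.C (θ.alphaN i : ℂ) * Polynomial.X ^ i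

/-- The polynomial `b(z)`. -/
def maPolynomial (θ : AGARCHParam p q) : Polynomial ℂ :=
  1 - ∑ j ∈ Finset.range q, Polynomial.C (θ.betaN j : ℂ) * Polynomial.X ^ (j + 1)

theorem coeff_arPolynomial (θ : AGARCHParam p q) (k : ℕ) :
    θ.arPolynomial.coeff k = θ.alphaN k := by
  rw [arPolynomial, Polynomial.finsetSum_coeff]
  simp only [Polynomial.coeff_C_mul_X_pow]
  rw [Finset.sum_ite_eq]
  split_ifs with h
  · rfl
  · rw [alphaN_of_le θ (by simpa using h), Complex.ofReal_zero]

theorem coeff_maPolynomial_zero (θ : AGARCHParam p q) : θ.maPolynomial.coeff 0 = 1 := by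
  rw [maPolynomial, Polynomial.coeff_sub, Polynomial.finsetSum_coeff]
  simp

theorem coeff_maPolynomial_succ (θ : AGARCHParam p q) (k : ℕ) :
    θ.maPolynomial.coeff (k + 1) = -θ.betaN k := by
  rw [maPolynomial, Polynomial.coeff_sub, Polynomial.finsetSum_coeff]
  simp only [Polynomial.coeff_C_mul_X_pow, add_left_inj]
  rw [Finset.sum_ite_eq, Polynomial.coeff_one, if_neg (Nat.succ_ne_zero k), zero_sub]
  split_ifs with h
  · rfl
  · rw [betaN_of_le θ (by simpa using h), Complex.ofReal_zero]

/-- The recursion defining `archCoeff` is the coefficientwise form of this product. Formal power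
series make convergence irrelevant. -/
theorem coe_arPolynomial (θ : AGARCHParam p q) :
    (θ.arPolynomial : PowerSeries ℂ) =
      θ.maPolynomial * PowerSeries.mk fun k => (θ.archCoeff k : ℂ) := by
  ext k
  rw [Polynomial.coeff_coe, coeff_arPolynomial, PowerSeries.coeff_mul]
  simp only [Polynomial.coeff_coe, PowerSeries.coeff_mk]
  rw [Finset.Nat.sum_antidiagonal_eq_sum_range_succ_mk, Finset.sum_range_succ']
  simp only [coeff_maPolynomial_zero, coeff_maPolynomial_succ, Nat.sub_zero, one_mul]
  have h1 := θ.archCoeff_eq k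
  rw [← Finset.sum_range_reflect] at h1
  have h2 : ∑ j ∈ Finset.range k, θ.betaN (k - 1 - (k - 1 - j)) * θ.archCoeff (k - 1 - j) =
      ∑ j ∈ Finset.range k, θ.betaN j * θ.archCoeff (k - (j + 1)) := by
    refine Finset.sum_congr rfl fun j hj => ?_
    have := Finset.mem_range.1 hj
    rw [show k - 1 - (k - 1 - j) = j by omega, show k - 1 - j = k - (j + 1) by omega]
  rw [h2] at h1
  rw [h1]
  push_cast
  simp only [neg_mul, Finset.sum_neg_distrib]
  ring

theorem aPoly_eq (θ : AGARCHParam p q) (z : ℂ) : θ.aPoly z = z * θ.arPolynomial.eval z := by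
  rw [aPoly, arPolynomial, Polynomial.eval_finsetSum, Finset.mul_sum, Finset.sum_range]
  refine Finset.sum_congr rfl fun i _ => ?_
  simp only [alphaN_fin, Polynomial.eval_mul, Polynomial.eval_C, Polynomial.eval_pow,
    Polynomial.eval_X]
  ring

theorem bPoly_eq (θ : AGARCHParam p q) (z : ℂ) : θ.bPoly z = θ.maPolynomial.eval z := by
  rw [bPoly, maPolynomial, Polynomial.eval_sub, Polynomial.eval_finsetSum, Finset.sum_range,
    Polynomial.eval_one]
  simp only [betaN_fin, Polynomial.eval_mul, Polynomial.eval_C, Polynomial.eval_pow,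
    Polynomial.eval_X]

/-- Over ℂ, coprimality means absence of common roots, and a common root of a(z)/z and b(z) is also
one of a and b. -/
theorem isCoprime_polynomials {θ : AGARCHParam p q}
    (hcoprime : ¬ ∃ z : ℂ, θ.aPoly z = 0 ∧ θ.bPoly z = 0) :
    IsCoprime θ.maPolynomial θ.arPolynomial := by
  rw [Polynomial.isCoprime_iff_aeval_ne_zero_of_isAlgClosed ℂ ℂ]
  intro z
  by_contra! hz
  simp only [Polynomial.coe_aeval_eq_eval] at hz
  exact hcoprime ⟨z, by rw [aPoly_eq, hz.2, mul_zero], by rw [bPoly_eq, hz.1]⟩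

theorem natDegree_arPolynomial_le (θ : AGARCHParam p q) : θ.arPolynomial.natDegree ≤ p - 1 := by
  refine Polynomial.natDegree_le_iff_coeff_eq_zero.2 fun k hk => ?_
  rw [coeff_arPolynomial, alphaN_of_le θ (by omega), Complex.ofReal_zero]

theorem natDegree_maPolynomial_le (θ : AGARCHParam p q) : θ.maPolynomial.natDegree ≤ q := by
  refine Polynomial.natDegree_le_iff_coeff_eq_zero.2 fun k hk => ?_
  obtain ⟨k, rfl⟩ : ∃ j, k = j + 1 := ⟨k - 1, by omega⟩
  rw [coeff_maPolynomial_succ, betaN_of_le θ (by omega), Complex.ofReal_zero, neg_zero]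

theorem maPolynomial_ne_zero (θ : AGARCHParam p q) : θ.maPolynomial ≠ 0 := by
  intro h
  have := θ.coeff_maPolynomial_zero
  simp [h] at this

/-- The coefficients of the power series `a / b` determine `a` and `b`. -/
theorem eq_of_archCoeff_eq {θ₀ θ : AGARCHParam p q}
    (hlast : q = 0 ∨ (∃ i : Fin p, (i : ℕ) + 1 = p ∧ θ₀.alpha i ≠ 0) ∨
      (∃ j : Fin q, (j : ℕ) + 1 = q ∧ θ₀.beta j ≠ 0))
    (hcoprime : ¬ ∃ z : ℂ, θ₀.aPoly z = 0 ∧ θ₀.bPoly z = 0)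
    (h : ∀ k, θ.archCoeff k = θ₀.archCoeff k) :
    (∀ k, θ.alphaN k = θ₀.alphaN k) ∧ ∀ k, θ.betaN k = θ₀.betaN k := by
  have hmul : θ.arPolynomial * θ₀.maPolynomial = θ₀.arPolynomial * θ.maPolynomial := by
    apply Polynomial.coe_injective (R := ℂ)
    rw [Polynomial.coe_mul, Polynomial.coe_mul, coe_arPolynomial, coe_arPolynomial]
    simp only [h]
    ring
  -- Coprimality makes both polynomials of θ multiples of those of θ₀ by one factor E. If a
  -- polynomial of θ₀ has maximal admissible degree, or if q = 0, then E is constant, and b(0) = 1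
  -- makes it one.
  obtain ⟨E, hE⟩ : θ₀.maPolynomial ∣ θ.maPolynomial :=
    (isCoprime_polynomials hcoprime).dvd_of_dvd_mul_left ⟨θ.arPolynomial, by rw [← hmul, mul_comm]⟩
  have hA : θ.arPolynomial = θ₀.arPolynomial * E := by
    apply mul_right_cancel₀ θ₀.maPolynomial_ne_zero
    rw [hmul, hE]
    ring
  have hE0 : E ≠ 0 := by
    rintro rfl
    exact θ.maPolynomial_ne_zero (by rw [hE, mul_zero])
  have hdeg : E.natDegree = 0 := by
    have hB := Polynomial.natDegree_mul θ₀.maPolynomial_ne_zero hE0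
    rw [← hE] at hB
    have hB' := θ.natDegree_maPolynomial_le
    rcases hlast with hq | ⟨i, hi, hne⟩ | ⟨j, hj, hne⟩
    · omega
    · have hc : θ₀.arPolynomial.coeff i ≠ 0 := by
        rw [coeff_arPolynomial, alphaN_fin]
        exact_mod_cast hne
      have h0 : θ₀.arPolynomial ≠ 0 := by
        intro h0
        simp [h0] at hc
      have hA' := Polynomial.natDegree_mul h0 hE0
      rw [← hA] at hA'
      have := θ.natDegree_arPolynomial_le
      have := Polynomial.le_natDegree_of_ne_zero hc
      omega
    · have hc : θ₀.maPolynomial.coeff (j + 1) ≠ 0 := by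
        rw [coeff_maPolynomial_succ, betaN_fin, neg_ne_zero]
        exact_mod_cast hne
      have := Polynomial.le_natDegree_of_ne_zero hc
      omega
  have hE1 : E = 1 := by
    rw [Polynomial.eq_C_of_natDegree_eq_zero hdeg] at hE ⊢
    have := congrArg (fun P => Polynomial.coeff P 0) hE
    simp only [Polynomial.coeff_mul_C, coeff_maPolynomial_zero, one_mul] at this
    rw [← this, Polynomial.C_1]
  rw [hE1, mul_one] at hA hE
  refine ⟨fun k => ?_, fun k => ?_⟩
  · have := congrArg (fun P => Polynomial.coeff P k) hA
    simp only [coeff_arPolynomial] at this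
    exact_mod_cast this
  · have := congrArg (fun P => Polynomial.coeff P (k + 1)) hE
    simp only [coeff_maPolynomial_succ, neg_inj] at this
    exact_mod_cast this

theorem asymSq_one (γ : ℝ) : asymSq γ 1 = (1 - γ) ^ 2 := by simp [asymSq]

theorem asymSq_neg_one (γ : ℝ) : asymSq γ (-1) = (1 + γ) ^ 2 := by simp [asymSq]

theorem asymSq_of_nonneg (γ : ℝ) {x : ℝ} (hx : 0 ≤ x) : asymSq γ x = (1 - γ) ^ 2 * x ^ 2 := by
  rw [asymSq, abs_of_nonneg hx]
  ring

theorem asymSq_of_nonpos (γ : ℝ) {x : ℝ} (hx : x ≤ 0) : asymSq γ x = (1 + γ) ^ 2 * x ^ 2 := by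
  rw [asymSq, abs_of_nonpos hx]
  ring

/-- The news impact functions and the constant of the stationary volatility determine the
parameter. -/
theorem eq_of_impact_eq {θ₀ θ : AGARCHParam p q} (hθ₀ : θ₀ ∈ space p q) (hθ : θ ∈ space p q)
    (hα : ∃ i : Fin p, 0 < θ₀.alpha i)
    (hlast : q = 0 ∨ (∃ i : Fin p, (i : ℕ) + 1 = p ∧ θ₀.alpha i ≠ 0) ∨
      (∃ j : Fin q, (j : ℕ) + 1 = q ∧ θ₀.beta j ≠ 0))
    (hcoprime : ¬ ∃ z : ℂ, θ₀.aPoly z = 0 ∧ θ₀.bPoly z = 0)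
    (hconst : θ.volConst = θ₀.volConst)
    (h : ∀ k x, θ.archCoeff k * asymSq θ.gamma x = θ₀.archCoeff k * asymSq θ₀.gamma x) :
    θ = θ₀ := by
  have g1 := hθ.2.2.2
  have g2 := hθ₀.2.2.2
  have hk : ∀ k, θ.archCoeff k = θ₀.archCoeff k := by
    intro k
    -- As |γ| ≤ 1, the square roots at 1 and -1 are √c (1 - γ) and √c (1 + γ) with c the k-th
    -- coefficient. Their sum 2√c does not involve γ.
    have e1 := congrArg Real.sqrt (h k 1)
    have e2 := congrArg Real.sqrt (h k (-1))
    rw [asymSq_one, asymSq_one, Real.sqrt_mul (archCoeff_nonneg hθ k),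
      Real.sqrt_mul (archCoeff_nonneg hθ₀ k), Real.sqrt_sq (by linarith),
      Real.sqrt_sq (by linarith)] at e1
    rw [asymSq_neg_one, asymSq_neg_one, Real.sqrt_mul (archCoeff_nonneg hθ k),
      Real.sqrt_mul (archCoeff_nonneg hθ₀ k), Real.sqrt_sq (by linarith),
      Real.sqrt_sq (by linarith)] at e2
    have e3 : √(θ.archCoeff k) = √(θ₀.archCoeff k) := by linarith
    exact (Real.sqrt_inj (archCoeff_nonneg hθ k) (archCoeff_nonneg hθ₀ k)).1 e3
  have hγ : θ.gamma = θ₀.gamma := by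
    obtain ⟨i, hi⟩ := hα
    have hpos : 0 < θ₀.archCoeff i := by
      refine lt_of_lt_of_le ?_ (alphaN_le_archCoeff hθ₀ i)
      rwa [alphaN_fin]
    have e1 := h i 1
    rw [hk, asymSq_one, asymSq_one] at e1
    have e2 := mul_left_cancel₀ hpos.ne' e1
    have := (sq_eq_sq₀ (by linarith) (by linarith)).1 e2
    linarith
  obtain ⟨ha, hb⟩ := eq_of_archCoeff_eq hlast hcoprime hk
  have h0 : θ.alphaZero = θ₀.alphaZero := by
    have hs := sum_betaN_lt_one hθ₀
    unfold volConst at hconst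
    simp only [hb] at hconst
    exact (div_left_inj' (by linarith)).1 hconst
  refine Prod.ext h0 (Prod.ext (funext fun i => ?_) (Prod.ext (funext fun j => ?_) hγ))
  · have := ha i
    rwa [alphaN_fin, alphaN_fin] at this
  · have := hb j
    rwa [betaN_fin, betaN_fin] at this

end AGARCHParam

/-! ### Probabilistic identification: peeling off the lags -/

namespace IsStationaryAGARCH

open AGARCHParam

variable {Ω : Type*} [MeasurableSpace Ω] {μ : Measure Ω} [IsProbabilityMeasure μ] {p q : ℕ}
  {θ₀ : AGARCHParam p q} {Z X σ : ℤ → Ω → ℝ}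

/-- If a function of the next innovation, scaled by the volatility, is determined by the past, it
is degenerate. -/
theorem exists_ae_eq_const (h : IsStationaryAGARCH μ θ₀ Z X σ) {t : ℤ}
    (hσ : ∀ᵐ ω ∂μ, σ t ω ≠ 0) {e : ℝ → ℝ} (he : Measurable e) {R : Ω → ℝ}
    (hR : Measurable[noisePast Z (t - 1)] R)
    (heq : ∀ᵐ ω ∂μ, e (Z t ω) * σ t ω ^ 2 = R ω) : ∃ c, ∀ᵐ ω ∂μ, e (Z 0 ω) = c := by
  obtain ⟨s, hsm, hs⟩ := h.vol_adapted t
  have hmeas : Measurable[noisePast Z (t - 1)] fun ω => R ω / s ω ^ 2 :=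
    hR.div (hsm.pow_const 2)
  -- Division by the squared volatility makes the function of `Z t` past-measurable up to a null
  -- set, while `Z t` is independent of that past. The function is thus independent of itself.
  have hind : IndepFun (fun ω => e (Z t ω)) (fun ω => e (Z t ω)) μ := by
    refine h.indepFun_of_measurable (t := t - 1)
      (he.comp (measurable_noiseFuture (by omega))) hmeas ?_
    filter_upwards [hs, hσ, heq] with ω h1 h2 h3
    rw [← h1, ← h3, mul_div_cancel_right₀ _ (pow_ne_zero 2 h2)]
  obtain ⟨c, hc⟩ := hind.exists_ae_eq_const (he.comp (h.noise.measurable t))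
  exact ⟨c, (h.noise.identDistrib t).ae_snd (p := fun z => e z = c)
    (he (measurableSet_singleton c)) hc⟩

/-- The stationary volatility identifies the parameter. -/
theorem eq_of_ae_statVol_eq (h : IsStationaryAGARCH μ θ₀ Z X σ) {K : Set (AGARCHParam p q)}
    {a A ρ : ℝ} (hK : UnifBounds K a A ρ) (hθ₀ : θ₀ ∈ K) {θ : AGARCHParam p q} (hθ : θ ∈ K)
    (hα : ∃ i : Fin p, 0 < θ₀.alpha i)
    (hlast : q = 0 ∨ (∃ i : Fin p, (i : ℕ) + 1 = p ∧ θ₀.alpha i ≠ 0) ∨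
      (∃ j : Fin q, (j : ℕ) + 1 = q ∧ θ₀.beta j ≠ 0))
    (hcoprime : ¬ ∃ z : ℂ, θ₀.aPoly z = 0 ∧ θ₀.bPoly z = 0)
    (hZ : ¬ ∃ a b : ℝ, ∀ᵐ ω ∂μ, Z 0 ω = a ∨ Z 0 ω = b)
    (heq : ∀ᵐ ω ∂μ, θ.statVol (fun s => X s ω) 0 = θ₀.statVol (fun s => X s ω) 0) :
    θ = θ₀ := by
  have hp : 0 < p := by
    obtain ⟨i, _⟩ := hα
    exact i.pos
  have hθ₀' := hK.subset hθ₀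
  have htemp := h.ae_temperedPath hθ₀' hp hK.rho_pos hK.rho_lt_one
  set D : ℕ → ℝ → ℝ := fun k x =>
    θ.archCoeff k * asymSq θ.gamma x - θ₀.archCoeff k * asymSq θ₀.gamma x with hD
  have hDm : ∀ k, Measurable (D k) := fun k =>
    (measurable_const.mul (measurable_asymSq _)).sub (measurable_const.mul (measurable_asymSq _))
  have hDmul : ∀ k r z, 0 ≤ r → D k (r * z) = D k z * r ^ 2 := by
    intro k r z hr
    simp only [hD, asymSq_mul _ hr]
    ring
  have hsum : ∀ᵐ ω ∂μ, (Summable fun k : ℕ => D k (X (0 - 1 - k) ω)) ∧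
      θ.volConst - θ₀.volConst + ∑' k : ℕ, D k (X (0 - 1 - k) ω) = 0 := by
    filter_upwards [htemp, heq] with ω h1 h2
    have s1 := hK.summable_archCoeff hθ h1 0
    have s2 := hK.summable_archCoeff hθ₀ h1 0
    refine ⟨s1.sub s2, ?_⟩
    simp only [hD]
    rw [s1.tsum_sub s2]
    unfold statVol at h2
    linarith
  have hσ : ∀ t, ∀ᵐ ω ∂μ, σ t ω ≠ 0 := by
    intro t
    filter_upwards [h.ae_isPath] with ω hω h0
    have := hω.alphaZero_le hθ₀' t
    rw [h0] at this
    have := hθ₀'.1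
    simp at *
    linarith
  -- Once `D` vanishes at all newer lags, the term in X_{-1-k} equals minus a constant and the sum
  -- of the older terms, which precede Z_{-1-k}. By homogeneity that term is D k (Z_{-1-k}) times
  -- the squared volatility, so `D k` of the innovation is constant; being piecewise quadratic, `D
  -- k` is zero.
  have hzero : ∀ k x, D k x = 0 := by
    intro k
    induction k using Nat.strong_induction_on with
    | _ k ih =>
      choose f hfm hf using h.exists_noisePast_path
      obtain ⟨c, hc⟩ := h.exists_ae_eq_const (t := -1 - k) (hσ _) (hDm k)
        (R := fun ω => -(θ.volConst - θ₀.volConst +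
          ∑' i : ℕ, D (i + (k + 1)) (f (-1 - k - 1 - i) ω).1))
        (by
          have hfm' : ∀ i : ℕ, Measurable[noisePast Z (-1 - k - 1)] (f (-1 - k - 1 - i)) :=
            fun i => (hfm _).mono (noisePast_mono (by omega)) le_rfl
          exact @measurable_neg_add_tsum Ω (noisePast Z _) _ _ fun i => (hDm _).comp
            (measurable_fst.comp (hfm' i)))
        (by
          filter_upwards [hsum, ae_all_iff.2 hf, h.obs_eq (-1 - k), h.vol_nonneg (-1 - k)]
            with ω h1 h2 h3 h4
          rw [← hDmul k _ _ h4, ← h3]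
          have h5 := h1.1.sum_add_tsum_nat_add (k + 1)
          rw [Finset.sum_range_succ, Finset.sum_eq_zero fun i hi => ih i (Finset.mem_range.1 hi) _,
            zero_add, zero_sub] at h5
          have h6 : ∑' i : ℕ, D (i + (k + 1)) (f (-1 - k - 1 - i) ω).1 =
              ∑' i : ℕ, D (i + (k + 1)) (X (-1 - ((i + (k + 1) : ℕ) : ℤ)) ω) := by
            refine tsum_congr fun i => ?_
            rw [← h2]
            dsimp only
            congr 2
            push_cast
            ring
          rw [h6]
          have h7 := h1.2
          rw [zero_sub] at h7
          linarith)
      have hint : Integrable (Z 0) μ := h.noise.memLp.integrable one_le_two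
      obtain ⟨e1, e2⟩ := eq_zero_of_ae_piecewise_eq_const hint h.noise.mean hZ
        (u := θ.archCoeff k * (1 - θ.gamma) ^ 2 - θ₀.archCoeff k * (1 - θ₀.gamma) ^ 2)
        (v := θ.archCoeff k * (1 + θ.gamma) ^ 2 - θ₀.archCoeff k * (1 + θ₀.gamma) ^ 2) (c := c) (by
          filter_upwards [hc] with ω hω
          refine ⟨fun h0 => ?_, fun h0 => ?_⟩
          · rw [← hω]
            simp only [hD, asymSq_of_nonneg _ h0]
            ring
          · rw [← hω]
            simp only [hD, asymSq_of_nonpos _ h0]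
            ring)
      intro x
      rcases le_total 0 x with h0 | h0
      · simp only [hD, asymSq_of_nonneg _ h0]
        rw [← mul_assoc, ← mul_assoc, ← sub_mul, e1, zero_mul]
      · simp only [hD, asymSq_of_nonpos _ h0]
        rw [← mul_assoc, ← mul_assoc, ← sub_mul, e2, zero_mul]
  obtain ⟨ω, hω⟩ := hsum.exists
  refine eq_of_impact_eq hθ₀' (hK.subset hθ) hα hlast hcoprime ?_
    fun k x => sub_eq_zero.1 (hzero k x)
  have := hω.2
  simp only [hzero, tsum_zero, add_zero] at this
  linarith

end IsStationaryAGARCH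

/-! ### Separation of the limiting criterion -/

/-- A lower bound of `log (u / a) + y / u` over `u ≥ a` with `|u - h| ≤ e`. -/
def lossFloor (a h e y : ℝ) : ℝ := Real.log (max (h - e) a / a) + y / (h + e)

theorem lossFloor_nonneg {a h e y : ℝ} (ha : 0 < a) (hh : a ≤ h) (he : 0 ≤ e) (hy : 0 ≤ y) :
    0 ≤ lossFloor a h e y :=
  add_nonneg (Real.log_nonneg ((one_le_div ha).2 (le_max_right _ _)))
    (div_nonneg hy (by linarith))

theorem lossFloor_le {a h e y u : ℝ} (ha : 0 < a) (hu : a ≤ u) (hy : 0 ≤ y)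
    (hd : |u - h| ≤ e) : lossFloor a h e y ≤ Real.log (u / a) + y / u := by
  have h1 := abs_le.1 hd
  have hu0 := ha.trans_le hu
  refine add_le_add (Real.log_le_log ?_ ?_) ?_
  · exact div_pos (ha.trans_le (le_max_right _ _)) ha
  · gcongr
    exact max_le (by linarith) hu
  · exact div_le_div_of_nonneg_left hy hu0 (by linarith)

theorem lossFloor_zero {a h y : ℝ} (hh : a ≤ h) :
    lossFloor a h 0 y = Real.log (h / a) + y / h := by
  rw [lossFloor, sub_zero, add_zero, max_eq_left hh]

theorem continuousAt_lossFloor {a h : ℝ} (ha : 0 < a) (hh : a ≤ h) (y : ℝ) :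
    ContinuousAt (fun e => lossFloor a h e y) 0 := by
  unfold lossFloor
  have h1 : max (h - 0) a / a ≠ 0 := (div_pos (ha.trans_le (le_max_right _ _)) ha).ne'
  have h2 : h + 0 ≠ 0 := by linarith
  refine ContinuousAt.add (ContinuousAt.log ?_ h1) (ContinuousAt.div continuousAt_const ?_ h2)
  · exact Continuous.continuousAt (by fun_prop)
  · exact Continuous.continuousAt (by fun_prop)

/-- The larger mean may be infinite, hence the truncation. With η = 1/(j + 1) and J = j the
truncated floors converge pointwise to the loss at `h`, and Fatou's lemma carries the strict
inequality over to some j. -/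
theorem exists_integrable_sub_lossFloor {Ω : Type*} [MeasurableSpace Ω] {μ : Measure Ω}
    [IsProbabilityMeasure μ] {s h y E : Ω → ℝ} (hsm : Measurable s) (hhm : Measurable h)
    (hym : Measurable y) (hEm : Measurable E) {a : ℝ} (ha : 0 < a) (hs : ∀ ω, a ≤ s ω)
    (hh : ∀ ω, a ≤ h ω) (hy : ∀ ω, 0 ≤ y ω) (hE : ∀ ω, 0 ≤ E ω)
    (hlt : ∫⁻ ω, ENNReal.ofReal (Real.log (s ω / a) + y ω / s ω) ∂μ <
      ∫⁻ ω, ENNReal.ofReal (Real.log (h ω / a) + y ω / h ω) ∂μ) :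
    ∃ η : ℝ, 0 < η ∧ ∃ J : ℝ,
      Integrable (fun ω => Real.log (s ω / a) + y ω / s ω -
        min (lossFloor a (h ω) (η * E ω) (y ω)) J) μ ∧
      ∫ ω, (Real.log (s ω / a) + y ω / s ω - min (lossFloor a (h ω) (η * E ω) (y ω)) J) ∂μ < 0 := by
  set F : Ω → ℝ := fun ω => Real.log (s ω / a) + y ω / s ω with hF
  set G : ℕ → Ω → ℝ := fun j ω => min (lossFloor a (h ω) (1 / ((j : ℝ) + 1) * E ω) (y ω)) j with hG
  have hF0 : ∀ ω, 0 ≤ F ω := fun ω => add_nonneg (Real.log_nonneg ((one_le_div ha).2 (hs ω)))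
    (div_nonneg (hy ω) (ha.le.trans (hs ω)))
  have hFm : Measurable F := (hsm.div_const a).log.add (hym.div hsm)
  have hFi : Integrable F μ := by
    refine (lintegral_ofReal_ne_top_iff_integrable hFm.aestronglyMeasurable
      (ae_of_all _ hF0)).1 hlt.ne_top
  have hG0 : ∀ j ω, 0 ≤ G j ω := fun j ω => le_min (lossFloor_nonneg ha (hh ω)
    (mul_nonneg (by positivity) (hE ω)) (hy ω)) (Nat.cast_nonneg j)
  have hGm : ∀ j, Measurable (G j) := by
    intro j
    refine Measurable.min ?_ measurable_const
    exact (((hhm.sub (hEm.const_mul _)).max measurable_const).div_const a).log.add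
      (hym.div (hhm.add (hEm.const_mul _)))
  have hGi : ∀ j, Integrable (G j) μ := fun j =>
    Integrable.of_bound (hGm j).aestronglyMeasurable (j : ℝ) (ae_of_all _ fun ω => by
      rw [Real.norm_of_nonneg (hG0 j ω)]
      exact min_le_right _ _)
  have hlim : ∀ ω, Tendsto (fun j => G j ω) atTop (𝓝 (Real.log (h ω / a) + y ω / h ω)) := by
    intro ω
    have h1 : Tendsto (fun j : ℕ => 1 / ((j : ℝ) + 1) * E ω) atTop (𝓝 0) := by
      simpa using (tendsto_one_div_add_atTop_nhds_zero_nat (𝕜 := ℝ)).mul_const (E ω)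
    have h2 := (continuousAt_lossFloor ha (hh ω) (y ω)).tendsto.comp h1
    rw [lossFloor_zero (hh ω)] at h2
    refine h2.congr' ?_
    have h3 : ∀ᶠ j : ℕ in atTop, lossFloor a (h ω) (1 / ((j : ℝ) + 1) * E ω) (y ω) ≤ j := by
      filter_upwards [h2.eventually_le_const (lt_add_one _),
        tendsto_natCast_atTop_atTop.eventually_ge_atTop
          (Real.log (h ω / a) + y ω / h ω + 1)] with j h4 h5
      exact h4.trans h5
    filter_upwards [h3] with j hj
    exact (min_eq_left hj).symm
  have hfatou : ∫⁻ ω, ENNReal.ofReal (Real.log (h ω / a) + y ω / h ω) ∂μ ≤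
      liminf (fun j => ∫⁻ ω, ENNReal.ofReal (G j ω) ∂μ) atTop := by
    refine le_trans (le_of_eq (lintegral_congr fun ω => ?_))
      (lintegral_liminf_le fun j => (hGm j).ennreal_ofReal)
    exact ((ENNReal.continuous_ofReal.tendsto _).comp (hlim ω)).liminf_eq.symm
  obtain ⟨j, hj⟩ := (eventually_lt_of_lt_liminf (hlt.trans_le hfatou)).exists
  refine ⟨1 / ((j : ℝ) + 1), by positivity, j, hFi.sub (hGi j), ?_⟩
  have hlt' : ∫ ω, F ω ∂μ < ∫ ω, G j ω ∂μ := by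
    rw [← ofReal_integral_eq_lintegral_ofReal hFi (ae_of_all _ hF0),
      ← ofReal_integral_eq_lintegral_ofReal (hGi j) (ae_of_all _ (hG0 j))] at hj
    exact (ENNReal.ofReal_lt_ofReal_iff_of_nonneg (integral_nonneg hF0)).1 hj
  have h1 : ∫ ω, (F ω - G j ω) ∂μ = ∫ ω, F ω ∂μ - ∫ ω, G j ω ∂μ := integral_sub hFi (hGi j)
  change ∫ ω, (F ω - G j ω) ∂μ < 0
  rw [h1]
  linarith

/-! ### Local comparison of losses along the path -/

namespace AGARCHParam

variable {p q : ℕ}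

theorem statVol_add (θ : AGARCHParam p q) (x : ℤ → ℝ) (s t : ℤ) :
    θ.statVol (fun u => x (u + t)) s = θ.statVol x (s + t) := by
  unfold statVol
  congr 1
  refine tsum_congr fun k => ?_
  beta_reduce
  rw [show s - 1 - (k : ℤ) + t = s + t - 1 - k by ring]

theorem pathDom_add (ρ : ℝ) (x : ℤ → ℝ) (s t : ℤ) :
    pathDom ρ (fun u => x (u + t)) s = pathDom ρ x (s + t) := by
  unfold pathDom
  refine tsum_congr fun k => ?_
  beta_reduce
  rw [show s - 1 - (k : ℤ) + t = s + t - 1 - k by ring]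

/-- An upper bound of the contribution of time zero to the difference of the losses at `θ₀` and at
`θ`, uniform over `θ` near `θ₁`; the loss at `θ` is truncated at `J`. -/
def lossGap (θ₀ θ₁ : AGARCHParam p q) (a ρ η J : ℝ) (x : ℤ → ℝ) : ℝ :=
  Real.log (θ₀.statVol x 0 / a) + x 0 ^ 2 / θ₀.statVol x 0 -
    min (lossFloor a (θ₁.statVol x 0) (η * pathDom ρ x 0) (x 0 ^ 2)) J

theorem measurable_lossGap (θ₀ θ₁ : AGARCHParam p q) (a ρ η J : ℝ) :
    Measurable (lossGap θ₀ θ₁ a ρ η J) := by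
  have hx : ∀ s : ℤ, Measurable fun x : ℤ → ℝ => x s := fun s => measurable_pi_apply s
  have m0 : ∀ θ : AGARCHParam p q, Measurable fun x : ℤ → ℝ => θ.statVol x 0 := fun θ =>
    measurable_statVol (X := fun s (x : ℤ → ℝ) => x s) θ fun k => hx _
  have m1 : Measurable fun x : ℤ → ℝ => pathDom ρ x 0 :=
    measurable_pathDom (X := fun s (x : ℤ → ℝ) => x s) ρ fun k => hx _
  refine (((m0 θ₀).div_const a).log.add (((hx 0).pow_const 2).div (m0 θ₀))).sub
    (Measurable.min ?_ measurable_const)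
  exact ((((m0 θ₁).sub (m1.const_mul _)).max measurable_const).div_const a).log.add
    (((hx 0).pow_const 2).div ((m0 θ₁).add (m1.const_mul _)))

theorem lossGap_shift (θ₀ θ₁ : AGARCHParam p q) (a ρ η J : ℝ) (x : ℤ → ℝ) (t : ℤ) :
    lossGap θ₀ θ₁ a ρ η J (fun u => x (u + t)) =
      Real.log (θ₀.statVol x t / a) + x t ^ 2 / θ₀.statVol x t -
        min (lossFloor a (θ₁.statVol x t) (η * pathDom ρ x t) (x t ^ 2)) J := by
  unfold lossGap
  rw [statVol_add, statVol_add, pathDom_add]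
  simp only [zero_add]

/-- The summands of the difference of the losses. -/
theorem UnifBounds.sub_le_lossGap {K : Set (AGARCHParam p q)} {a A ρ : ℝ}
    (h : UnifBounds K a A ρ) {θ₀ θ₁ θ : AGARCHParam p q} (hθ₀ : θ₀ ∈ K) (hθ : θ ∈ K)
    {ρ' η : ℝ} (J : ℝ) {x : ℤ → ℝ} {t : ℤ}
    (hd : |θ.statVol x t - θ₁.statVol x t| ≤ η * pathDom ρ' x t) :
    (x t ^ 2 / θ₀.statVol x t + Real.log (θ₀.statVol x t)) -
      (x t ^ 2 / θ.statVol x t + Real.log (θ.statVol x t)) ≤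
      lossGap θ₀ θ₁ a ρ' η J (fun u => x (u + t)) := by
  have ha := h.a_pos
  have hu := h.le_statVol hθ x t
  have hu₀ := h.le_statVol hθ₀ x t
  have hfl := lossFloor_le ha hu (sq_nonneg (x t)) hd
  rw [lossGap_shift]
  rw [Real.log_div (ha.trans_le hu).ne' ha.ne'] at hfl
  rw [Real.log_div (ha.trans_le hu₀).ne' ha.ne']
  have := min_le_left (lossFloor a (θ₁.statVol x t) (η * pathDom ρ' x t) (x t ^ 2)) J
  linarith

theorem pathDom_nonneg {ρ : ℝ} (hρ : 0 ≤ ρ) (x : ℤ → ℝ) (t : ℤ) : 0 ≤ pathDom ρ x t :=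
  tsum_nonneg fun k => by positivity

end AGARCHParam

namespace IsStationaryAGARCH

open AGARCHParam

variable {Ω : Type*} [MeasurableSpace Ω] {μ : Measure Ω} {p q : ℕ}
  {θ₀ : AGARCHParam p q} {Z X σ : ℤ → Ω → ℝ} {K : Set (AGARCHParam p q)} {a A ρ : ℝ}

theorem lintegral_sq_noise (h : IsStationaryAGARCH μ θ₀ Z X σ) :
    ∫⁻ ω, ENNReal.ofReal (Z 0 ω ^ 2) ∂μ = 1 := by
  rw [← ofReal_integral_eq_lintegral_ofReal (h.integrable_sq_noise 0)
    (ae_of_all _ fun ω => sq_nonneg _), h.noise.secondMoment, ENNReal.ofReal_one]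

variable [IsProbabilityMeasure μ]

/-- The squared innovation has unit mean and is independent of the volatilities. -/
theorem lintegral_sq_obs_div_statVol (h : IsStationaryAGARCH μ θ₀ Z X σ)
    (hK : UnifBounds K a A ρ) (hθ₀ : θ₀ ∈ K) (hp : 0 < p) (θ : AGARCHParam p q) :
    ∫⁻ ω, ENNReal.ofReal (X 0 ω ^ 2 / θ.statVol (fun s => X s ω) 0) ∂μ =
      ∫⁻ ω, ENNReal.ofReal (θ₀.statVol (fun s => X s ω) 0 / θ.statVol (fun s => X s ω) 0) ∂μ := by
  obtain ⟨g, hgm, hg⟩ := h.exists_noisePast_statVol θ (s := 0) (t := -1) (by omega)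
  obtain ⟨g₀, hgm₀, hg₀⟩ := h.exists_noisePast_statVol θ₀ (s := 0) (t := -1) (by omega)
  have hm : ∀ θ : AGARCHParam p q, Measurable fun ω => θ.statVol (fun s => X s ω) 0 := fun θ =>
    measurable_statVol θ fun k => h.measurable_obs _
  have hind : IndepFun (Z 0) (fun ω => θ₀.statVol (fun s => X s ω) 0 /
      θ.statVol (fun s => X s ω) 0) μ := by
    refine h.indepFun_of_measurable (measurable_noiseFuture (by omega)) (hgm₀.div hgm) ?_
    filter_upwards [hg, hg₀] with ω h1 h2
    rw [h1, h2, Pi.div_apply]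
  have hφ : Measurable fun x : ℝ => ENNReal.ofReal (x ^ 2) := by fun_prop
  have hmul := lintegral_mul_eq_lintegral_mul_lintegral_of_indepFun''
    (hφ.comp (h.noise.measurable 0)).aemeasurable
    (ENNReal.measurable_ofReal.comp ((hm θ₀).div (hm θ))).aemeasurable
    (hind.comp hφ ENNReal.measurable_ofReal)
  simp only [Function.comp_apply, h.lintegral_sq_noise, one_mul, Pi.div_apply] at hmul
  rw [← hmul]
  refine lintegral_congr_ae ?_
  filter_upwards [h.obs_eq 0, h.ae_sq_vol_eq_statVol hK hθ₀ hp] with ω h1 h2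
  rw [← ENNReal.ofReal_mul (sq_nonneg _), h1, ← h2 0]
  congr 1
  ring

/-- The bound log x ≤ x^κ/κ reduces this to the fractional moment of the volatility. -/
theorem lintegral_log_statVol_ne_top (h : IsStationaryAGARCH μ θ₀ Z X σ)
    (hK : UnifBounds K a A ρ) (hθ₀ : θ₀ ∈ K) (hp : 0 < p) :
    ∫⁻ ω, ENNReal.ofReal (Real.log (θ₀.statVol (fun s => X s ω) 0 / a)) ∂μ ≠ ⊤ := by
  obtain ⟨κ, hκ0, hκ1, hσ⟩ := h.exists_lintegral_vol_rpow_ne_top (hK.subset hθ₀) hp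
  have ha := hK.a_pos
  refine ne_top_of_le_ne_top (b := ∫⁻ ω, ENNReal.ofReal ((a ^ κ)⁻¹ / κ) *
    ENNReal.ofReal (σ 0 ω ^ 2) ^ κ ∂μ) ?_ (lintegral_mono_ae ?_)
  · rw [lintegral_const_mul' _ _ ENNReal.ofReal_ne_top]
    exact ENNReal.mul_ne_top ENNReal.ofReal_ne_top hσ
  · filter_upwards [h.ae_sq_vol_eq_statVol hK hθ₀ hp] with ω hω
    rw [← hω 0, ENNReal.ofReal_rpow_of_nonneg (sq_nonneg _) hκ0.le,
      ← ENNReal.ofReal_mul (by positivity)]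
    refine ENNReal.ofReal_le_ofReal ?_
    refine (Real.log_le_rpow_div (by positivity) hκ0).trans_eq ?_
    rw [Real.div_rpow (sq_nonneg _) ha.le]
    field_simp

/-- The limiting criterion is uniquely minimized at the true parameter. -/
theorem lintegral_loss_lt (h : IsStationaryAGARCH μ θ₀ Z X σ)
    (hK : UnifBounds K a A ρ) (hθ₀ : θ₀ ∈ K) (hp : 0 < p) {θ : AGARCHParam p q} (hθ : θ ∈ K)
    (hne : ¬ ∀ᵐ ω ∂μ, θ.statVol (fun s => X s ω) 0 = θ₀.statVol (fun s => X s ω) 0) :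
    ∫⁻ ω, ENNReal.ofReal (Real.log (θ₀.statVol (fun s => X s ω) 0 / a) +
        X 0 ω ^ 2 / θ₀.statVol (fun s => X s ω) 0) ∂μ <
      ∫⁻ ω, ENNReal.ofReal (Real.log (θ.statVol (fun s => X s ω) 0 / a) +
        X 0 ω ^ 2 / θ.statVol (fun s => X s ω) 0) ∂μ := by
  have ha := hK.a_pos
  have hm : ∀ θ : AGARCHParam p q, Measurable fun ω => θ.statVol (fun s => X s ω) 0 := fun θ =>
    measurable_statVol θ fun k => h.measurable_obs _
  have hle : ∀ θ ∈ K, ∀ ω, a ≤ θ.statVol (fun s => X s ω) 0 := fun θ hθ ω => hK.le_statVol hθ _ _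
  -- X_0² is replaced by h_0(θ₀), its conditional mean given the past. The division by `a` keeps the
  -- logarithm nonnegative, so that all means make sense in [0, ∞].
  have key : ∀ θ ∈ K, ∫⁻ ω, ENNReal.ofReal (Real.log (θ.statVol (fun s => X s ω) 0 / a) +
        X 0 ω ^ 2 / θ.statVol (fun s => X s ω) 0) ∂μ =
      ∫⁻ ω, ENNReal.ofReal (Real.log (θ.statVol (fun s => X s ω) 0 / a) +
        θ₀.statVol (fun s => X s ω) 0 / θ.statVol (fun s => X s ω) 0) ∂μ := by
    intro θ hθ
    have hlog : ∀ ω, 0 ≤ Real.log (θ.statVol (fun s => X s ω) 0 / a) := fun ω =>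
      Real.log_nonneg ((one_le_div ha).2 (hle θ hθ ω))
    have e1 : ∀ ω, ENNReal.ofReal (Real.log (θ.statVol (fun s => X s ω) 0 / a) +
        X 0 ω ^ 2 / θ.statVol (fun s => X s ω) 0) =
        ENNReal.ofReal (Real.log (θ.statVol (fun s => X s ω) 0 / a)) +
        ENNReal.ofReal (X 0 ω ^ 2 / θ.statVol (fun s => X s ω) 0) := fun ω =>
      ENNReal.ofReal_add (hlog ω) (div_nonneg (sq_nonneg _) (ha.le.trans (hle θ hθ ω)))
    have e2 : ∀ ω, ENNReal.ofReal (Real.log (θ.statVol (fun s => X s ω) 0 / a) +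
        θ₀.statVol (fun s => X s ω) 0 / θ.statVol (fun s => X s ω) 0) =
        ENNReal.ofReal (Real.log (θ.statVol (fun s => X s ω) 0 / a)) +
        ENNReal.ofReal (θ₀.statVol (fun s => X s ω) 0 / θ.statVol (fun s => X s ω) 0) := fun ω =>
      ENNReal.ofReal_add (hlog ω)
        (div_nonneg (ha.le.trans (hle θ₀ hθ₀ ω)) (ha.le.trans (hle θ hθ ω)))
    have hlm : Measurable fun ω => ENNReal.ofReal (Real.log (θ.statVol (fun s => X s ω) 0 / a)) :=
      ((hm θ).div_const a).log.ennreal_ofReal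
    simp only [e1, e2]
    rw [lintegral_add_left hlm, lintegral_add_left hlm,
      h.lintegral_sq_obs_div_statVol hK hθ₀ hp θ]
  rw [key θ₀ hθ₀, key θ hθ]
  have hself : ∀ ω, θ₀.statVol (fun s => X s ω) 0 / θ₀.statVol (fun s => X s ω) 0 = 1 := fun ω =>
    div_self (ha.trans_le (hle θ₀ hθ₀ ω)).ne'
  -- With r = h_0(θ₀)/h_0(θ) the comparison of the integrands becomes log r ≤ r - 1, strict unless r
  -- = 1.
  have hsplit : ∀ ω, Real.log (θ₀.statVol (fun s => X s ω) 0 / a) =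
      Real.log (θ.statVol (fun s => X s ω) 0 / a) +
      Real.log (θ₀.statVol (fun s => X s ω) 0 / θ.statVol (fun s => X s ω) 0) := by
    intro ω
    have h1 := ha.trans_le (hle θ₀ hθ₀ ω)
    have h2 := ha.trans_le (hle θ hθ ω)
    rw [Real.log_div h1.ne' ha.ne', Real.log_div h2.ne' ha.ne', Real.log_div h1.ne' h2.ne']
    ring
  simp only [hself]
  refine lintegral_strict_mono_of_ae_le_of_frequently_ae_lt
    (((hm θ).div_const a).log.add ((hm θ₀).div (hm θ))).ennreal_ofReal.aemeasurable ?_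
    (ae_of_all _ fun ω => ?_) ?_
  · have e1 : ∀ ω, ENNReal.ofReal (Real.log (θ₀.statVol (fun s => X s ω) 0 / a) + 1) =
        ENNReal.ofReal (Real.log (θ₀.statVol (fun s => X s ω) 0 / a)) + 1 := fun ω => by
      rw [ENNReal.ofReal_add (Real.log_nonneg ((one_le_div ha).2 (hle θ₀ hθ₀ ω))) zero_le_one,
        ENNReal.ofReal_one]
    simp only [e1]
    rw [lintegral_add_right _ measurable_const, lintegral_const, measure_univ, mul_one]
    exact ENNReal.add_ne_top.2 ⟨h.lintegral_log_statVol_ne_top hK hθ₀ hp, ENNReal.one_ne_top⟩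
  · have hr := div_pos (ha.trans_le (hle θ₀ hθ₀ ω)) (ha.trans_le (hle θ hθ ω))
    refine ENNReal.ofReal_le_ofReal ?_
    rw [hsplit]
    linarith [Real.log_le_sub_one_of_pos hr]
  · refine (not_eventually.1 hne).mono fun ω hω heq => hω ?_
    have h1 := ha.trans_le (hle θ₀ hθ₀ ω)
    have h2 := ha.trans_le (hle θ hθ ω)
    have hr := div_pos h1 h2
    by_contra hω'
    have hr1 : θ₀.statVol (fun s => X s ω) 0 / θ.statVol (fun s => X s ω) 0 ≠ 1 := by
      rw [Ne, div_eq_one_iff_eq h2.ne']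
      exact fun h => hω' h.symm
    have hstrict := Real.log_lt_sub_one_of_pos hr hr1
    rw [hsplit] at heq
    have hlog : 0 ≤ Real.log (θ.statVol (fun s => X s ω) 0 / a) :=
      Real.log_nonneg ((one_le_div ha).2 (hle θ hθ ω))
    have hlog₀ : 0 ≤ Real.log (θ₀.statVol (fun s => X s ω) 0 / a) :=
      Real.log_nonneg ((one_le_div ha).2 (hle θ₀ hθ₀ ω))
    rw [hsplit] at hlog₀
    rw [ENNReal.ofReal_eq_ofReal_iff (by linarith) (by linarith)] at heq
    linarith

/-- Near a parameter other than the true one the likelihood is eventually smaller than at the true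
parameter. -/
theorem exists_nhdsWithin_logLik_lt (h : IsStationaryAGARCH μ θ₀ Z X σ)
    (hK : UnifBounds K a A ρ) (hθ₀ : θ₀ ∈ K) (hp : 0 < p) {ς : Fin q → ℝ} (hς : ∀ j, 0 ≤ ς j)
    {θ₁ : AGARCHParam p q} (hθ₁ : θ₁ ∈ K)
    (hne : ¬ ∀ᵐ ω ∂μ, θ₁.statVol (fun s => X s ω) 0 = θ₀.statVol (fun s => X s ω) 0) :
    ∃ V ∈ 𝓝[K] θ₁, ∀ᵐ ω ∂μ, ∀ᶠ n in atTop, ∀ θ ∈ V, θ ∈ K →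
      logLik ς (fun t => X t ω) n θ < logLik ς (fun t => X t ω) n θ₀ := by
  have ha := hK.a_pos
  obtain ⟨ρ', hρ', hρ'1⟩ := exists_between hK.rho_lt_one
  have hρ'0 := hK.rho_pos.trans hρ'
  obtain ⟨η, hη, J, hint, hneg⟩ := exists_integrable_sub_lossFloor (μ := μ)
    (s := fun ω => θ₀.statVol (fun s => X s ω) 0) (h := fun ω => θ₁.statVol (fun s => X s ω) 0)
    (y := fun ω => X 0 ω ^ 2) (E := fun ω => pathDom ρ' (fun s => X s ω) 0)
    (measurable_statVol θ₀ fun k => h.measurable_obs _)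
    (measurable_statVol θ₁ fun k => h.measurable_obs _)
    ((h.measurable_obs 0).pow_const 2) (measurable_pathDom ρ' fun k => h.measurable_obs _) ha
    (fun ω => hK.le_statVol hθ₀ _ _) (fun ω => hK.le_statVol hθ₁ _ _) (fun ω => sq_nonneg _)
    (fun ω => pathDom_nonneg hρ'0.le _ _) (h.lintegral_loss_lt hK hθ₀ hp hθ₁ hne)
  set I := ∫ ω, lossGap θ₀ θ₁ a ρ' η J (fun s => X s ω) ∂μ with hI
  have hI0 : I < 0 := hneg
  set g : (ℤ → ℝ × ℝ) → ℝ := fun w => lossGap θ₀ θ₁ a ρ' η J fun s => (w s).1 with hg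
  have hgm : Measurable g := (measurable_lossGap θ₀ θ₁ a ρ' η J).comp
    (measurable_pi_lambda _ fun s => measurable_fst.comp (measurable_pi_apply s))
  have hid := h.identDistrib_pathShift hgm 1
  have hgi : Integrable (fun ω => g (pathShift 1 fun t => (X t ω, σ t ω))) μ :=
    hid.integrable_iff.2 hint
  have hgI : ∫ ω, g (pathShift 1 fun t => (X t ω, σ t ω)) ∂μ = I := hid.integral_eq
  -- Half of the negative mean is held back: sums of g - I/2 are bounded above, so sums of g tend to
  -- -∞ linearly and beat the bounded effect of the initial values. The shift by one matches the
  -- likelihood, whose first observation is at time one.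
  have hbdd := h.ae_bddAbove_sum (f := fun w => g (pathShift 1 w) - I / 2)
    ((hgm.comp (measurable_pathShift 1)).sub_const _) (hgi.sub (integrable_const _)) (by
      rw [integral_sub hgi (integrable_const _), hgI, integral_const, probReal_univ, one_smul]
      linarith)
  refine ⟨_, hK.eventually_abs_statVol_sub_le hρ' hθ₁ hη, ?_⟩
  filter_upwards [hbdd, h.ae_temperedPath (hK.subset hθ₀) hp hρ'0 hρ'1,
    h.ae_summable_obs (hK.subset hθ₀) hp hK.rho_pos hK.rho_lt_one fun k => k + 1]
    with ω ⟨C, hC⟩ htemp hfwd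
  obtain ⟨C', hC'⟩ := hK.exists_abs_logLik_add_statLoss_le hς (htemp.mono hK.rho_pos.le hρ'.le) hfwd
  have hlim : Tendsto (fun n : ℕ => (n : ℝ) * (-(I / 2))) atTop atTop :=
    tendsto_natCast_atTop_atTop.atTop_mul_const (by linarith)
  filter_upwards [hlim.eventually_gt_atTop (C + 2 * C')] with n hn θ hθV hθ
  have hsum : θ₀.statLoss (fun t => X t ω) n - θ.statLoss (fun t => X t ω) n ≤
      ∑ k ∈ Finset.range n, g (pathShift 1 (pathShift k fun t => (X t ω, σ t ω))) := by
    unfold statLoss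
    rw [← Finset.sum_sub_distrib]
    refine Finset.sum_le_sum fun k _ => ?_
    have hgk : g (pathShift 1 (pathShift k fun t => (X t ω, σ t ω))) =
        lossGap θ₀ θ₁ a ρ' η J (fun u => X (u + (k + 1)) ω) := by
      simp only [hg, pathShift]
      congr 1
      funext u
      rw [add_assoc, add_comm 1]
    rw [hgk]
    exact hK.sub_le_lossGap hθ₀ hθ J (x := fun s => X s ω) (hθV _ htemp (k + 1))
  have hCn := hC n
  rw [Finset.sum_sub_distrib, Finset.sum_const, Finset.card_range, nsmul_eq_mul] at hCn
  have h1 := (abs_le.1 (hC' θ hθ n)).2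
  have h2 := (abs_le.1 (hC' θ₀ hθ₀ n)).1
  linarith

/-- Outside every neighbourhood of the true parameter the likelihood is eventually smaller than at
the true parameter. -/
theorem ae_eventually_logLik_lt (h : IsStationaryAGARCH μ θ₀ Z X σ) (hKc : IsCompact K)
    (hK : UnifBounds K a A ρ) (hθ₀ : θ₀ ∈ K) (hp : 0 < p) {ς : Fin q → ℝ} (hς : ∀ j, 0 ≤ ς j)
    (hident : ∀ θ ∈ K, (∀ᵐ ω ∂μ, θ.statVol (fun s => X s ω) 0 = θ₀.statVol (fun s => X s ω) 0) →
      θ = θ₀) {U : Set (AGARCHParam p q)} (hU : IsOpen U) (hU₀ : θ₀ ∈ U) :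
    ∀ᵐ ω ∂μ, ∀ᶠ n in atTop, ∀ θ ∈ K \ U,
      logLik ς (fun t => X t ω) n θ < logLik ς (fun t => X t ω) n θ₀ := by
  -- The property passes to subsets and finite unions, so by compactness it suffices near each
  -- point. The repeated condition `θ ∈ K` is kept because the sets in the induction need not lie in
  -- K.
  have key : ∀ᵐ ω ∂μ, ∀ᶠ n in atTop, ∀ θ ∈ K \ U, θ ∈ K →
      logLik ς (fun t => X t ω) n θ < logLik ς (fun t => X t ω) n θ₀ := by
    refine (hKc.diff hU).induction_on (p := fun S => ∀ᵐ ω ∂μ, ∀ᶠ n in atTop, ∀ θ ∈ S, θ ∈ K →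
      logLik ς (fun t => X t ω) n θ < logLik ς (fun t => X t ω) n θ₀) ?_ ?_ ?_ ?_
    · exact ae_of_all _ fun ω => Eventually.of_forall fun n θ hθ => absurd hθ (Set.notMem_empty θ)
    · intro S T hST hT
      filter_upwards [hT] with ω hω
      exact hω.mono fun n hn θ hθ => hn θ (hST hθ)
    · intro S T hS hT
      filter_upwards [hS, hT] with ω h1 h2
      filter_upwards [h1, h2] with n h3 h4 θ hθ hθK
      exact hθ.elim (fun hθ => h3 θ hθ hθK) fun hθ => h4 θ hθ hθK
    · intro θ₁ hθ₁
      obtain ⟨V, hV, hV'⟩ := h.exists_nhdsWithin_logLik_lt hK hθ₀ hp hς hθ₁.1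
        fun heq => hθ₁.2 (hident θ₁ hθ₁.1 heq ▸ hU₀)
      exact ⟨V, nhdsWithin_mono _ Set.sdiff_subset hV, hV'⟩
  filter_upwards [key] with ω hω
  exact hω.mono fun n hn θ hθ => hn θ hθ hθ.1

end IsStationaryAGARCH

end

/-! ### Strong consistency -/

theorem theorem5p5 {Ω : Type*} [MeasurableSpace Ω] (μ : Measure Ω) [IsProbabilityMeasure μ]
    (p q : ℕ) (θ₀ : AGARCHParam p q) (Z X σ : ℤ → Ω → ℝ)
    (hX : IsStationaryAGARCH μ θ₀ Z X σ)
    -- some `α_i°`, `i = 1, …, p`, is positive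
    (hα : ∃ i : Fin p, 0 < θ₀.alpha i)
    -- `(α_p°, β_q°) ≠ (0, 0)`
    (hlast : q = 0 ∨ (∃ i : Fin p, (i : ℕ) + 1 = p ∧ θ₀.alpha i ≠ 0) ∨
      (∃ j : Fin q, (j : ℕ) + 1 = q ∧ θ₀.beta j ≠ 0))
    -- no common zeros
    (hcoprime : ¬ ∃ z : ℂ, θ₀.aPoly z = 0 ∧ θ₀.bPoly z = 0)
    -- the law of `Z_0` is not concentrated at two points
    (hZ : ¬ ∃ a b : ℝ, ∀ᵐ ω ∂μ, Z 0 ω = a ∨ Z 0 ω = b)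
    (K : Set (AGARCHParam p q)) (hK : IsCompact K) (hKsub : K ⊆ AGARCHParam.space p q)
    (hθ₀ : θ₀ ∈ K)
    -- the initial value of the volatility recursion
    (ς : Fin q → ℝ) (hς : ∀ j, 0 ≤ ς j) :
    (∀ n ω, ∃ θ, AGARCHParam.IsQMLE K ς (fun t => X t ω) n θ) ∧
    ∀ θhat : ℕ → Ω → AGARCHParam p q,
      (∀ n ≥ 1, ∀ᵐ ω ∂μ, AGARCHParam.IsQMLE K ς (fun t => X t ω) n (θhat n ω)) →
      ∀ᵐ ω ∂μ, Tendsto (fun n => θhat n ω) atTop (𝓝 θ₀) := by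
  obtain ⟨a, A, ρ, hKb⟩ := AGARCHParam.exists_unifBounds hK ⟨θ₀, hθ₀⟩ hKsub
  have hp : 0 < p := hα.choose.pos
  refine ⟨fun n ω => AGARCHParam.exists_isQMLE hK ⟨θ₀, hθ₀⟩ hKsub hς _ n, fun θhat hmax => ?_⟩
  -- Countably many balls form a neighbourhood basis, so the exceptional null sets can be united. A
  -- maximizer outside one of these balls would eventually be beaten by θ₀.
  have hev := ae_all_iff.2 fun m : ℕ => hX.ae_eventually_logLik_lt hK hKb hθ₀ hp hς
    (fun θ hθ heq => hX.eq_of_ae_statVol_eq hKb hθ₀ hθ hα hlast hcoprime hZ heq)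
    (Metric.isOpen_ball (x := θ₀) (ε := 1 / ((m : ℝ) + 1))) (Metric.mem_ball_self (by positivity))
  have hmax' : ∀ᵐ ω ∂μ, ∀ n : ℕ, 1 ≤ n →
      AGARCHParam.IsQMLE K ς (fun t => X t ω) n (θhat n ω) :=
    ae_all_iff.2 fun n => by
      by_cases hn : 1 ≤ n
      · filter_upwards [hmax n hn] with ω hω _ using hω
      · exact ae_of_all _ fun ω h => absurd h hn
  filter_upwards [hev, hmax'] with ω h1 h2
  refine Metric.nhds_basis_ball_inv_nat_succ.tendsto_right_iff.2 fun m _ => ?_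
  filter_upwards [h1 m, eventually_ge_atTop 1] with n hn hn1
  by_contra hnot
  obtain ⟨hmem, hopt⟩ := h2 n hn1
  exact absurd (hopt hθ₀) (not_le.2 (hn _ ⟨hmem, hnot⟩))
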